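/- **Setting.** Let $(X_0,Y_0)$ be a random pair in $\mathbb R^p\times\mathbb R$ and let $(X_i,Y_i)$, $i=1,\dots,n$, be i.i.d. copies of it. Let $\phi(a,b)$ be a measurable function on $\mathbb R^2$ which is convex and three times differentiable in $b$, and write $\phi_k=\partial^k\phi/\partial b^k$. Let $\bar\beta\in\mathbb R^p$ be a minimizer of $\beta\mapsto\mathbb E[\phi(Y_0,X_0^{\mathrm T}\beta)]$ (these expectations being finite), and let $s_0=\|\bar\beta\|_0\ge 1$ be its number of non-zero entries. Put $\Sigma=\mathbb E[X_0X_0^{\mathrm T}]$, $\Omega^*=\Sigma^{-1}$, $H=\mathbb E[\phi_2(Y_0,X_0^{\mathrm T}\bar\beta)X_0X_0^{\mathrm T}]$, $M^*=H^{-1}$. Let $\xi\in\mathbb R^p$, $\xi\neq0$, with support $S_\xi$, and $V=\mathbb E[(\xi^{\mathrm T}M^*X_0)^2\phi_1^2(Y_0,X_0^{\mathrm T}\bar\beta)]$. Let $0<\rho<1$ and let $J\subset\{1,\dots,n\}$ be a fixed set with complement $J^{\mathrm c}$, $|J|>\rho n$, $|J^{\mathrm c}|>\rho n$. Let $\hat\beta$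 be a random vector (an estimator of $\bar\beta$), and let $\hat M^J$, $\hat M^{J^{\mathrm c}}$ be symmetric $p\times p$ random matrices (estimators of $M^*$) that are measurable functions of $(X_i,Y_i)_{i\in J}$ and of $(X_i,Y_i)_{i\in J^{\mathrm c}}$ respectively. Define $$\widehat{\xi^{\mathrm T}\beta}=\xi^{\mathrm T}\hat\beta-\xi^{\mathrm T}\hat M^{J^{\mathrm c}}\frac1n\sum_{i\in J}X_i\phi_1(Y_i,X_i^{\mathrm T}\hat\beta)-\xi^{\mathrm T}\hat M^{J}\frac1n\sum_{i\in J^{\mathrm c}}X_i\phi_1(Y_i,X_i^{\mathrm T}\hat\beta),$$ $$\hat V=\frac1n\sum_{i\in J}(\xi^{\mathrm T}\hat M^{J^{\mathrm c}}X_i)^2\phi_1^2(Y_i,X_i^{\mathrm T}\hat\beta)+\frac1n\sum_{i\in J^{\mathrm c}}(\xi^{\mathrm T}\hat M^{J}X_i)^2\phi_1^2(Y_i,X_i^{\mathrm T}\hat\beta),$$ and let $\Delta_1,\Delta_2$ be defined by $$\frac{\widehat{\xi^{\mathrm T}\beta}-\xi^{\mathrm T}\bar\beta}{\sqrt V}=-\frac1n\sum_{i=1}^n\frac{(\xi^{\mathrm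 T}M^*X_i)\phi_1(Y_i,X_i^{\mathrm T}\bar\beta)}{\sqrt V}+\Delta_1n^{-1/2},\qquad \frac{\hat V}{V}=1+\Delta_2 .$$ Write $p\vee n=\max\{p,n\}$ and $\tau_n=\log(p\vee n)/\sqrt n$. The sub-gaussian norm of a random variable is $\|z\|_{\psi_2}=\inf\{t>0:\mathbb E\exp(z^2/t^2)\le2\}$, that of a random vector is $\sup_{s\ne0}\|\langle s,Z\rangle/\|s\|_2\|_{\psi_2}$. For a matrix $A$, $\|A\|_2$ and $\|A\|_1$ are the operator norms for the Euclidean and the $\ell^1$ norms, and $A_{\cdot,S_\xi}$ is the submatrix of $A$ formed by the columns with index in $S_\xi$. **Conditions on the estimators.** Let $\delta_1,\delta_2,\delta_3,A_1,A_2$ be real numbers. (B) With probability at least $1-\delta_1$: $\|\hat\beta-\bar\beta\|_1\le C_1s_0\sqrt{\log(p\vee n)/n}$ and $\frac1n\sum_{i=1}^n(X_i^{\mathrm T}\hat\beta-X_i^{\mathrm T}\bar\beta)^2\le C_1s_0\log(p\vee n)/n$. (C) With probability at least $1-\delta_2$: $\|(\hat M^J-M^*)_{\cdot,S_\xi}\|_2\le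 C_2A_1\sqrt{\log(p\vee n)/n}$ and $\|(\hat M^J-M^*)_{\cdot,S_\xi}\|_1\le C_2A_2\sqrt{\log(p\vee n)/n}$; and with probability at least $1-\delta_3$ the same two bounds hold for $\hat M^{J^{\mathrm c}}$. **Assumptions on the population.** (E) The entries of $X_0$ are sub-gaussian with norm at most $\sigma_1$, and $\xi^{\mathrm T}M^*X_0$ is sub-gaussian with norm at most $\sigma_1\|M^*\xi\|_2$. (G) $X_0$ is a sub-gaussian random vector with norm at most $\sigma_1$. (H1) $\lambda_{\min}(\Omega^*)\ge C_3$, $\lambda_{\min}(M^*)\ge C_3$, $\lambda_{\min}(M^*\Sigma M^*)\ge C_3$ and $\lambda_{\max}(M^*)\le C_4$. (H2) $\phi_1(Y_0,X_0^{\mathrm T}\bar\beta)$ is sub-gaussian with norm at most $\sigma_2$, and $\mathbb E[\phi_1^2(Y_0,X_0^{\mathrm T}\bar\beta)\mid X_0]\ge C_5$ almost surely. (H3) Almost surely, $\phi_2(Y_0,X_0^{\mathrm T}\bar\beta)\le C_6$ and $|\phi_3(Y_0,b)|\le C_7$ for all $b\in\mathbb R$. **Theorem.** Let $C_1,\dots,C_7,\sigma_1,\sigma_2>0$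 and $0<\rho<1$, and let $c(\tfrac12),c(\tfrac23),c(1)>0$ be fixed absolute constants (arbitrary; in particular the constants of the concentration inequality for averages of centered $\alpha$-sub-exponential variables, $\alpha=\tfrac12,\tfrac23,1$). There is a constant $C>0$ depending only on these absolute constants and on $(C_1,\dots,C_7,\sigma_1,\sigma_2,\rho)$ such that the following holds in every setting as above that satisfies (B), (C), (H1), (H2) and (H3). (i) If (E) holds, $A_2\frac{\|\xi\|_1}{\|\xi\|_2}\tau_n\le1$ and $s_0\tau_n\le\min\{\frac{c(1)\rho\sqrt n}{3},\frac{c(2/3)n^{1/6}}{4},1\}$, then with probability at least $1-\delta_1-\delta_2-\delta_3-\frac2n-\frac{12}{p\vee n}-2\exp\{-c(\tfrac12)n^{1/3}\}-4\exp\{-\tfrac12\sqrt n\}$, $$|\Delta_1|\le C\Big(A_2\frac{\|\xi\|_1}{\|\xi\|_2}+A_1\sqrt{s_0}+\sqrt{\log n}\,s_0\Big)\tau_n,\qquad |\Delta_2|\le C\Big(n^{-1/3}+\sqrt{s_0}\,\tau_n+A_2\frac{\|\xi\|_1}{\|\xi\|_2}\tau_n\Big).$$ (ii) If (G) holds, $A_1\tau_n\le1$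 and $s_0\tau_n\le\min\{c(1)\rho\sqrt n,\frac{c(1)\sqrt n}{2},\frac{c(2/3)n^{1/6}}{3},1\}$, then with probability at least $1-\delta_1-\delta_2-\delta_3-\frac2n-\frac{20}{p\vee n}-2\exp\{-c(\tfrac12)n^{1/3}\}-4\exp\{-\tfrac12\sqrt n\}$, $$|\Delta_1|\le C\big(A_1\sqrt{s_0}+\sqrt{\log n}\,s_0\big)\tau_n,\qquad |\Delta_2|\le C\big(n^{-1/3}+\sqrt{s_0}\,\tau_n+A_1\tau_n\big).$$ -/

import Mathlib

open MeasureTheory ProbabilityTheory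
open scoped ENNReal Matrix

namespace DebiasedGLM

noncomputable section

/-! ### Vector and matrix norms -/

/-- `‖a‖₁`. -/
def l1Norm {p : ℕ} (a : Fin p → ℝ) : ℝ := ∑ j, |a j|

/-- `‖a‖₂` (Euclidean; the norm instance on `Fin p → ℝ` is the sup norm). -/
def l2Norm {p : ℕ} (a : Fin p → ℝ) : ℝ := Real.sqrt (∑ j, a j ^ 2)

/-- `‖a‖₀`, the number of non-zero entries. -/
def l0Norm {p : ℕ} (a : Fin p → ℝ) : ℕ := (Finset.univ.filter fun j => a j ≠ 0).card

/-- The operator norm of a matrix for the Euclidean norms. -/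
def matNorm2 {ι κ : Type*} [Fintype ι] [Fintype κ] [DecidableEq κ] (A : Matrix ι κ ℝ) : ℝ :=
  ‖LinearMap.toContinuousLinearMap (Matrix.toEuclideanLin A)‖

/-- The operator norm of a matrix for the `ℓ¹` norms: the largest absolute column sum. -/
def matNorm1 {ι κ : Type*} [Fintype ι] (A : Matrix ι κ ℝ) : ℝ :=
  ⨆ j, ∑ i, |A i j|

/-- The block of the columns of `A` whose index lies in the support of `ξ`. -/
def colBlock {p : ℕ} (ξ : Fin p → ℝ) (A : Matrix (Fin p) (Fin p) ℝ) :
    Matrix (Fin p) {j : Fin p // ξ j ≠ 0} ℝ :=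
  A.submatrix id Subtype.val

/-- `c ≤ λ_min(A)` (used for symmetric `A`). -/
def EigenvaluesGE {p : ℕ} (A : Matrix (Fin p) (Fin p) ℝ) (c : ℝ) : Prop :=
  ∀ l : ℝ, Module.End.HasEigenvalue (Matrix.toLin' A) l → c ≤ l

/-- `λ_max(A) ≤ c` (used for symmetric `A`). -/
def EigenvaluesLE {p : ℕ} (A : Matrix (Fin p) (Fin p) ℝ) (c : ℝ) : Prop :=
  ∀ l : ℝ, Module.End.HasEigenvalue (Matrix.toLin' A) l → l ≤ c

/-! ### Sub-gaussian norms -/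

section Prob

variable {Ω : Type*} [MeasurableSpace Ω]

/-- `‖Z‖_{ψ₂} = inf {t > 0 : E exp(Z² / t²) ≤ 2}`, with value `∞` if there is no such `t`. -/
def psi2Norm (μ : Measure Ω) (Z : Ω → ℝ) : ℝ≥0∞ :=
  ⨅ (t : ℝ) (_ : 0 < t ∧ ∫⁻ ω, ENNReal.ofReal (Real.exp (Z ω ^ 2 / t ^ 2)) ∂μ ≤ 2),
    ENNReal.ofReal t

/-- `sup_{s ≠ 0} ‖⟨s, Z⟩ / ‖s‖₂‖_{ψ₂}`. -/
def psi2VecNorm {p : ℕ} (μ : Measure Ω) (Z : Ω → Fin p → ℝ) : ℝ≥0∞ :=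
  ⨆ (s : Fin p → ℝ) (_ : s ≠ 0), psi2Norm μ (fun ω => (s ⬝ᵥ Z ω) / l2Norm s)

/-! ### The loss function and the population quantities -/

/-- `φ_k(a, b) = ∂^k φ(a, b) / ∂b^k`. -/
def dphi (φ : ℝ → ℝ → ℝ) (k : ℕ) (a b : ℝ) : ℝ := iteratedDeriv k (φ a) b

/-- `φ` is (jointly) measurable, and convex and three times differentiable in `b`. -/
structure IsLoss (φ : ℝ → ℝ → ℝ) : Prop where
  measurable : Measurable (Function.uncurry φ)
  convex : ∀ a, ConvexOn ℝ Set.univ (φ a)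
  differentiable : ∀ a, ∀ k < 3, Differentiable ℝ (iteratedDeriv k (φ a))

/-- `β̄` minimizes `β ↦ E[φ(Y₀, X₀ᵀβ)]`, all these expectations being finite. -/
def IsTarget {p : ℕ} (μ : Measure Ω) (φ : ℝ → ℝ → ℝ) (X₀ : Ω → Fin p → ℝ) (Y₀ : Ω → ℝ)
    (βbar : Fin p → ℝ) : Prop :=
  (∀ β : Fin p → ℝ, Integrable (fun ω => φ (Y₀ ω) (X₀ ω ⬝ᵥ β)) μ) ∧
  ∀ β : Fin p → ℝ,
    ∫ ω, φ (Y₀ ω) (X₀ ω ⬝ᵥ βbar) ∂μ ≤ ∫ ω, φ (Y₀ ω) (X₀ ω ⬝ᵥ β) ∂μ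

/-- `Σ = E[X₀ X₀ᵀ]`. -/
def secondMoment {p : ℕ} (μ : Measure Ω) (X₀ : Ω → Fin p → ℝ) : Matrix (Fin p) (Fin p) ℝ :=
  Matrix.of fun j k => ∫ ω, X₀ ω j * X₀ ω k ∂μ

/-- `H = E[φ₂(Y₀, X₀ᵀβ̄) X₀ X₀ᵀ]`. -/
def hessian {p : ℕ} (μ : Measure Ω) (φ : ℝ → ℝ → ℝ) (X₀ : Ω → Fin p → ℝ) (Y₀ : Ω → ℝ)
    (βbar : Fin p → ℝ) : Matrix (Fin p) (Fin p) ℝ :=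
  Matrix.of fun j k => ∫ ω, dphi φ 2 (Y₀ ω) (X₀ ω ⬝ᵥ βbar) * (X₀ ω j * X₀ ω k) ∂μ

/-- `M* = H⁻¹`. -/
def Mstar {p : ℕ} (μ : Measure Ω) (φ : ℝ → ℝ → ℝ) (X₀ : Ω → Fin p → ℝ) (Y₀ : Ω → ℝ)
    (βbar : Fin p → ℝ) : Matrix (Fin p) (Fin p) ℝ :=
  (hessian μ φ X₀ Y₀ βbar)⁻¹

/-- `V = E[(ξᵀ M* X₀)² φ₁(Y₀, X₀ᵀβ̄)²]`. -/
def asympVar {p : ℕ} (μ : Measure Ω) (φ : ℝ → ℝ → ℝ) (X₀ : Ω → Fin p → ℝ) (Y₀ : Ω → ℝ)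
    (βbar ξ : Fin p → ℝ) : ℝ :=
  ∫ ω, (ξ ⬝ᵥ (Mstar μ φ X₀ Y₀ βbar *ᵥ X₀ ω)) ^ 2 *
    dphi φ 1 (Y₀ ω) (X₀ ω ⬝ᵥ βbar) ^ 2 ∂μ

/-! ### The sample and the estimators -/

/-- `(X_i, Y_i)`, `i = 1, …, n`, are i.i.d. copies of `(X₀, Y₀)`. -/
structure IsIIDSample {n p : ℕ} (μ : Measure Ω) (X₀ : Ω → Fin p → ℝ) (Y₀ : Ω → ℝ)
    (X : Fin n → Ω → Fin p → ℝ) (Y : Fin n → Ω → ℝ) : Prop where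
  measurable_X₀ : Measurable X₀
  measurable_Y₀ : Measurable Y₀
  measurable_X : ∀ i, Measurable (X i)
  measurable_Y : ∀ i, Measurable (Y i)
  indep : iIndepFun (fun i ω => (X i ω, Y i ω)) μ
  identDistrib : ∀ i, IdentDistrib (fun ω => (X i ω, Y i ω)) (fun ω => (X₀ ω, Y₀ ω)) μ μ

/-- The random matrix `M` is computed from the subsample `(X_i, Y_i)`, `i ∈ J`. -/
def BasedOn {n p : ℕ} (X : Fin n → Ω → Fin p → ℝ) (Y : Fin n → Ω → ℝ) (J : Finset (Fin n))
    (M : Ω → Matrix (Fin p) (Fin p) ℝ) : Prop :=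
  ∀ j k, Measurable[⨆ i ∈ J, MeasurableSpace.comap (fun ω => (X i ω, Y i ω)) inferInstance]
    (fun ω => M ω j k)

/-- The cross-fitted debiased estimator of `ξᵀβ̄`; `MJ`, `MJc` are the estimators of `M*` from
the subsamples `J`, `Jᶜ`. -/
def debiased {n p : ℕ} (φ : ℝ → ℝ → ℝ) (ξ : Fin p → ℝ) (X : Fin n → Ω → Fin p → ℝ)
    (Y : Fin n → Ω → ℝ) (J : Finset (Fin n)) (βhat : Ω → Fin p → ℝ)
    (MJ MJc : Ω → Matrix (Fin p) (Fin p) ℝ) (ω : Ω) : ℝ :=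
  ξ ⬝ᵥ βhat ω
    - ξ ⬝ᵥ (MJc ω *ᵥ ((1 / (n : ℝ)) •
        ∑ i ∈ J, dphi φ 1 (Y i ω) (X i ω ⬝ᵥ βhat ω) • X i ω))
    - ξ ⬝ᵥ (MJ ω *ᵥ ((1 / (n : ℝ)) •
        ∑ i ∈ Jᶜ, dphi φ 1 (Y i ω) (X i ω ⬝ᵥ βhat ω) • X i ω))

/-- The cross-fitted variance estimator `V̂`. -/
def varEst {n p : ℕ} (φ : ℝ → ℝ → ℝ) (ξ : Fin p → ℝ) (X : Fin n → Ω → Fin p → ℝ)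
    (Y : Fin n → Ω → ℝ) (J : Finset (Fin n)) (βhat : Ω → Fin p → ℝ)
    (MJ MJc : Ω → Matrix (Fin p) (Fin p) ℝ) (ω : Ω) : ℝ :=
  (1 / (n : ℝ)) * ∑ i ∈ J,
      (ξ ⬝ᵥ (MJc ω *ᵥ X i ω)) ^ 2 * dphi φ 1 (Y i ω) (X i ω ⬝ᵥ βhat ω) ^ 2
    + (1 / (n : ℝ)) * ∑ i ∈ Jᶜ,
      (ξ ⬝ᵥ (MJ ω *ᵥ X i ω)) ^ 2 * dphi φ 1 (Y i ω) (X i ω ⬝ᵥ βhat ω) ^ 2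

/-- `Δ₁`, defined by
`(debiased - ξᵀβ̄) / √V = -(1/n) ∑ᵢ (ξᵀ M* X_i) φ₁(Y_i, X_iᵀβ̄) / √V + Δ₁ n^(-1/2)`. -/
def Delta1 {n p : ℕ} (μ : Measure Ω) (φ : ℝ → ℝ → ℝ) (X₀ : Ω → Fin p → ℝ) (Y₀ : Ω → ℝ)
    (βbar ξ : Fin p → ℝ) (X : Fin n → Ω → Fin p → ℝ) (Y : Fin n → Ω → ℝ) (J : Finset (Fin n))
    (βhat : Ω → Fin p → ℝ) (MJ MJc : Ω → Matrix (Fin p) (Fin p) ℝ) (ω : Ω) : ℝ :=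
  Real.sqrt n *
    ((debiased φ ξ X Y J βhat MJ MJc ω - ξ ⬝ᵥ βbar) / Real.sqrt (asympVar μ φ X₀ Y₀ βbar ξ)
      + (1 / (n : ℝ)) * ∑ i, (ξ ⬝ᵥ (Mstar μ φ X₀ Y₀ βbar *ᵥ X i ω)) *
          dphi φ 1 (Y i ω) (X i ω ⬝ᵥ βbar) / Real.sqrt (asympVar μ φ X₀ Y₀ βbar ξ))

/-- `Δ₂`, defined by `V̂ / V = 1 + Δ₂`. -/
def Delta2 {n p : ℕ} (μ : Measure Ω) (φ : ℝ → ℝ → ℝ) (X₀ : Ω → Fin p → ℝ) (Y₀ : Ω → ℝ)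
    (βbar ξ : Fin p → ℝ) (X : Fin n → Ω → Fin p → ℝ) (Y : Fin n → Ω → ℝ) (J : Finset (Fin n))
    (βhat : Ω → Fin p → ℝ) (MJ MJc : Ω → Matrix (Fin p) (Fin p) ℝ) (ω : Ω) : ℝ :=
  varEst φ ξ X Y J βhat MJ MJc ω / asympVar μ φ X₀ Y₀ βbar ξ - 1

/-! ### The conditions on the estimators -/

/-- `log(p ∨ n)`. -/
def logDim (n p : ℕ) : ℝ := Real.log (max p n : ℕ)

/-- `τ_n = log(p ∨ n) / √n`. -/
def tau (n p : ℕ) : ℝ := logDim n p / Real.sqrt n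

/-- The rates assumed for `β̂`: with probability at least `1 - δ`,
`‖β̂ - β̄‖₁ ≤ C₁ s₀ √(log(p ∨ n)/n)` and
`(1/n) ∑ᵢ (X_iᵀβ̂ - X_iᵀβ̄)² ≤ C₁ s₀ log(p ∨ n)/n`, where `s₀ = ‖β̄‖₀`. -/
def BetaHatRate {n p : ℕ} (μ : Measure Ω) (X : Fin n → Ω → Fin p → ℝ) (βbar : Fin p → ℝ)
    (βhat : Ω → Fin p → ℝ) (C₁ δ : ℝ) : Prop :=
  1 - δ ≤ μ.real {ω |
    l1Norm (βhat ω - βbar) ≤ C₁ * l0Norm βbar * Real.sqrt (logDim n p / n) ∧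
    (1 / (n : ℝ)) * ∑ i, (X i ω ⬝ᵥ βhat ω - X i ω ⬝ᵥ βbar) ^ 2
      ≤ C₁ * l0Norm βbar * (logDim n p / n)}

/-- The rates assumed for an estimator `M` of `Mst`: with probability at least `1 - δ`, the block
of `M - Mst` formed by the columns in the support of `ξ` has Euclidean operator norm at most
`C₂ A₁ √(log(p ∨ n)/n)` and `ℓ¹` operator norm at most `C₂ A₂ √(log(p ∨ n)/n)`. -/
def MhatRate {p : ℕ} (μ : Measure Ω) (n : ℕ) (Mst : Matrix (Fin p) (Fin p) ℝ) (ξ : Fin p → ℝ)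
    (M : Ω → Matrix (Fin p) (Fin p) ℝ) (C₂ A₁ A₂ δ : ℝ) : Prop :=
  1 - δ ≤ μ.real {ω |
    matNorm2 (colBlock ξ (M ω - Mst)) ≤ C₂ * A₁ * Real.sqrt (logDim n p / n) ∧
    matNorm1 (colBlock ξ (M ω - Mst)) ≤ C₂ * A₂ * Real.sqrt (logDim n p / n)}

/-! ### The assumptions on the population -/

/-- The entries of `X₀` are sub-gaussian with norm at most `σ₁`, and `ξᵀ M* X₀` is sub-gaussian
with norm at most `σ₁ ‖M* ξ‖₂`. -/
def SubGaussianEntries {p : ℕ} (μ : Measure Ω) (X₀ : Ω → Fin p → ℝ)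
    (Mst : Matrix (Fin p) (Fin p) ℝ) (ξ : Fin p → ℝ) (σ₁ : ℝ) : Prop :=
  (∀ j, psi2Norm μ (fun ω => X₀ ω j) ≤ ENNReal.ofReal σ₁) ∧
  psi2Norm μ (fun ω => ξ ⬝ᵥ (Mst *ᵥ X₀ ω)) ≤ ENNReal.ofReal (σ₁ * l2Norm (Mst *ᵥ ξ))

/-- `X₀` is a sub-gaussian random vector with norm at most `σ₁`. -/
def SubGaussianVector {p : ℕ} (μ : Measure Ω) (X₀ : Ω → Fin p → ℝ) (σ₁ : ℝ) : Prop :=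
  psi2VecNorm μ X₀ ≤ ENNReal.ofReal σ₁

/-- `C₃ ≤ λ_min(Ω*)` with `Ω* = Σ⁻¹`, `C₃ ≤ λ_min(M*)`, `C₃ ≤ λ_min(M* Σ M*)` and
`λ_max(M*) ≤ C₄`. -/
def EigenvalueBounds {p : ℕ} (Sig Mst : Matrix (Fin p) (Fin p) ℝ) (C₃ C₄ : ℝ) : Prop :=
  EigenvaluesGE Sig⁻¹ C₃ ∧ EigenvaluesGE Mst C₃ ∧ EigenvaluesGE (Mst * Sig * Mst) C₃ ∧
  EigenvaluesLE Mst C₄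

/-- `φ₁(Y₀, X₀ᵀβ̄)` is sub-gaussian with norm at most `σ₂`, and
`E[φ₁(Y₀, X₀ᵀβ̄)² | X₀] ≥ C₅` almost surely. -/
def ScoreCondition {p : ℕ} (μ : Measure Ω) (φ : ℝ → ℝ → ℝ) (X₀ : Ω → Fin p → ℝ) (Y₀ : Ω → ℝ)
    (βbar : Fin p → ℝ) (σ₂ C₅ : ℝ) : Prop :=
  psi2Norm μ (fun ω => dphi φ 1 (Y₀ ω) (X₀ ω ⬝ᵥ βbar)) ≤ ENNReal.ofReal σ₂ ∧
  ∀ᵐ ω ∂μ, C₅ ≤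
    (μ[fun ω' => dphi φ 1 (Y₀ ω') (X₀ ω' ⬝ᵥ βbar) ^ 2 |
      MeasurableSpace.comap X₀ inferInstance]) ω

/-- Almost surely, `φ₂(Y₀, X₀ᵀβ̄) ≤ C₆`, and `|φ₃(Y₀, b)| ≤ C₇` for every real `b`. -/
def DerivativeBounds {p : ℕ} (μ : Measure Ω) (φ : ℝ → ℝ → ℝ) (X₀ : Ω → Fin p → ℝ) (Y₀ : Ω → ℝ)
    (βbar : Fin p → ℝ) (C₆ C₇ : ℝ) : Prop :=
  ∀ᵐ ω ∂μ, dphi φ 2 (Y₀ ω) (X₀ ω ⬝ᵥ βbar) ≤ C₆ ∧ ∀ b : ℝ, |dphi φ 3 (Y₀ ω) b| ≤ C₇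

end Prob

end

end DebiasedGLM

/-!
Write `N = p ∨ n`, `L = log N`, `τ = L / √n`, and let `Z_i`, `ψ_i`, `f_i` be the projection
`ξᵀM*X_i`, the score and the curvature of the loss at the target, `ψ'_i` the score at `β̂`, `x_i`
the error `X_iᵀ(β̂ - β̄)` of the linear predictor, and `e_i` the error `((M̂ - M*) ξ)ᵀ X_i` of the
projection, with `M̂` computed from the half of the sample that does not contain `i`.

Expanding the score to second order at the target (`IsLoss.abs_taylor_le`) gives
`ξᵀ(β̂ - β̄) - avg (Z + e) ψ' + avg Z ψ` as the sum of

* `-avg e ψ`: the score has mean zero in every direction, by the first-order condition at `β̄`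
  (`IsTarget.integral_score_eq_zero`), so that this is of order `√(L / n)` times the size of
  `(M̂ - M*) ξ`;
* `ξᵀ(β̂ - β̄) - avg Z f x`: since `H M* = 1`, the vector `avg Z f X` has mean `ξ`, and Hölder's
  inequality with the `ℓ¹` rate of `β̂` makes this `O(s₀ L / n)`;
* `-avg e f x`, at most the product of the root mean squares of `e` and `x`;
* the Taylor remainder, at most a multiple of `max |Z + e| · avg x²`; here `max |Z|` is of order
  `√(log n)`.

This is `abs_debiased_error_le`. For the variance, `avg (Zψ)²` is close to `V`, and replacing `Zψ`
by `(Z + e) ψ'` changes it by the mean square of the difference and a Cauchy–Schwarz term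
(`abs_varEst_error_le`). The scale is fixed by `V ≥ C₃ C₅ ‖ξ‖₂²` (`le_asympVar`).

Three kinds of random sums have to be controlled. Sums of products of sub-gaussian variables obey
Bernstein's inequality (`IsIIDCopies.bernstein`). The squares `(Zψ)²` have heavier tails; they are
truncated, which produces the term `n^(-1/3)` (`IsIIDCopies.measure_avg_sq_gt_le`). Sums that
involve `(M̂ - M*) ξ` are bounded in one of two ways. If only the entries of `X` are sub-gaussian,
they are bounded for all directions simultaneously, at the cost of measuring the direction in the
`ℓ¹` norm (`measure_not_crossfitGood_l1`). If `X` is a sub-gaussian vector, the direction is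
independent of the half of the sample it is tested on and can be treated as fixed, with the
Euclidean norm (`measure_not_crossfitGood_l2`). The rest of the argument is the same in both cases
(`le_measureReal_abs_Delta_le`).

The total exceptional probability found here, beyond that of the assumed rates, is `2/n + 9/N`.
-/

namespace DebiasedGLM

/-! ### The loss function -/

/-- Joint measurability of a partial derivative, as a limit of difference quotients. -/
theorem measurable_uncurry_deriv {F : ℝ → ℝ → ℝ} (hF : Measurable (Function.uncurry F))
    (hd : ∀ a, Differentiable ℝ (F a)) :
    Measurable (Function.uncurry fun a b => deriv (F a) b) := by
  have hlim : ∀ z : ℝ × ℝ, Filter.Tendsto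
      (fun n : ℕ => (F z.1 (z.2 + 1 / ((n : ℝ) + 1)) - F z.1 z.2) / (1 / ((n : ℝ) + 1)))
      Filter.atTop (nhds (deriv (F z.1) z.2)) := by
    intro z
    have h := ((hd z.1) z.2).hasDerivAt.tendsto_slope_zero_right
    have ht : Filter.Tendsto (fun n : ℕ => 1 / ((n : ℝ) + 1)) Filter.atTop
        (nhdsWithin 0 (Set.Ioi 0)) := by
      refine tendsto_nhdsWithin_iff.2 ⟨tendsto_one_div_add_atTop_nhds_zero_nat, ?_⟩
      exact Filter.Eventually.of_forall fun n => by simp only [Set.mem_Ioi]; positivity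
    refine (h.comp ht).congr fun n => ?_
    simp only [Function.comp, smul_eq_mul]
    exact (div_eq_inv_mul _ _).symm
  refine measurable_of_tendsto_metrizable (f := fun (n : ℕ) (z : ℝ × ℝ) =>
    (F z.1 (z.2 + 1 / ((n : ℝ) + 1)) - F z.1 z.2) / (1 / ((n : ℝ) + 1))) (fun n => ?_)
    (tendsto_pi_nhds.2 hlim)
  have h1 : Measurable fun z : ℝ × ℝ => F z.1 (z.2 + 1 / ((n : ℝ) + 1)) :=
    hF.comp (measurable_fst.prodMk (measurable_snd.add_const _))
  exact (h1.sub hF).div_const _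

variable {φ : ℝ → ℝ → ℝ}

theorem IsLoss.hasDerivAt_dphi (h : IsLoss φ) {k : ℕ} (hk : k < 3) (a b : ℝ) :
    HasDerivAt (dphi φ k a) (dphi φ (k + 1) a b) b := by
  have h1 := (h.differentiable a k hk b).hasDerivAt
  have h2 : dphi φ (k + 1) a b = deriv (iteratedDeriv k (φ a)) b := by
    simp only [dphi, iteratedDeriv_succ]
  rw [h2]
  exact h1

theorem IsLoss.measurable_dphi (h : IsLoss φ) {k : ℕ} (hk : k ≤ 3) :
    Measurable (Function.uncurry (dphi φ k)) := by
  induction k with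
  | zero =>
    have h0 : dphi φ 0 = φ := by funext a b; simp [dphi]
    rw [h0]
    exact h.measurable
  | succ k ih =>
    have h1 := measurable_uncurry_deriv (ih (by omega))
      (fun a => h.differentiable a k (by omega))
    have h2 : dphi φ (k + 1) = fun a b => deriv (dphi φ k a) b := by
      funext a b
      exact (h.hasDerivAt_dphi (by omega) a b).deriv.symm
    rw [h2]
    exact h1

theorem IsLoss.measurable_dphi_comp (h : IsLoss φ) {k : ℕ} (hk : k ≤ 3) {α : Type*}
    [MeasurableSpace α] {f g : α → ℝ} (hf : Measurable f) (hg : Measurable g) :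
    Measurable fun x => dphi φ k (f x) (g x) := by
  have h1 := (h.measurable_dphi hk).comp (hf.prodMk hg)
  have h2 : (Function.uncurry (dphi φ k) ∘ fun x => (f x, g x)) =
      fun x => dphi φ k (f x) (g x) := rfl
  rwa [h2] at h1

theorem IsLoss.dphi_two_nonneg (h : IsLoss φ) (a b : ℝ) : 0 ≤ dphi φ 2 a b := by
  have h0 : dphi φ 0 a = φ a := by funext x; simp [dphi]
  have h1 : deriv (φ a) = dphi φ 1 a := by
    funext x
    rw [← h0]
    exact (h.hasDerivAt_dphi (by norm_num) a x).deriv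
  have hmono : Monotone (dphi φ 1 a) := by
    have hd : Differentiable ℝ (φ a) := by
      rw [← h0]; exact fun x => (h.hasDerivAt_dphi (by norm_num) a x).differentiableAt
    rw [← h1, ← monotoneOn_univ]
    exact (h.convex a).monotoneOn_deriv fun x _ => hd x
  rw [← (h.hasDerivAt_dphi (k := 1) (by norm_num) a b).deriv]
  exact hmono.deriv_nonneg

/-- The values of `Y` for which `φ₂(Y, ·)` is `C`-Lipschitz on the rationals, hence on `ℝ`.
Only countably many inequalities are involved, so that this event is visibly measurable, unlike
the event `∀ b, |φ₃(Y, b)| ≤ C`. -/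
def lipSet (φ : ℝ → ℝ → ℝ) (C : ℝ) : Set ℝ :=
  {y | ∀ q r : ℚ, |dphi φ 2 y q - dphi φ 2 y r| ≤ C * |(q : ℝ) - r|}

theorem IsLoss.measurableSet_lipSet (h : IsLoss φ) (C : ℝ) : MeasurableSet (lipSet φ C) := by
  have hm : ∀ q : ℝ, Measurable fun y => dphi φ 2 y q := fun q =>
    h.measurable_dphi_comp (by norm_num) measurable_id measurable_const
  have hS : lipSet φ C = ⋂ (q : ℚ) (r : ℚ),
      {y | |dphi φ 2 y q - dphi φ 2 y r| ≤ C * |(q : ℝ) - r|} := by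
    ext y; simp [lipSet]
  rw [hS]
  refine MeasurableSet.iInter fun q => MeasurableSet.iInter fun r => ?_
  exact measurableSet_le ((hm q).sub (hm r)).abs measurable_const

theorem IsLoss.mem_lipSet (h : IsLoss φ) {C y : ℝ} (hy : ∀ b, |dphi φ 3 y b| ≤ C) :
    y ∈ lipSet φ C := by
  intro q r
  have := Convex.norm_image_sub_le_of_norm_hasDerivWithin_le (s := Set.univ)
    (f := dphi φ 2 y) (f' := dphi φ 3 y) (C := C) (x := (r : ℝ)) (y := (q : ℝ))
    (fun x _ => (h.hasDerivAt_dphi (k := 2) (by norm_num) y x).hasDerivWithinAt)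
    (fun x _ => hy x) convex_univ trivial trivial
  simpa [Real.norm_eq_abs] using this

theorem IsLoss.lipschitz_of_mem_lipSet (h : IsLoss φ) {C y : ℝ} (hy : y ∈ lipSet φ C)
    (b b' : ℝ) : |dphi φ 2 y b - dphi φ 2 y b'| ≤ C * |b - b'| := by
  have hc : Continuous (dphi φ 2 y) :=
    continuous_iff_continuousAt.2 fun x =>
      (h.hasDerivAt_dphi (k := 2) (by norm_num) y x).continuousAt
  have hclosed : IsClosed {z : ℝ × ℝ | |dphi φ 2 y z.1 - dphi φ 2 y z.2| ≤ C * |z.1 - z.2|} :=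
    isClosed_le (by fun_prop) (by fun_prop)
  have hdense : DenseRange (Prod.map ((↑) : ℚ → ℝ) ((↑) : ℚ → ℝ)) :=
    Rat.denseRange_cast.prodMap Rat.denseRange_cast
  exact hdense.induction_on (p := fun z : ℝ × ℝ =>
    |dphi φ 2 y z.1 - dphi φ 2 y z.2| ≤ C * |z.1 - z.2|) (b, b') hclosed (fun z => hy z.1 z.2)

/-- First-order Taylor expansion of the score `φ₁(y, ·)` with quadratic remainder. -/
theorem IsLoss.abs_taylor_le (h : IsLoss φ) {C y : ℝ} (hC : 0 ≤ C) (hy : y ∈ lipSet φ C)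
    (b b' : ℝ) :
    |dphi φ 1 y b' - dphi φ 1 y b - dphi φ 2 y b * (b' - b)| ≤ C * (b' - b) ^ 2 := by
  have key : ∃ c, |c - b| ≤ |b' - b| ∧
      dphi φ 1 y b' - dphi φ 1 y b = dphi φ 2 y c * (b' - b) := by
    have hd := h.hasDerivAt_dphi (k := 1) (by norm_num) y
    have hcont : Continuous (dphi φ 1 y) :=
      continuous_iff_continuousAt.2 fun x => (hd x).continuousAt
    rcases lt_trichotomy b b' with hlt | heq | hgt
    · obtain ⟨c, hc, hc'⟩ := exists_hasDerivAt_eq_slope (dphi φ 1 y) (dphi φ 2 y) hlt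
        hcont.continuousOn (fun x _ => hd x)
      refine ⟨c, ?_, ?_⟩
      · rw [abs_of_pos (by linarith [hc.1]), abs_of_pos (by linarith)]; linarith [hc.2]
      · rw [hc']; field_simp [(sub_pos.2 hlt).ne']
    · exact ⟨b, by simp, by simp [heq]⟩
    · obtain ⟨c, hc, hc'⟩ := exists_hasDerivAt_eq_slope (dphi φ 1 y) (dphi φ 2 y) hgt
        hcont.continuousOn (fun x _ => hd x)
      refine ⟨c, ?_, ?_⟩
      · rw [abs_of_neg (by linarith [hc.2]), abs_of_neg (by linarith)]; linarith [hc.1]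
      · have : b - b' ≠ 0 := (sub_pos.2 hgt).ne'
        rw [hc']; field_simp; ring
  obtain ⟨c, hc, he⟩ := key
  rw [he, ← sub_mul, abs_mul, ← sq_abs, sq, ← mul_assoc]
  refine mul_le_mul_of_nonneg_right ?_ (abs_nonneg _)
  exact (h.lipschitz_of_mem_lipSet hy c b).trans (mul_le_mul_of_nonneg_left hc hC)

section Population

variable {Ω : Type*} [MeasurableSpace Ω] {μ : Measure Ω} {p : ℕ}
  {X₀ : Ω → Fin p → ℝ} {Y₀ : Ω → ℝ} {βbar : Fin p → ℝ}

/-- One half of the first-order condition at the minimizer: by convexity the difference quotients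
along `v` lie between the directional derivative and the quotient for step `1`, so that dominated
convergence applies. -/
theorem IsTarget.integral_score_nonneg (h : IsLoss φ) (hT : IsTarget μ φ X₀ Y₀ βbar)
    (v : Fin p → ℝ)
    (hint : Integrable (fun ω => dphi φ 1 (Y₀ ω) (X₀ ω ⬝ᵥ βbar) * (X₀ ω ⬝ᵥ v)) μ) :
    0 ≤ ∫ ω, dphi φ 1 (Y₀ ω) (X₀ ω ⬝ᵥ βbar) * (X₀ ω ⬝ᵥ v) ∂μ := by
  set t : ℕ → ℝ := fun n => 1 / ((n : ℝ) + 1) with htdef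
  have ht0 : ∀ n, 0 < t n := fun n => by simp only [htdef]; positivity
  have ht1 : ∀ n, t n ≤ 1 := fun n => by
    simp only [htdef]
    rw [div_le_one (by positivity)]
    linarith [(Nat.cast_nonneg n : (0 : ℝ) ≤ n)]
  have hline : ∀ ω (s : ℝ), X₀ ω ⬝ᵥ (βbar + s • v) = X₀ ω ⬝ᵥ βbar + s * (X₀ ω ⬝ᵥ v) := by
    intro ω s
    rw [dotProduct_add, dotProduct_smul, smul_eq_mul]
  set F : ℕ → Ω → ℝ := fun n ω =>
    (φ (Y₀ ω) (X₀ ω ⬝ᵥ (βbar + t n • v)) - φ (Y₀ ω) (X₀ ω ⬝ᵥ βbar)) / t n with hF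
  set G : Ω → ℝ := fun ω => φ (Y₀ ω) (X₀ ω ⬝ᵥ (βbar + v)) - φ (Y₀ ω) (X₀ ω ⬝ᵥ βbar) with hG
  have hFint : ∀ n, Integrable (F n) μ := fun n => ((hT.1 _).sub (hT.1 _)).div_const _
  have hGint : Integrable G μ := (hT.1 _).sub (hT.1 _)
  have hder : ∀ ω, HasDerivAt (fun s => φ (Y₀ ω) (X₀ ω ⬝ᵥ βbar + s * (X₀ ω ⬝ᵥ v)))
      (dphi φ 1 (Y₀ ω) (X₀ ω ⬝ᵥ βbar) * (X₀ ω ⬝ᵥ v)) 0 := by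
    intro ω
    have h0 : dphi φ 0 (Y₀ ω) = φ (Y₀ ω) := by funext x; simp [dphi]
    have h1 := h.hasDerivAt_dphi (k := 0) (by norm_num) (Y₀ ω)
      (X₀ ω ⬝ᵥ βbar + 0 * (X₀ ω ⬝ᵥ v))
    rw [h0] at h1
    have h2 : HasDerivAt (fun s : ℝ => X₀ ω ⬝ᵥ βbar + s * (X₀ ω ⬝ᵥ v)) (X₀ ω ⬝ᵥ v) 0 := by
      simpa using ((hasDerivAt_id (0 : ℝ)).mul_const (X₀ ω ⬝ᵥ v)).const_add (X₀ ω ⬝ᵥ βbar)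
    simpa [Function.comp_def] using h1.comp 0 h2
  have hconv : ∀ ω, ConvexOn ℝ Set.univ
      (fun s => φ (Y₀ ω) (X₀ ω ⬝ᵥ βbar + s * (X₀ ω ⬝ᵥ v))) := by
    intro ω
    refine ⟨convex_univ, fun x _ y _ a b ha hb hab => ?_⟩
    have := (h.convex (Y₀ ω)).2 (Set.mem_univ (X₀ ω ⬝ᵥ βbar + x * (X₀ ω ⬝ᵥ v)))
      (Set.mem_univ (X₀ ω ⬝ᵥ βbar + y * (X₀ ω ⬝ᵥ v))) ha hb hab
    refine le_trans (le_of_eq (congrArg (φ (Y₀ ω)) ?_)) this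
    simp only [smul_eq_mul]
    linear_combination (-(X₀ ω ⬝ᵥ βbar)) * hab
  have hlow : ∀ n ω, dphi φ 1 (Y₀ ω) (X₀ ω ⬝ᵥ βbar) * (X₀ ω ⬝ᵥ v) ≤ F n ω := by
    intro n ω
    have := (hconv ω).le_slope_of_hasDerivAt (Set.mem_univ 0) (Set.mem_univ (t n)) (ht0 n)
      (hder ω)
    rw [slope_def_field] at this
    simpa [hF, hline] using this
  have hup : ∀ n ω, F n ω ≤ G ω := by
    intro n ω
    have := (hconv ω).2 (Set.mem_univ 0) (Set.mem_univ 1) (sub_nonneg.2 (ht1 n)) (ht0 n).le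
      (by ring)
    simp only [smul_eq_mul, mul_zero, mul_one, zero_add, zero_mul, add_zero, one_mul] at this
    have h1 : X₀ ω ⬝ᵥ (βbar + v) = X₀ ω ⬝ᵥ βbar + X₀ ω ⬝ᵥ v := dotProduct_add _ _ _
    simp only [hF, hG, hline, h1]
    rw [div_le_iff₀ (ht0 n)]
    linarith
  have hlim : ∀ ω, Filter.Tendsto (fun n => F n ω) Filter.atTop
      (nhds (dphi φ 1 (Y₀ ω) (X₀ ω ⬝ᵥ βbar) * (X₀ ω ⬝ᵥ v))) := by
    intro ω
    have h1 := (hder ω).tendsto_slope_zero_right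
    have h2 : Filter.Tendsto t Filter.atTop (nhdsWithin 0 (Set.Ioi 0)) :=
      tendsto_nhdsWithin_iff.2 ⟨tendsto_one_div_add_atTop_nhds_zero_nat,
        Filter.Eventually.of_forall fun n => ht0 n⟩
    refine (h1.comp h2).congr fun n => ?_
    simp only [Function.comp, smul_eq_mul, hF, hline, zero_add, zero_mul, add_zero]
    rw [div_eq_inv_mul]
  have hDCT := tendsto_integral_of_dominated_convergence
    (fun ω => |dphi φ 1 (Y₀ ω) (X₀ ω ⬝ᵥ βbar) * (X₀ ω ⬝ᵥ v)| + |G ω|)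
    (fun n => (hFint n).aestronglyMeasurable) (hint.abs.add hGint.abs)
    (fun n => Filter.Eventually.of_forall fun ω => by
      rw [Real.norm_eq_abs, abs_le]
      have h1 := hlow n ω
      have h2 := hup n ω
      have h3 := neg_abs_le (dphi φ 1 (Y₀ ω) (X₀ ω ⬝ᵥ βbar) * (X₀ ω ⬝ᵥ v))
      have h4 := le_abs_self (G ω)
      have h5 := abs_nonneg (dphi φ 1 (Y₀ ω) (X₀ ω ⬝ᵥ βbar) * (X₀ ω ⬝ᵥ v))
      have h6 := abs_nonneg (G ω)
      constructor <;> linarith)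
    (Filter.Eventually.of_forall hlim)
  refine ge_of_tendsto' hDCT fun n => ?_
  have h1 : ∫ ω, F n ω ∂μ = (∫ ω, φ (Y₀ ω) (X₀ ω ⬝ᵥ (βbar + t n • v)) ∂μ
      - ∫ ω, φ (Y₀ ω) (X₀ ω ⬝ᵥ βbar) ∂μ) / t n := by
    simp only [hF]
    rw [integral_div, integral_sub (hT.1 _) (hT.1 _)]
  rw [h1]
  exact div_nonneg (sub_nonneg.2 (hT.2 _)) (ht0 n).le

theorem IsTarget.integral_score_eq_zero (h : IsLoss φ) (hT : IsTarget μ φ X₀ Y₀ βbar)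
    (v : Fin p → ℝ)
    (hint : Integrable (fun ω => dphi φ 1 (Y₀ ω) (X₀ ω ⬝ᵥ βbar) * (X₀ ω ⬝ᵥ v)) μ) :
    ∫ ω, dphi φ 1 (Y₀ ω) (X₀ ω ⬝ᵥ βbar) * (X₀ ω ⬝ᵥ v) ∂μ = 0 := by
  refine le_antisymm ?_ (hT.integral_score_nonneg h v hint)
  have h1 := hT.integral_score_nonneg h (-v) (by simpa using hint.neg)
  simp only [dotProduct_neg, mul_neg, integral_neg] at h1
  linarith

end Population

/-! ### Exponential moments -/

section Moments

variable {Ω : Type*} [MeasurableSpace Ω] {μ : Measure Ω}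

/-- `E exp |U| ≤ 2`: the variable `U` is sub-exponential with norm at most `1`. -/
def SubExpOne (μ : Measure Ω) (U : Ω → ℝ) : Prop :=
  Integrable (fun ω => Real.exp |U ω|) μ ∧ ∫ ω, Real.exp |U ω| ∂μ ≤ 2

/-- `E exp (Z² / k²) ≤ 2`: the variable `Z` is sub-gaussian with norm at most `k`. -/
def SubGauss (μ : Measure Ω) (Z : Ω → ℝ) (k : ℝ) : Prop :=
  Integrable (fun ω => Real.exp ((Z ω / k) ^ 2)) μ ∧ ∫ ω, Real.exp ((Z ω / k) ^ 2) ∂μ ≤ 2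

/-- The infimum in the definition of `psi2Norm` need not be attained a priori; doubling the bound
makes this irrelevant. -/
theorem subGauss_of_psi2Norm_le {Z : Ω → ℝ} (hZ : Measurable Z) {σ : ℝ} (hσ : 0 < σ)
    (h : psi2Norm μ Z ≤ ENNReal.ofReal σ) : SubGauss μ Z (2 * σ) := by
  have h1 : psi2Norm μ Z < ENNReal.ofReal (2 * σ) :=
    h.trans_lt ((ENNReal.ofReal_lt_ofReal_iff (by linarith)).2 (by linarith))
  simp only [psi2Norm, iInf_lt_iff] at h1
  obtain ⟨t, ⟨ht0, ht⟩, htσ⟩ := h1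
  have htσ' : t < 2 * σ := (ENNReal.ofReal_lt_ofReal_iff (by linarith)).1 htσ
  have hm : Measurable fun ω => Real.exp ((Z ω / (2 * σ)) ^ 2) :=
    Real.measurable_exp.comp ((hZ.div_const _).pow_const 2)
  have hle : ∫⁻ ω, ENNReal.ofReal (Real.exp ((Z ω / (2 * σ)) ^ 2)) ∂μ ≤ 2 := by
    refine le_trans (lintegral_mono fun ω => ?_) ht
    refine ENNReal.ofReal_le_ofReal (Real.exp_le_exp.2 ?_)
    rw [div_pow]
    gcongr
  constructor
  · refine ⟨hm.aestronglyMeasurable, ?_⟩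
    rw [hasFiniteIntegral_iff_ofReal (Filter.Eventually.of_forall fun ω => (Real.exp_pos _).le)]
    exact hle.trans_lt (by norm_num)
  · rw [integral_eq_lintegral_of_nonneg_ae
      (Filter.Eventually.of_forall fun ω => (Real.exp_pos _).le) hm.aestronglyMeasurable]
    exact ENNReal.toReal_le_of_le_ofReal (by norm_num) (by simpa using hle)

theorem SubGauss.mono {Z : Ω → ℝ} (hZ : Measurable Z) {k l : ℝ} (h : SubGauss μ Z k) (hk : 0 < k)
    (hkl : k ≤ l) : SubGauss μ Z l := by
  have hm : Measurable fun ω => Real.exp ((Z ω / l) ^ 2) :=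
    Real.measurable_exp.comp ((hZ.div_const _).pow_const 2)
  have hle : ∀ ω, Real.exp ((Z ω / l) ^ 2) ≤ Real.exp ((Z ω / k) ^ 2) := fun ω => by
    rw [Real.exp_le_exp, div_pow, div_pow]
    gcongr
  have hi : Integrable (fun ω => Real.exp ((Z ω / l) ^ 2)) μ :=
    h.1.mono' hm.aestronglyMeasurable (Filter.Eventually.of_forall fun ω => by
      rw [Real.norm_eq_abs, Real.abs_exp]; exact hle ω)
  exact ⟨hi, (integral_mono hi h.1 hle).trans h.2⟩

theorem SubGauss.const_mul {Z : Ω → ℝ} {k c : ℝ} (h : SubGauss μ Z k) (hc : c ≠ 0) :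
    SubGauss μ (fun ω => c * Z ω) (c * k) := by
  have : ∀ ω, c * Z ω / (c * k) = Z ω / k := fun ω => mul_div_mul_left _ _ hc
  simpa only [SubGauss, this] using h

theorem SubGauss.tail [IsFiniteMeasure μ] {Z : Ω → ℝ} {k t : ℝ} (h : SubGauss μ Z k) (hk : 0 < k)
    (ht : 0 ≤ t) : μ.real {ω | t * k < |Z ω|} ≤ 2 * Real.exp (-t ^ 2) := by
  have h1 := mul_meas_ge_le_integral_of_nonneg
    (Filter.Eventually.of_forall fun ω => (Real.exp_pos ((Z ω / k) ^ 2)).le) h.1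
    (Real.exp (t ^ 2))
  have h2 : μ.real {ω | t * k < |Z ω|} ≤
      μ.real {ω | Real.exp (t ^ 2) ≤ Real.exp ((Z ω / k) ^ 2)} := by
    refine measureReal_mono fun ω hω => ?_
    simp only [Set.mem_ofPred_eq] at hω ⊢
    rw [Real.exp_le_exp, div_pow, le_div_iff₀ (by positivity), ← sq_abs (Z ω), ← mul_pow]
    exact pow_le_pow_left₀ (by positivity) hω.le 2
  have h3 := Real.exp_pos (t ^ 2)
  rw [Real.exp_neg, ← div_eq_mul_inv, le_div_iff₀ h3, mul_comm]
  calc _ ≤ Real.exp (t ^ 2) * μ.real {ω | Real.exp (t ^ 2) ≤ Real.exp ((Z ω / k) ^ 2)} := by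
        gcongr
    _ ≤ 2 := h1.trans h.2

theorem SubExpOne.mono {U W : Ω → ℝ} (h : SubExpOne μ W) (hU : Measurable U)
    (hle : ∀ᵐ ω ∂μ, |U ω| ≤ |W ω|) : SubExpOne μ U := by
  have hm : Measurable fun ω => Real.exp |U ω| := Real.measurable_exp.comp hU.abs
  have hle' : ∀ᵐ ω ∂μ, Real.exp |U ω| ≤ Real.exp |W ω| :=
    hle.mono fun ω hω => Real.exp_le_exp.2 hω
  have hi : Integrable (fun ω => Real.exp |U ω|) μ :=
    h.1.mono' hm.aestronglyMeasurable (hle'.mono fun ω hω => by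
      rw [Real.norm_eq_abs, Real.abs_exp]; exact hω)
  exact ⟨hi, (integral_mono_ae hi h.1 hle').trans h.2⟩

/-- The product of two sub-gaussian variables is sub-exponential. -/
theorem SubGauss.mul {Z W : Ω → ℝ} {k l : ℝ} (hZ : SubGauss μ Z k) (hW : SubGauss μ W l)
    (hZm : Measurable Z) (hWm : Measurable W) :
    SubExpOne μ (fun ω => (Z ω / k) * (W ω / l)) := by
  have hm : Measurable fun ω => Real.exp |(Z ω / k) * (W ω / l)| :=
    Real.measurable_exp.comp ((hZm.div_const _).mul (hWm.div_const _)).abs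
  have hle : ∀ ω, Real.exp |(Z ω / k) * (W ω / l)| ≤
      (Real.exp ((Z ω / k) ^ 2) + Real.exp ((W ω / l) ^ 2)) / 2 := by
    intro ω
    set a := Z ω / k
    set b := W ω / l
    have h1 : Real.exp |a * b| ≤ Real.exp (a ^ 2 / 2) * Real.exp (b ^ 2 / 2) := by
      rw [← Real.exp_add, Real.exp_le_exp, abs_mul]
      nlinarith [sq_nonneg (|a| - |b|), sq_abs a, sq_abs b]
    have h2 : Real.exp (a ^ 2) = Real.exp (a ^ 2 / 2) ^ 2 := by
      rw [sq (Real.exp _), ← Real.exp_add]; ring_nf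
    have h3 : Real.exp (b ^ 2) = Real.exp (b ^ 2 / 2) ^ 2 := by
      rw [sq (Real.exp _), ← Real.exp_add]; ring_nf
    nlinarith [sq_nonneg (Real.exp (a ^ 2 / 2) - Real.exp (b ^ 2 / 2))]
  have hi2 := (hZ.1.add hW.1).div_const 2
  have hi : Integrable (fun ω => Real.exp |(Z ω / k) * (W ω / l)|) μ :=
    hi2.mono' hm.aestronglyMeasurable (Filter.Eventually.of_forall fun ω => by
      rw [Real.norm_eq_abs, Real.abs_exp]; exact hle ω)
  refine ⟨hi, (integral_mono hi hi2 hle).trans ?_⟩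
  simp only [Pi.add_apply]
  rw [integral_div, integral_add hZ.1 hW.1]
  linarith [hZ.2, hW.2]

theorem SubExpOne.integrable_pow {U : Ω → ℝ} (h : SubExpOne μ U) (hU : Measurable U) (m : ℕ) :
    Integrable (fun ω => |U ω| ^ m) μ := by
  refine (h.1.const_mul (m.factorial : ℝ)).mono' (hU.abs.pow_const m).aestronglyMeasurable
    (Filter.Eventually.of_forall fun ω => ?_)
  have := Real.pow_div_factorial_le_exp _ (abs_nonneg (U ω)) m
  rw [div_le_iff₀ (by positivity)] at this
  rw [Real.norm_eq_abs, abs_of_nonneg (by positivity)]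
  linarith

theorem SubExpOne.integral_pow_le {U : Ω → ℝ} (h : SubExpOne μ U) (hU : Measurable U) (m : ℕ) :
    ∫ ω, |U ω| ^ m ∂μ ≤ 2 * m.factorial := by
  have h1 : ∫ ω, |U ω| ^ m ∂μ ≤ ∫ ω, (m.factorial : ℝ) * Real.exp |U ω| ∂μ := by
    refine integral_mono (h.integrable_pow hU m) (h.1.const_mul _) fun ω => ?_
    have := Real.pow_div_factorial_le_exp _ (abs_nonneg (U ω)) m
    rw [div_le_iff₀ (by positivity)] at this
    simp only
    linarith
  rw [integral_const_mul] at h1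
  have h2 : (0 : ℝ) ≤ m.factorial := by positivity
  nlinarith [h.2]

theorem SubExpOne.integrable {U : Ω → ℝ} (h : SubExpOne μ U) (hU : Measurable U) :
    Integrable U μ := by
  have := h.integrable_pow hU 1
  simp only [pow_one] at this
  exact (integrable_norm_iff hU.aestronglyMeasurable).1 this

theorem SubExpOne.integrable_sq {U : Ω → ℝ} (h : SubExpOne μ U) (hU : Measurable U) :
    Integrable (fun ω => U ω ^ 2) μ := by
  simpa only [sq_abs] using h.integrable_pow hU 2

theorem SubExpOne.abs_integral_le [IsProbabilityMeasure μ] {U : Ω → ℝ} (h : SubExpOne μ U)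
    (hU : Measurable U) : |∫ ω, U ω ∂μ| ≤ 1 := by
  have h1 : |∫ ω, U ω ∂μ| ≤ ∫ ω, |U ω| ∂μ := abs_integral_le_integral_abs
  have h2 : ∫ ω, |U ω| ∂μ ≤ ∫ ω, (Real.exp |U ω| - 1) ∂μ := by
    refine integral_mono (h.integrable hU).abs (h.1.sub (integrable_const 1)) fun ω => ?_
    simp only
    linarith [Real.add_one_le_exp |U ω|]
  rw [integral_sub h.1 (integrable_const 1)] at h2
  simp only [integral_const, probReal_univ, smul_eq_mul, mul_one] at h2
  linarith [h.2]

end Moments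

/-! ### Concentration of sums -/

theorem exp_le_one_add_add_sq_mul_exp_abs (x : ℝ) :
    Real.exp x ≤ 1 + x + x ^ 2 * Real.exp |x| := by
  have h := Complex.norm_exp_sub_sum_le_norm_mul_exp (x : ℂ) 2
  simp only [Finset.sum_range_succ, Finset.sum_range_zero, pow_zero, pow_one, Nat.factorial,
    Nat.cast_one, div_one, zero_add, mul_one, Complex.norm_real, Real.norm_eq_abs, sq_abs] at h
  have h2 : (Complex.exp (x : ℂ) - (1 + (x : ℂ))) = ((Real.exp x - (1 + x) : ℝ) : ℂ) := by
    push_cast; rfl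
  rw [h2, Complex.norm_real, Real.norm_eq_abs] at h
  linarith [le_abs_self (Real.exp x - (1 + x))]

section Sums

variable {Ω : Type*} [MeasurableSpace Ω] {μ : Measure Ω}

/-- `E exp (l U) ≤ 1 + l² E[U² exp (l₀ |U|)]` for a centred variable and `|l| ≤ l₀`. -/
theorem integrable_exp_and_mgf_le [IsProbabilityMeasure μ] {U : Ω → ℝ} (hU : Measurable U)
    (hUi : Integrable U μ)
    (hU0 : ∫ ω, U ω ∂μ = 0) {l₀ v : ℝ}
    (hi : Integrable (fun ω => U ω ^ 2 * Real.exp (l₀ * |U ω|)) μ)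
    (hv : ∫ ω, U ω ^ 2 * Real.exp (l₀ * |U ω|) ∂μ ≤ v) {l : ℝ} (hl : |l| ≤ l₀) :
    Integrable (fun ω => Real.exp (l * U ω)) μ ∧ mgf U μ l ≤ Real.exp (l ^ 2 * v) := by
  have hle : ∀ ω, Real.exp (l * U ω) ≤
      1 + l * U ω + l ^ 2 * (U ω ^ 2 * Real.exp (l₀ * |U ω|)) := by
    intro ω
    refine (exp_le_one_add_add_sq_mul_exp_abs (l * U ω)).trans ?_
    have h1 : Real.exp |l * U ω| ≤ Real.exp (l₀ * |U ω|) := by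
      rw [Real.exp_le_exp, abs_mul]
      gcongr
    have h2 : (l * U ω) ^ 2 * Real.exp |l * U ω| ≤
        l ^ 2 * (U ω ^ 2 * Real.exp (l₀ * |U ω|)) := by
      rw [mul_pow, mul_assoc]
      gcongr
    linarith
  have hI : Integrable (fun ω => 1 + l * U ω + l ^ 2 * (U ω ^ 2 * Real.exp (l₀ * |U ω|))) μ :=
    ((integrable_const 1).add (hUi.const_mul l)).add (hi.const_mul (l ^ 2))
  have hE : Integrable (fun ω => Real.exp (l * U ω)) μ :=
    hI.mono' (Real.measurable_exp.comp (hU.const_mul l)).aestronglyMeasurable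
      (Filter.Eventually.of_forall fun ω => by
        rw [Real.norm_eq_abs, Real.abs_exp]; exact hle ω)
  refine ⟨hE, ?_⟩
  have h1 : mgf U μ l ≤ 1 + l ^ 2 * v := by
    refine (integral_mono hE hI hle).trans ?_
    have hI1 : Integrable (fun ω => 1 + l * U ω) μ := (integrable_const 1).add (hUi.const_mul l)
    rw [integral_add hI1 (hi.const_mul (l ^ 2)),
      integral_add (integrable_const 1) (hUi.const_mul l), integral_const_mul, integral_const_mul,
      hU0]
    simp only [integral_const, probReal_univ, smul_eq_mul, mul_one, mul_zero, add_zero]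
    gcongr
  linarith [Real.add_one_le_exp (l ^ 2 * v)]

/-- Two-sided Chernoff bound for a sum of independent centred variables with a common bound on
`E[U² exp (l₀ |U|)]`. -/
theorem measure_abs_sum_gt_le [IsProbabilityMeasure μ] {n : ℕ} {U : Fin n → Ω → ℝ}
    (hind : iIndepFun U μ)
    (hU : ∀ i, Measurable (U i)) (hUi : ∀ i, Integrable (U i) μ)
    (hU0 : ∀ i, ∫ ω, U i ω ∂μ = 0) {l₀ v : ℝ}
    (hi : ∀ i, Integrable (fun ω => U i ω ^ 2 * Real.exp (l₀ * |U i ω|)) μ)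
    (hv : ∀ i, ∫ ω, U i ω ^ 2 * Real.exp (l₀ * |U i ω|) ∂μ ≤ v) (hv0 : 0 ≤ v)
    {l : ℝ} (hl : 0 ≤ l)
    (hl' : l ≤ l₀) (s : Finset (Fin n)) (t : ℝ) :
    μ.real {ω | t < |∑ i ∈ s, U i ω|} ≤ 2 * Real.exp (-(l * t) + n * (l ^ 2 * v)) := by
  have hone : ∀ W : Fin n → Ω → ℝ, iIndepFun W μ → (∀ i, Measurable (W i)) →
      (∀ i, Integrable (fun ω => Real.exp (l * W i ω)) μ ∧
        mgf (W i) μ l ≤ Real.exp (l ^ 2 * v)) →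
      μ.real {ω | t ≤ ∑ i ∈ s, W i ω} ≤ Real.exp (-(l * t) + n * (l ^ 2 * v)) := by
    intro W hW hWm hWb
    have h1 := measure_ge_le_exp_mul_mgf (μ := μ) (X := ∑ i ∈ s, W i) t hl
      (by
        have := hW.integrable_exp_mul_sum hWm (s := s) (t := l) fun i _ => (hWb i).1
        exact this)
    rw [hW.mgf_sum hWm] at h1
    simp only [Finset.sum_apply] at h1
    refine h1.trans ?_
    have h2 : ∏ i ∈ s, mgf (W i) μ l ≤ ∏ i ∈ s, Real.exp (l ^ 2 * v) :=
      Finset.prod_le_prod (fun i _ => mgf_nonneg) fun i _ => (hWb i).2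
    have h3 : ∏ i ∈ s, Real.exp (l ^ 2 * v) ≤ Real.exp (n * (l ^ 2 * v)) := by
      rw [Finset.prod_const, ← Real.exp_nat_mul, Real.exp_le_exp]
      have : (s.card : ℝ) ≤ n := by
        exact_mod_cast (Finset.card_le_univ s).trans (by simp)
      gcongr
    rw [Real.exp_add, neg_mul]
    exact mul_le_mul_of_nonneg_left (h2.trans h3) (Real.exp_pos _).le
  have hpos := hone U hind hU fun i =>
    integrable_exp_and_mgf_le (hU i) (hUi i) (hU0 i) (hi i) (hv i) (by rwa [abs_of_nonneg hl])
  have hneg := hone (fun i ω => -U i ω)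
    (hind.comp (fun _ x => -x) fun _ => measurable_neg) (fun i => (hU i).neg) fun i =>
    integrable_exp_and_mgf_le (hU i).neg (hUi i).neg
      ((integral_neg _).trans (by rw [hU0 i, neg_zero]))
      (by simpa using hi i) (by simpa using hv i) (by rwa [abs_of_nonneg hl])
  have hsub : {ω | t < |∑ i ∈ s, U i ω|} ⊆
      {ω | t ≤ ∑ i ∈ s, U i ω} ∪ {ω | t ≤ ∑ i ∈ s, -U i ω} := by
    intro ω hω
    simp only [Set.mem_ofPred_eq, Set.mem_union, Finset.sum_neg_distrib] at hω ⊢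
    rcases lt_abs.1 hω with h | h
    · exact Or.inl h.le
    · exact Or.inr h.le
  refine (measureReal_mono hsub).trans ((measureReal_union_le _ _).trans ?_)
  linarith

/-- The `ζ i` are independent copies of `ζ₀`. -/
structure IsIIDCopies {E : Type*} [MeasurableSpace E] {n : ℕ} (μ : Measure Ω)
    (ζ : Fin n → Ω → E) (ζ₀ : Ω → E) : Prop where
  measurable : ∀ i, Measurable (ζ i)
  measurable₀ : Measurable ζ₀
  indep : iIndepFun ζ μ
  ident : ∀ i, IdentDistrib (ζ i) ζ₀ μ μ

theorem IsIIDCopies.comp {E F : Type*} [MeasurableSpace E] [MeasurableSpace F] {n : ℕ}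
    {ζ : Fin n → Ω → E} {ζ₀ : Ω → E} (h : IsIIDCopies μ ζ ζ₀) {g : E → F} (hg : Measurable g) :
    IsIIDCopies μ (fun i ω => g (ζ i ω)) (fun ω => g (ζ₀ ω)) :=
  ⟨fun i => hg.comp (h.measurable i), hg.comp h.measurable₀,
    h.indep.comp (fun _ => g) fun _ => hg, fun i => (h.ident i).comp hg⟩

variable {n : ℕ} {U : Fin n → Ω → ℝ} {U₀ : Ω → ℝ}

/-- The same bound for i.i.d. variables, centred at their mean. -/
theorem IsIIDCopies.measure_abs_sum_sub_gt_le [IsProbabilityMeasure μ] (h : IsIIDCopies μ U U₀)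
    (hUi : Integrable U₀ μ) {l₀ v : ℝ}
    (hi : Integrable (fun ω => (U₀ ω - ∫ ω', U₀ ω' ∂μ) ^ 2 *
      Real.exp (l₀ * |U₀ ω - ∫ ω', U₀ ω' ∂μ|)) μ)
    (hv : ∫ ω, (U₀ ω - ∫ ω', U₀ ω' ∂μ) ^ 2 *
      Real.exp (l₀ * |U₀ ω - ∫ ω', U₀ ω' ∂μ|) ∂μ ≤ v) {l : ℝ} (hl : 0 ≤ l)
    (hl' : l ≤ l₀) (s : Finset (Fin n)) (t : ℝ) :
    μ.real {ω | t < |∑ i ∈ s, (U i ω - ∫ ω', U₀ ω' ∂μ)|} ≤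
      2 * Real.exp (-(l * t) + n * (l ^ 2 * v)) := by
  set m := ∫ ω', U₀ ω' ∂μ with hm
  have hc := h.comp (g := fun x => x - m) (measurable_id.sub_const m)
  have hF : Measurable fun x : ℝ => x ^ 2 * Real.exp (l₀ * |x|) := by fun_prop
  have hv0 : 0 ≤ v := le_trans (integral_nonneg fun ω => by positivity) hv
  refine measure_abs_sum_gt_le (v := v) hc.indep hc.measurable (fun i => ?_) (fun i => ?_)
    (fun i => ?_) (fun i => ?_) hv0 hl hl' s t
  · exact ((hc.ident i).integrable_iff).2 (hUi.sub (integrable_const m))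
  · rw [(hc.ident i).integral_eq, integral_sub hUi (integrable_const m)]
    simp [hm]
  · exact (((hc.ident i).comp hF).integrable_iff).2 hi
  · exact le_trans (le_of_eq ((hc.ident i).comp hF).integral_eq) hv

/-- Bernstein's inequality for sub-exponential variables, at the scale `√(n L)`. -/
theorem IsIIDCopies.bernstein [IsProbabilityMeasure μ] (h : IsIIDCopies μ U U₀)
    (hE : SubExpOne μ U₀) {L : ℝ} (hL : 0 ≤ L) (hLn : L ≤ n) (hn : 0 < n) (s : Finset (Fin n)) :
    μ.real {ω | 34 * Real.sqrt (n * L) < |∑ i ∈ s, (U i ω - ∫ ω', U₀ ω' ∂μ)|} ≤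
      2 * Real.exp (-(5 * L)) := by
  have hn' : (0 : ℝ) < n := by exact_mod_cast hn
  have hUm := h.measurable₀
  set m := ∫ ω', U₀ ω' ∂μ with hm
  have hm1 : |m| ≤ 1 := hE.abs_integral_le hUm
  -- `x² exp (x / 2) ≤ 8 exp x`, and centring costs a factor `e`.
  have hle : ∀ ω, (U₀ ω - m) ^ 2 * Real.exp (1 / 2 * |U₀ ω - m|) ≤ 24 * Real.exp |U₀ ω| := by
    intro ω
    set x := |U₀ ω - m| with hx
    have h0 : 0 ≤ x := abs_nonneg _
    have h1 := Real.pow_div_factorial_le_exp (x / 2) (by positivity) 2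
    have h2 : Real.exp x = Real.exp (x / 2) * Real.exp (x / 2) := by
      rw [← Real.exp_add]; ring_nf
    have h3 : x ≤ |U₀ ω| + 1 := (abs_sub _ _).trans (by linarith)
    have h4 : Real.exp x ≤ Real.exp |U₀ ω| * 3 := by
      refine (Real.exp_le_exp.2 h3).trans ?_
      rw [Real.exp_add]
      have := Real.exp_one_lt_d9
      gcongr
      linarith
    have h5 : (U₀ ω - m) ^ 2 = x ^ 2 := (sq_abs _).symm
    rw [h5, show 1 / 2 * x = x / 2 by ring]
    have h6 : x ^ 2 ≤ 8 * Real.exp (x / 2) := by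
      simp only [Nat.factorial] at h1
      norm_num at h1
      linarith
    calc x ^ 2 * Real.exp (x / 2) ≤ 8 * Real.exp (x / 2) * Real.exp (x / 2) := by gcongr
      _ = 8 * Real.exp x := by rw [h2]; ring
      _ ≤ _ := by linarith
  have hmeas : Measurable fun ω => (U₀ ω - m) ^ 2 * Real.exp (1 / 2 * |U₀ ω - m|) := by fun_prop
  have hi : Integrable (fun ω => (U₀ ω - m) ^ 2 * Real.exp (1 / 2 * |U₀ ω - m|)) μ :=
    (hE.1.const_mul 24).mono' hmeas.aestronglyMeasurable (Filter.Eventually.of_forall fun ω => by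
      rw [Real.norm_eq_abs, abs_of_nonneg (by positivity)]; exact hle ω)
  have hv : ∫ ω, (U₀ ω - m) ^ 2 * Real.exp (1 / 2 * |U₀ ω - m|) ∂μ ≤ 48 := by
    refine (integral_mono hi (hE.1.const_mul 24) hle).trans ?_
    rw [integral_const_mul]
    linarith [hE.2]
  have hl : 1 / 2 * Real.sqrt (L / n) ≤ 1 / 2 := by
    have : Real.sqrt (L / n) ≤ 1 := Real.sqrt_le_one.2 ((div_le_one hn').2 hLn)
    linarith
  refine (h.measure_abs_sum_sub_gt_le (hE.integrable hUm) hi hv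
    (l := 1 / 2 * Real.sqrt (L / n)) (by positivity) hl s _).trans ?_
  refine mul_le_mul_of_nonneg_left (Real.exp_le_exp.2 (le_of_eq ?_)) (by norm_num)
  have h1 : Real.sqrt (L / n) * Real.sqrt (n * L) = L := by
    rw [← Real.sqrt_mul (by positivity), show L / n * (n * L) = L ^ 2 by field_simp,
      Real.sqrt_sq hL]
  have h2 : Real.sqrt (L / n) ^ 2 = L / n := Real.sq_sqrt (by positivity)
  have h3 : (n : ℝ) * ((1 / 2 * Real.sqrt (L / n)) ^ 2 * 48) = 12 * L := by
    rw [mul_pow, h2]; field_simp; ring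
  rw [h3]
  linear_combination (-17) * h1

end Sums

/-! ### Averages of squares of sub-exponential variables -/

section Squares

variable {Ω : Type*} [MeasurableSpace Ω] {μ : Measure Ω}
variable {n : ℕ} {U : Fin n → Ω → ℝ} {U₀ : Ω → ℝ}

theorem abs_min_sub_integral_le [IsProbabilityMeasure μ] {W : Ω → ℝ} (hW : Measurable W) {T : ℝ}
    (h0 : ∀ ω, 0 ≤ W ω) (hT : ∀ ω, W ω ≤ T) (ω : Ω) : |W ω - ∫ ω', W ω' ∂μ| ≤ T := by
  have hi : Integrable W μ := (integrable_const T).mono' hW.aestronglyMeasurable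
    (Filter.Eventually.of_forall fun ω => by
      rw [Real.norm_eq_abs, abs_of_nonneg (h0 ω)]; exact hT ω)
  have h1 : 0 ≤ ∫ ω', W ω' ∂μ := integral_nonneg h0
  have h2 : ∫ ω', W ω' ∂μ ≤ T := by
    have := integral_mono hi (integrable_const T) hT
    simpa using this
  rw [abs_le]
  constructor <;> linarith [h0 ω, hT ω]

/-- The truncation level of squares of sub-exponential variables, in units of `n ^ (1/3)`. It is
chosen so that `E U¹² ≤ 2 · 12!` makes truncation matter with probability at most `1 / (2 n)`. -/
noncomputable def truncLevel : ℝ := 4 * (Nat.factorial 12 : ℕ)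

/-- The constant in the deviation bound for averages of squares of sub-exponential variables. -/
noncomputable def sqConst : ℝ := 390 * truncLevel + 48

theorem one_le_truncLevel : 1 ≤ truncLevel := by
  norm_num [truncLevel, Nat.factorial]

theorem sqConst_pos : 0 < sqConst := by
  have := one_le_truncLevel
  unfold sqConst
  linarith

theorem four_mul_cube_le_exp {a : ℝ} (ha : 0 ≤ a) : 4 * a ^ 3 ≤ Real.exp (6 * a) := by
  have h := Real.pow_div_factorial_le_exp (6 * a) (by positivity) 3
  norm_num [Nat.factorial] at h
  have : 0 ≤ a ^ 3 := by positivity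
  nlinarith

/-- Averages of squares of sub-exponential variables (which have only a moment generating function
of order `1/2`) deviate from their mean by at most a multiple of `n ^ (-1/3)`, except on an event
of probability `1 / n`. The squares are truncated at a multiple of `n ^ (1/3)`; the truncated
variables obey Chernoff's bound, and moments control both the bias and the probability that the
truncation matters. -/
theorem IsIIDCopies.measure_avg_sq_gt_le [IsProbabilityMeasure μ] (h : IsIIDCopies μ U U₀)
    (hE : SubExpOne μ U₀) (hn : 0 < n) :
    μ.real {ω | sqConst * (n : ℝ) ^ (-(1 / 3) : ℝ) <
      |(1 / (n : ℝ)) * ∑ i, U i ω ^ 2 - ∫ ω', U₀ ω' ^ 2 ∂μ|} ≤ 1 / n := by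
  have hn' : (0 : ℝ) < n := by exact_mod_cast hn
  have hUm := h.measurable₀
  set a : ℝ := (n : ℝ) ^ (1 / 3 : ℝ) with ha
  have ha0 : 0 < a := Real.rpow_pos_of_pos hn' _
  have ha3 : a ^ 3 = n := by
    rw [ha, ← Real.rpow_natCast, ← Real.rpow_mul hn'.le]
    norm_num
  have ha1 : 1 ≤ a := Real.one_le_rpow (by exact_mod_cast hn) (by norm_num)
  have hainv : (n : ℝ) ^ (-(1 / 3) : ℝ) = 1 / a := by
    rw [Real.rpow_neg hn'.le, ← ha, one_div]
  set B := truncLevel with hB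
  have hB1 : 1 ≤ B := one_le_truncLevel
  set T := B * a with hT
  have hT0 : 0 < T := by positivity
  have hTa : a ≤ T := by nlinarith
  set W₀ : Ω → ℝ := fun ω => min (U₀ ω ^ 2) T with hW₀
  set W : Fin n → Ω → ℝ := fun i ω => min (U i ω ^ 2) T with hW
  have hWiid : IsIIDCopies μ W W₀ :=
    h.comp (g := fun x => min (x ^ 2) T) ((measurable_id.pow_const 2).min measurable_const)
  have hW₀m : Measurable W₀ := hWiid.measurable₀
  have hW0 : ∀ ω, 0 ≤ W₀ ω := fun ω => le_min (sq_nonneg _) hT0.le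
  have hWT : ∀ ω, W₀ ω ≤ T := fun ω => min_le_right _ _
  have hW2 : ∀ ω, W₀ ω ≤ U₀ ω ^ 2 := fun ω => min_le_left _ _
  have hWi : Integrable W₀ μ := (integrable_const T).mono' hW₀m.aestronglyMeasurable
    (Filter.Eventually.of_forall fun ω => by
      rw [Real.norm_eq_abs, abs_of_nonneg (hW0 ω)]; exact hWT ω)
  have h4i : Integrable (fun ω => U₀ ω ^ 4) μ := by
    simpa only [(show Even 4 by decide).pow_abs] using hE.integrable_pow hUm 4
  have h4 : ∫ ω, U₀ ω ^ 4 ∂μ ≤ 48 := by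
    have := hE.integral_pow_le hUm 4
    simp only [(show Even 4 by decide).pow_abs] at this
    norm_num [Nat.factorial] at this
    exact this
  have h2 : ∫ ω, U₀ ω ^ 2 ∂μ ≤ 4 := by
    have := hE.integral_pow_le hUm 2
    simp only [sq_abs] at this
    norm_num [Nat.factorial] at this
    exact this
  set m := ∫ ω, W₀ ω ∂μ with hm
  have hm0 : 0 ≤ m := integral_nonneg hW0
  have hm4 : m ≤ 4 := (integral_mono hWi (hE.integrable_sq hUm) hW2).trans h2
  -- The bias of the truncation.
  have hbias0 : m ≤ ∫ ω, U₀ ω ^ 2 ∂μ := integral_mono hWi (hE.integrable_sq hUm) hW2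
  have hbias : ∫ ω, U₀ ω ^ 2 ∂μ - m ≤ 48 / a := by
    rw [hm, ← integral_sub (hE.integrable_sq hUm) hWi]
    have h1 : ∫ ω, (U₀ ω ^ 2 - W₀ ω) ∂μ ≤ ∫ ω, U₀ ω ^ 4 / T ∂μ := by
      refine integral_mono ((hE.integrable_sq hUm).sub hWi) (h4i.div_const T) fun ω => ?_
      simp only [hW₀]
      rw [le_div_iff₀ hT0]
      rcases le_total (U₀ ω ^ 2) T with hc | hc
      · rw [min_eq_left hc, sub_self, zero_mul]; positivity
      · rw [min_eq_right hc]; nlinarith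
    rw [integral_div] at h1
    refine h1.trans ?_
    gcongr
  -- Chernoff's bound for the truncated variables.
  have hcher : μ.real {ω | 390 * B * a ^ 2 < |∑ i, (W i ω - m)|} ≤ 1 / (2 * n) := by
    have hle : ∀ ω, (W₀ ω - m) ^ 2 * Real.exp (1 / T * |W₀ ω - m|) ≤
        3 * (2 * U₀ ω ^ 4 + 32) := by
      intro ω
      have h1 : 1 / T * |W₀ ω - m| ≤ 1 := by
        rw [one_div, inv_mul_le_iff₀ hT0, mul_one]
        exact abs_min_sub_integral_le hW₀m hW0 hWT ω
      have h3 : Real.exp (1 / T * |W₀ ω - m|) ≤ 3 :=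
        (Real.exp_le_exp.2 h1).trans (by linarith [Real.exp_one_lt_d9])
      have h5 : (W₀ ω - m) ^ 2 ≤ 2 * U₀ ω ^ 4 + 32 := by
        have h6 : W₀ ω ^ 2 ≤ (U₀ ω ^ 2) ^ 2 := pow_le_pow_left₀ (hW0 ω) (hW2 ω) 2
        nlinarith [sq_nonneg (W₀ ω + m)]
      calc _ ≤ (2 * U₀ ω ^ 4 + 32) * 3 := by gcongr
        _ = _ := by ring
    have hbi : Integrable (fun ω => 3 * (2 * U₀ ω ^ 4 + 32)) μ :=
      ((h4i.const_mul 2).add (integrable_const 32)).const_mul 3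
    have hi : Integrable (fun ω => (W₀ ω - m) ^ 2 * Real.exp (1 / T * |W₀ ω - m|)) μ :=
      hbi.mono' (by fun_prop) (Filter.Eventually.of_forall fun ω => by
        rw [Real.norm_eq_abs, abs_of_nonneg (by positivity)]; exact hle ω)
    have hv : ∫ ω, (W₀ ω - m) ^ 2 * Real.exp (1 / T * |W₀ ω - m|) ∂μ ≤ 384 := by
      refine (integral_mono hi hbi hle).trans ?_
      rw [integral_const_mul, integral_add (h4i.const_mul 2) (integrable_const 32),
        integral_const_mul]
      simp only [integral_const, probReal_univ, smul_eq_mul, one_mul]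
      linarith
    refine (hWiid.measure_abs_sum_sub_gt_le hWi hi hv (l := 1 / T) (by positivity) le_rfl
      Finset.univ _).trans ?_
    have h5 : -(1 / T * (390 * B * a ^ 2)) + n * ((1 / T) ^ 2 * 384) ≤ -(6 * a) := by
      have e1 : 1 / T * (390 * B * a ^ 2) = 390 * a := by rw [hT]; field_simp
      have e2 : n * ((1 / T) ^ 2 * 384) = 384 * a / B ^ 2 := by
        rw [hT, ← ha3]; field_simp
      have e3 : 384 * a / B ^ 2 ≤ 384 * a :=
        div_le_self (by positivity) (one_le_pow₀ hB1)
      rw [e1, e2]; linarith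
    refine (mul_le_mul_of_nonneg_left (Real.exp_le_exp.2 h5) (by norm_num)).trans ?_
    have h6 := four_mul_cube_le_exp ha0.le
    rw [ha3] at h6
    rw [Real.exp_neg, ← div_eq_mul_inv, div_le_div_iff₀ (Real.exp_pos _) (by positivity)]
    linarith
  -- The truncation rarely matters.
  have htr : μ.real {ω | ∃ i, T < U i ω ^ 2} ≤ 1 / (2 * n) := by
    have hone : ∀ i, μ.real {ω | T < U i ω ^ 2} ≤ 1 / (2 * n ^ 2) := by
      intro i
      have h12i : Integrable (fun ω => U i ω ^ 12) μ := by
        have := (((h.ident i).comp (u := fun x : ℝ => x ^ 12)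
          (measurable_id.pow_const 12)).integrable_iff).2 (by
            simpa only [Function.comp_def, (show Even 12 by decide).pow_abs]
              using hE.integrable_pow hUm 12)
        exact this
      have h12 : ∫ ω, U i ω ^ 12 ∂μ ≤ 2 * (Nat.factorial 12 : ℕ) := by
        have e := ((h.ident i).comp (u := fun x : ℝ => x ^ 12)
          (measurable_id.pow_const 12)).integral_eq
        simp only [Function.comp_def] at e
        rw [e]
        simpa only [(show Even 12 by decide).pow_abs] using hE.integral_pow_le hUm 12
      have h1 := mul_meas_ge_le_integral_of_nonneg
        (Filter.Eventually.of_forall fun ω => (show Even 12 by decide).pow_nonneg (U i ω))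
        h12i (T ^ 6)
      have h3 : μ.real {ω | T < U i ω ^ 2} ≤ μ.real {ω | T ^ 6 ≤ U i ω ^ 12} := by
        refine measureReal_mono fun ω hω => ?_
        simp only [Set.mem_ofPred_eq] at hω ⊢
        calc T ^ 6 ≤ (U i ω ^ 2) ^ 6 := pow_le_pow_left₀ hT0.le hω.le 6
          _ = _ := by ring
      have h5 : B * n ^ 2 ≤ T ^ 6 := by
        have : B ≤ B ^ 6 := le_self_pow₀ hB1 (by norm_num)
        rw [hT, mul_pow, ← ha3]
        calc B * (a ^ 3) ^ 2 ≤ B ^ 6 * (a ^ 3) ^ 2 := by gcongr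
          _ = _ := by ring
      have h6 : B * n ^ 2 * μ.real {ω | T < U i ω ^ 2} ≤ 2 * (Nat.factorial 12 : ℕ) :=
        calc _ ≤ T ^ 6 * μ.real {ω | T ^ 6 ≤ U i ω ^ 12} := by gcongr
          _ ≤ _ := h1.trans h12
      have h7 : B = 4 * (Nat.factorial 12 : ℕ) := rfl
      have h8 : (0 : ℝ) < (Nat.factorial 12 : ℕ) := by positivity
      rw [le_div_iff₀ (by positivity)]
      rw [h7] at h6
      nlinarith
    have hU : {ω | ∃ i, T < U i ω ^ 2} = ⋃ i, {ω | T < U i ω ^ 2} := by ext; simp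
    rw [hU]
    refine (measureReal_iUnion_fintype_le _).trans ?_
    refine (Finset.sum_le_sum fun i _ => hone i).trans (le_of_eq ?_)
    simp only [Finset.sum_const, Finset.card_univ, Fintype.card_fin, nsmul_eq_mul]
    field_simp
  have hsub : {ω | sqConst * (n : ℝ) ^ (-(1 / 3) : ℝ) <
      |(1 / (n : ℝ)) * ∑ i, U i ω ^ 2 - ∫ ω', U₀ ω' ^ 2 ∂μ|} ⊆
      {ω | 390 * B * a ^ 2 < |∑ i, (W i ω - m)|} ∪ {ω | ∃ i, T < U i ω ^ 2} := by
    intro ω hω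
    by_contra hcon
    simp only [Set.mem_union, Set.mem_ofPred_eq, not_or, not_exists, not_lt] at hω hcon
    obtain ⟨hc1, hc2⟩ := hcon
    have e1 : ∀ i, W i ω = U i ω ^ 2 := fun i => min_eq_left (hc2 i)
    simp only [e1, Finset.sum_sub_distrib, Finset.sum_const, Finset.card_univ,
      Fintype.card_fin, nsmul_eq_mul] at hc1
    have e2 : (1 / (n : ℝ)) * ∑ i, U i ω ^ 2 - m =
        (1 / (n : ℝ)) * (∑ i, U i ω ^ 2 - n * m) := by field_simp
    have e3 : |(1 / (n : ℝ)) * ∑ i, U i ω ^ 2 - m| ≤ 390 * B / a := by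
      rw [e2, abs_mul, abs_of_pos (by positivity), one_div, inv_mul_le_iff₀ hn', ← ha3]
      rw [← ha3] at hc1
      calc _ ≤ 390 * B * a ^ 2 := hc1
        _ = _ := by field_simp
    have e4 := abs_sub_le ((1 / (n : ℝ)) * ∑ i, U i ω ^ 2) m (∫ ω', U₀ ω' ^ 2 ∂μ)
    have e5 : |m - ∫ ω', U₀ ω' ^ 2 ∂μ| ≤ 48 / a := by
      rw [abs_le]; constructor <;> linarith [div_nonneg (by norm_num : (0 : ℝ) ≤ 48) ha0.le]
    rw [hainv] at hω
    have e6 : sqConst * (1 / a) = 390 * B / a + 48 / a := by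
      rw [sqConst, ← hB]; ring
    linarith
  refine (measureReal_mono hsub).trans ((measureReal_union_le _ _).trans ?_)
  calc _ ≤ 1 / (2 * (n : ℝ)) + 1 / (2 * n) := add_le_add hcher htr
    _ = 1 / n := by field_simp; norm_num

end Squares

/-! ### Sample splitting -/

section Splitting

variable {Ω α β E : Type*} [MeasurableSpace Ω] {μ : Measure Ω} [MeasurableSpace α]
  [MeasurableSpace β] [MeasurableSpace E]

/-- A bound on the probability of an event that is uniform in a parameter stays valid when the
parameter is random and independent of the rest. -/
theorem measureReal_le_of_indepFun [IsProbabilityMeasure μ] {A : Ω → α} {S : Ω → β}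
    (hAS : IndepFun A S μ) (hA : Measurable A) (hS : Measurable S) {B : Set (α × β)}
    (hB : MeasurableSet B) {ε : ℝ} (hε : 0 ≤ ε) (h : ∀ a, μ.real {ω | (a, S ω) ∈ B} ≤ ε) :
    μ.real {ω | (A ω, S ω) ∈ B} ≤ ε := by
  have h1 := (indepFun_iff_map_prod_eq_prod_map_map hA.aemeasurable hS.aemeasurable).1 hAS
  have h2 : μ {ω | (A ω, S ω) ∈ B} = ((μ.map A).prod (μ.map S)) B := by
    rw [← h1, Measure.map_apply (hA.prodMk hS) hB]
    rfl
  have : IsProbabilityMeasure (μ.map A) := Measure.isProbabilityMeasure_map hA.aemeasurable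
  have : IsProbabilityMeasure (μ.map S) := Measure.isProbabilityMeasure_map hS.aemeasurable
  rw [measureReal_def, h2, Measure.prod_apply hB]
  refine ENNReal.toReal_le_of_le_ofReal hε ?_
  calc ∫⁻ a, (μ.map S) (Prod.mk a ⁻¹' B) ∂(μ.map A)
      ≤ ∫⁻ _, ENNReal.ofReal ε ∂(μ.map A) := by
        refine lintegral_mono fun a => ?_
        rw [Measure.map_apply hS (measurable_prodMk_left hB)]
        exact (ENNReal.le_ofReal_iff_toReal_le (measure_ne_top _ _) hε).2 (h a)
    _ = ENNReal.ofReal ε := by simp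

/-- A deviation bound for sums over the subsample `s` that is uniform in a parameter stays valid for
a parameter computed from a disjoint subsample `t`. -/
theorem measureReal_sum_le_of_disjoint [IsProbabilityMeasure μ] {n : ℕ} {ζ : Fin n → Ω → E}
    (hζ : ∀ i, Measurable (ζ i)) (hind : iIndepFun ζ μ) {s t : Finset (Fin n)}
    (hst : Disjoint t s) {A : Ω → α}
    (hA : Measurable[⨆ i ∈ t, MeasurableSpace.comap (ζ i) inferInstance] A)
    {F : α → E → ℝ} (hF : Measurable (Function.uncurry F)) {c : α → ℝ} (hc : Measurable c)
    {ε : ℝ} (hε : 0 ≤ ε)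
    (h : ∀ a, μ.real {ω | c a < |∑ i ∈ s, F a (ζ i ω)|} ≤ ε) :
    μ.real {ω | c (A ω) < |∑ i ∈ s, F (A ω) (ζ i ω)|} ≤ ε := by
  have hmle : ∀ i, MeasurableSpace.comap (ζ i) inferInstance ≤ ‹MeasurableSpace Ω› :=
    fun i => (hζ i).comap_le
  have hA' : Measurable A := hA.mono (iSup₂_le fun i _ => hmle i) le_rfl
  set S : Ω → (s → E) := fun ω i => ζ i ω with hSdef
  have hS' : Measurable S := measurable_pi_iff.2 fun i => hζ i
  have hS : Measurable[⨆ i ∈ s, MeasurableSpace.comap (ζ i) inferInstance] S := by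
    refine (@measurable_pi_iff Ω s (fun _ => E)
      (⨆ i ∈ s, MeasurableSpace.comap (ζ i) inferInstance) _ S).2 fun i => ?_
    have h1 : Measurable[MeasurableSpace.comap (ζ i) inferInstance] (ζ i) :=
      comap_measurable _
    exact h1.mono (le_iSup₂_of_le (i : Fin n) i.2 le_rfl) le_rfl
  have hAS : IndepFun A S μ := by
    have h1 : Indep (⨆ i ∈ (t : Set (Fin n)), MeasurableSpace.comap (ζ i) inferInstance)
        (⨆ i ∈ (s : Set (Fin n)), MeasurableSpace.comap (ζ i) inferInstance) μ :=
      indep_iSup_of_disjoint hmle hind (by exact_mod_cast hst)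
    rw [IndepFun_iff_Indep]
    exact indep_of_indep_of_le_left (indep_of_indep_of_le_right h1 (by
      simpa using hS.comap_le)) (by simpa using hA.comap_le)
  have hB : MeasurableSet {z : α × (s → E) | c z.1 < |∑ i, F z.1 (z.2 i)|} := by
    refine measurableSet_lt (hc.comp measurable_fst) (Measurable.abs ?_)
    refine Finset.measurable_sum _ fun i _ => ?_
    exact hF.comp (measurable_fst.prodMk ((measurable_pi_apply i).comp measurable_snd))
  have hsum : ∀ a ω, ∑ i : s, F a (S ω i) = ∑ i ∈ s, F a (ζ i ω) := fun a ω =>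
    Finset.sum_coe_sort s fun i => F a (ζ i ω)
  have := measureReal_le_of_indepFun hAS hA' hS' hB hε (fun a => by
    simpa only [Set.mem_ofPred_eq, hsum] using h a)
  simpa only [Set.mem_ofPred_eq, hsum] using this

end Splitting

/-! ### Norms and quadratic forms -/

section LinAlg

variable {p : ℕ}

theorem l2Norm_nonneg (v : Fin p → ℝ) : 0 ≤ l2Norm v := Real.sqrt_nonneg _

theorem l1Norm_nonneg (v : Fin p → ℝ) : 0 ≤ l1Norm v := Finset.sum_nonneg fun _ _ => abs_nonneg _

theorem l2Norm_sq (v : Fin p → ℝ) : l2Norm v ^ 2 = v ⬝ᵥ v := by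
  rw [l2Norm, Real.sq_sqrt (Finset.sum_nonneg fun _ _ => sq_nonneg _)]
  exact Finset.sum_congr rfl fun _ _ => sq _

theorem l2Norm_pos {v : Fin p → ℝ} (hv : v ≠ 0) : 0 < l2Norm v := by
  refine lt_of_le_of_ne (l2Norm_nonneg v) fun h => hv ?_
  have h1 := l2Norm_sq v
  rw [← h] at h1
  exact dotProduct_self_eq_zero.1 (by simpa using h1.symm)

theorem measurable_l1Norm : Measurable (l1Norm : (Fin p → ℝ) → ℝ) := by
  unfold l1Norm
  fun_prop

theorem measurable_l2Norm : Measurable (l2Norm : (Fin p → ℝ) → ℝ) := by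
  unfold l2Norm
  fun_prop

/-- Hölder's inequality for `ℓ¹` and `ℓ^∞`. -/
theorem abs_dotProduct_le (a v : Fin p → ℝ) {B : ℝ} (h : ∀ j, |v j| ≤ B) :
    |a ⬝ᵥ v| ≤ l1Norm a * B := by
  rw [l1Norm, Finset.sum_mul]
  refine (Finset.abs_sum_le_sum_abs _ _).trans (Finset.sum_le_sum fun j _ => ?_)
  rw [abs_mul]
  exact mul_le_mul_of_nonneg_left (h j) (abs_nonneg _)

theorem mem_spectrum_iff_hasEigenvalue (A : Matrix (Fin p) (Fin p) ℝ) (l : ℝ) :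
    l ∈ spectrum ℝ A ↔ Module.End.HasEigenvalue (Matrix.toLin' A) l := by
  rw [Module.End.hasEigenvalue_iff_mem_spectrum, Matrix.spectrum_toLin']

theorem EigenvaluesGE.isUnit_det {A : Matrix (Fin p) (Fin p) ℝ} {c : ℝ} (h : EigenvaluesGE A c)
    (hc : 0 < c) : IsUnit A.det := by
  rw [← Matrix.isUnit_iff_isUnit_det]
  by_contra hA
  exact absurd (h 0 ((mem_spectrum_iff_hasEigenvalue A 0).1 (spectrum.zero_mem ℝ hA)))
    (not_le.2 hc)

theorem EigenvaluesGE.le_dotProduct {A : Matrix (Fin p) (Fin p) ℝ} (hA : A.IsSymm) {c : ℝ}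
    (h : EigenvaluesGE A c) (v : Fin p → ℝ) : c * (v ⬝ᵥ v) ≤ v ⬝ᵥ (A *ᵥ v) := by
  have hB : (A - algebraMap ℝ _ c).IsHermitian := by
    have h1 : A.IsHermitian := by
      rw [Matrix.IsHermitian, Matrix.conjTranspose_eq_transpose_of_trivial]; exact hA
    refine h1.sub ?_
    rw [Matrix.IsHermitian, Matrix.conjTranspose_eq_transpose_of_trivial,
      Matrix.algebraMap_eq_diagonal, Matrix.diagonal_transpose]
  have hpsd : (A - algebraMap ℝ _ c).PosSemidef := by
    rw [hB.posSemidef_iff_eigenvalues_nonneg]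
    intro i
    have h1 := hB.eigenvalues_mem_spectrum_real i
    have h2 : hB.eigenvalues i + c ∈ spectrum ℝ A := by
      rw [spectrum.mem_iff] at h1 ⊢
      rw [sub_sub_eq_add_sub] at h1
      rwa [map_add]
    have := h _ ((mem_spectrum_iff_hasEigenvalue A _).1 h2)
    simp only [Pi.zero_apply]
    linarith
  have h3 := hpsd.dotProduct_mulVec_nonneg v
  rw [star_trivial, Matrix.sub_mulVec, dotProduct_sub, Algebra.algebraMap_eq_smul_one,
    Matrix.smul_mulVec, Matrix.one_mulVec, dotProduct_smul, smul_eq_mul] at h3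
  linarith

theorem EigenvaluesLE.dotProduct_le {A : Matrix (Fin p) (Fin p) ℝ} (hA : A.IsSymm) {c : ℝ}
    (h : EigenvaluesLE A c) (v : Fin p → ℝ) : v ⬝ᵥ (A *ᵥ v) ≤ c * (v ⬝ᵥ v) := by
  have hneg : EigenvaluesGE (-A) (-c) := by
    intro l hl
    rw [← mem_spectrum_iff_hasEigenvalue, ← spectrum.neg_eq, Set.mem_neg,
      mem_spectrum_iff_hasEigenvalue] at hl
    linarith [h _ hl]
  have := hneg.le_dotProduct (Matrix.IsSymm.neg hA) v
  rw [Matrix.neg_mulVec, dotProduct_neg] at this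
  linarith

theorem dotProduct_mulVec_comm {A : Matrix (Fin p) (Fin p) ℝ} (hA : A.IsSymm)
    (v w : Fin p → ℝ) : v ⬝ᵥ (A *ᵥ w) = (A *ᵥ v) ⬝ᵥ w := by
  rw [Matrix.dotProduct_mulVec, ← Matrix.mulVec_transpose, hA.eq]

/-- `0 ≤ A ≤ c` implies `‖A v‖₂ ≤ c ‖v‖₂`. -/
theorem l2Norm_mulVec_le {A : Matrix (Fin p) (Fin p) ℝ} (hA : A.IsSymm) {c : ℝ} (hc : 0 < c)
    (h0 : EigenvaluesGE A 0) (h : EigenvaluesLE A c) (v : Fin p → ℝ) :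
    l2Norm (A *ᵥ v) ≤ c * l2Norm v := by
  refine (pow_le_pow_iff_left₀ (l2Norm_nonneg _) (mul_nonneg hc.le (l2Norm_nonneg v))
    two_ne_zero).1 ?_
  rw [mul_pow, l2Norm_sq, l2Norm_sq]
  set y := A *ᵥ v with hy
  have h1 := h.dotProduct_le hA y
  have h2 := h.dotProduct_le hA v
  have h3 := h0.le_dotProduct hA (c • v - y)
  have e1 : v ⬝ᵥ (A *ᵥ y) = y ⬝ᵥ y := dotProduct_mulVec_comm hA v y
  have e2 : y ⬝ᵥ (A *ᵥ v) = y ⬝ᵥ y := rfl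
  rw [Matrix.mulVec_sub, Matrix.mulVec_smul, zero_mul, sub_dotProduct, dotProduct_sub,
    dotProduct_sub, smul_dotProduct, smul_dotProduct, dotProduct_smul, dotProduct_smul, e1,
    e2] at h3
  simp only [smul_eq_mul] at h3
  have h4 : c * (y ⬝ᵥ y) ≤ c * (c * (v ⬝ᵥ (A *ᵥ v))) := by linarith
  have h5 := le_of_mul_le_mul_left h4 hc
  nlinarith

theorem dotProduct_le_of_inv {S : Matrix (Fin p) (Fin p) ℝ} (hS : S.IsSymm) {c : ℝ} (hc : 0 < c)
    (h : EigenvaluesGE S⁻¹ c) (v : Fin p → ℝ) : v ⬝ᵥ (S *ᵥ v) ≤ (v ⬝ᵥ v) / c := by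
  have hu : IsUnit S.det := by
    have := h.isUnit_det hc
    rwa [Matrix.isUnit_nonsing_inv_det_iff] at this
  have hSi : (S⁻¹).IsSymm := by rw [Matrix.IsSymm, Matrix.transpose_nonsing_inv, hS.eq]
  set b := S *ᵥ v with hb
  have e1 : S⁻¹ *ᵥ b = v := by
    rw [hb, Matrix.mulVec_mulVec, Matrix.nonsing_inv_mul _ hu, Matrix.one_mulVec]
  have h1 := h.le_dotProduct hSi b
  rw [e1] at h1
  have h2 : 0 ≤ (v - c • b) ⬝ᵥ (v - c • b) := by
    rw [← l2Norm_sq]; positivity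
  rw [sub_dotProduct, dotProduct_sub, dotProduct_sub, smul_dotProduct, smul_dotProduct,
    dotProduct_smul, dotProduct_smul, dotProduct_comm b v] at h2
  simp only [smul_eq_mul] at h2
  rw [dotProduct_comm b v] at h1
  rw [le_div_iff₀ hc]
  nlinarith

theorem mulVec_eq_colBlock (ξ : Fin p → ℝ) (A : Matrix (Fin p) (Fin p) ℝ) (i : Fin p) :
    (A *ᵥ ξ) i = ∑ j : {j : Fin p // ξ j ≠ 0}, colBlock ξ A i j * ξ j := by
  have h1 : ∑ j : {j : Fin p // ξ j ≠ 0}, colBlock ξ A i j * ξ j =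
      ∑ j ∈ Finset.univ.filter (fun j => ξ j ≠ 0), A i j * ξ j := by
    rw [Finset.sum_subtype (p := fun j => ξ j ≠ 0) (Finset.univ.filter fun j => ξ j ≠ 0)
      (by simp)]
    rfl
  rw [h1, Finset.sum_filter_of_ne]
  · rfl
  · intro j _ hj h0
    exact hj (by rw [h0, mul_zero])

theorem l2Norm_mulVec_le_of_matNorm2 (ξ : Fin p → ℝ) (A : Matrix (Fin p) (Fin p) ℝ) :
    l2Norm (A *ᵥ ξ) ≤ matNorm2 (colBlock ξ A) * l2Norm ξ := by
  set x : EuclideanSpace ℝ {j : Fin p // ξ j ≠ 0} := WithLp.toLp 2 fun j => ξ j with hx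
  have h1 := (LinearMap.toContinuousLinearMap (Matrix.toEuclideanLin (colBlock ξ A))).le_opNorm x
  have h2 : ‖(LinearMap.toContinuousLinearMap (Matrix.toEuclideanLin (colBlock ξ A))) x‖ =
      l2Norm (A *ᵥ ξ) := by
    rw [EuclideanSpace.norm_eq, l2Norm]
    congr 1
    refine Finset.sum_congr rfl fun i _ => ?_
    rw [Real.norm_eq_abs, sq_abs, mulVec_eq_colBlock]
    rfl
  have h3 : ‖x‖ = l2Norm ξ := by
    rw [EuclideanSpace.norm_eq, l2Norm]
    congr 1
    simp only [hx, Real.norm_eq_abs, sq_abs]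
    rw [← Finset.sum_subtype (p := fun j => ξ j ≠ 0) (Finset.univ.filter fun j => ξ j ≠ 0)
      (by simp) (fun j => ξ j ^ 2), Finset.sum_filter_of_ne]
    intro j _ hj h0
    exact hj (by rw [h0]; norm_num)
  rw [h2, h3] at h1
  exact h1

theorem l1Norm_mulVec_le_of_matNorm1 (ξ : Fin p → ℝ) (A : Matrix (Fin p) (Fin p) ℝ) :
    l1Norm (A *ᵥ ξ) ≤ matNorm1 (colBlock ξ A) * l1Norm ξ := by
  have h1 : ∀ j, ∑ i, |colBlock ξ A i j| ≤ matNorm1 (colBlock ξ A) := fun j =>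
    le_ciSup (f := fun j => ∑ i, |colBlock ξ A i j|) (Set.finite_range _).bddAbove j
  have h3 : l1Norm ξ = ∑ j : {j : Fin p // ξ j ≠ 0}, |ξ j| := by
    rw [l1Norm, ← Finset.sum_subtype (p := fun j => ξ j ≠ 0)
      (Finset.univ.filter fun j => ξ j ≠ 0)
      (by simp) (fun j => |ξ j|), Finset.sum_filter_of_ne]
    intro j _ hj h0
    exact hj (by rw [h0, abs_zero])
  rw [h3, l1Norm, Finset.mul_sum]
  calc ∑ i, |(A *ᵥ ξ) i|
      ≤ ∑ i, ∑ j : {j : Fin p // ξ j ≠ 0}, |colBlock ξ A i j| * |ξ j| := by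
        refine Finset.sum_le_sum fun i _ => ?_
        rw [mulVec_eq_colBlock]
        refine (Finset.abs_sum_le_sum_abs _ _).trans (le_of_eq ?_)
        simp only [abs_mul]
    _ = ∑ j : {j : Fin p // ξ j ≠ 0}, (∑ i, |colBlock ξ A i j|) * |ξ j| := by
        rw [Finset.sum_comm]
        simp only [Finset.sum_mul]
    _ ≤ _ := Finset.sum_le_sum fun j _ => mul_le_mul_of_nonneg_right (h1 j) (abs_nonneg _)

end LinAlg

/-! ### Population quantities -/

section Population

variable {Ω : Type*} [MeasurableSpace Ω] {μ : Measure Ω} {p : ℕ} {φ : ℝ → ℝ → ℝ}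
  {X₀ : Ω → Fin p → ℝ} {Y₀ : Ω → ℝ} {βbar : Fin p → ℝ}

/-- The score `φ₁(y, xᵀβ)` of an observation `z = (x, y)`. -/
noncomputable def score (φ : ℝ → ℝ → ℝ) (β : Fin p → ℝ) (z : (Fin p → ℝ) × ℝ) : ℝ :=
  dphi φ 1 z.2 (z.1 ⬝ᵥ β)

/-- The curvature `φ₂(y, xᵀβ)` of the loss at an observation `z = (x, y)`. -/
noncomputable def curv (φ : ℝ → ℝ → ℝ) (β : Fin p → ℝ) (z : (Fin p → ℝ) × ℝ) : ℝ :=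
  dphi φ 2 z.2 (z.1 ⬝ᵥ β)

theorem measurable_dotProduct {α : Type*} [MeasurableSpace α] {f g : α → Fin p → ℝ}
    (hf : Measurable f) (hg : Measurable g) : Measurable fun x => f x ⬝ᵥ g x := by
  simp only [dotProduct]
  exact Finset.measurable_sum _ fun j _ =>
    ((measurable_pi_apply j).comp hf).mul ((measurable_pi_apply j).comp hg)

theorem IsLoss.measurable_score (h : IsLoss φ) (β : Fin p → ℝ) : Measurable (score φ β) :=
  h.measurable_dphi_comp (by norm_num) measurable_snd
    (measurable_dotProduct measurable_fst measurable_const)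

theorem IsLoss.measurable_curv (h : IsLoss φ) (β : Fin p → ℝ) : Measurable (curv φ β) :=
  h.measurable_dphi_comp (by norm_num) measurable_snd
    (measurable_dotProduct measurable_fst measurable_const)

theorem secondMoment_isSymm (μ : Measure Ω) (X₀ : Ω → Fin p → ℝ) :
    (secondMoment μ X₀).IsSymm := by
  refine Matrix.IsSymm.ext fun i j => ?_
  simp only [secondMoment, Matrix.of_apply, mul_comm]

theorem hessian_isSymm (μ : Measure Ω) (φ : ℝ → ℝ → ℝ) (X₀ : Ω → Fin p → ℝ) (Y₀ : Ω → ℝ)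
    (βbar : Fin p → ℝ) : (hessian μ φ X₀ Y₀ βbar).IsSymm := by
  refine Matrix.IsSymm.ext fun i j => ?_
  simp only [hessian, Matrix.of_apply]
  congr 1
  ext ω
  ring

theorem Mstar_isSymm (μ : Measure Ω) (φ : ℝ → ℝ → ℝ) (X₀ : Ω → Fin p → ℝ) (Y₀ : Ω → ℝ)
    (βbar : Fin p → ℝ) : (Mstar μ φ X₀ Y₀ βbar).IsSymm := by
  rw [Mstar, Matrix.IsSymm, Matrix.transpose_nonsing_inv, (hessian_isSymm μ φ X₀ Y₀ βbar).eq]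

theorem hessian_mulVec_Mstar {c : ℝ} (hc : 0 < c)
    (h : EigenvaluesGE (Mstar μ φ X₀ Y₀ βbar) c) (v : Fin p → ℝ) :
    hessian μ φ X₀ Y₀ βbar *ᵥ (Mstar μ φ X₀ Y₀ βbar *ᵥ v) = v := by
  have hu := h.isUnit_det hc
  rw [Mstar, Matrix.isUnit_nonsing_inv_det_iff] at hu
  rw [Mstar, Matrix.mulVec_mulVec, Matrix.mul_nonsing_inv _ hu, Matrix.one_mulVec]

theorem dotProduct_secondMoment
    (hX : ∀ j k, Integrable (fun ω => X₀ ω j * X₀ ω k) μ) (a : Fin p → ℝ) :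
    a ⬝ᵥ (secondMoment μ X₀ *ᵥ a) = ∫ ω, (a ⬝ᵥ X₀ ω) ^ 2 ∂μ := by
  have e : ∀ ω, (a ⬝ᵥ X₀ ω) ^ 2 = ∑ j, ∑ k, a j * a k * (X₀ ω j * X₀ ω k) := by
    intro ω
    rw [sq, dotProduct, Finset.sum_mul_sum]
    refine Finset.sum_congr rfl fun j _ => Finset.sum_congr rfl fun k _ => by ring
  simp only [e]
  rw [integral_finsetSum _ fun j _ => integrable_finsetSum _ fun k _ => (hX j k).const_mul _]
  simp only [dotProduct, Matrix.mulVec, secondMoment, Matrix.of_apply, Finset.mul_sum]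
  refine Finset.sum_congr rfl fun j _ => ?_
  rw [integral_finsetSum _ fun k _ => (hX j k).const_mul _]
  refine Finset.sum_congr rfl fun k _ => ?_
  rw [integral_const_mul]
  ring

/-- Since `H M* = 1`, the population counterpart of `(1/n) ∑ᵢ φ₂ (ξᵀM*X_i) X_i` is `ξ`. -/
theorem integral_curv_mul
    (hX : ∀ j k, Integrable
      (fun ω => dphi φ 2 (Y₀ ω) (X₀ ω ⬝ᵥ βbar) * (X₀ ω j * X₀ ω k)) μ)
    {c : ℝ} (hc : 0 < c) (h : EigenvaluesGE (Mstar μ φ X₀ Y₀ βbar) c) (ξ : Fin p → ℝ)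
    (j : Fin p) :
    ∫ ω, (Mstar μ φ X₀ Y₀ βbar *ᵥ ξ) ⬝ᵥ X₀ ω *
      (dphi φ 2 (Y₀ ω) (X₀ ω ⬝ᵥ βbar) * X₀ ω j) ∂μ = ξ j := by
  have h1 := congrFun (hessian_mulVec_Mstar hc h ξ) j
  set u := Mstar μ φ X₀ Y₀ βbar *ᵥ ξ
  have e : ∀ ω, u ⬝ᵥ X₀ ω * (dphi φ 2 (Y₀ ω) (X₀ ω ⬝ᵥ βbar) * X₀ ω j) =
      ∑ k, dphi φ 2 (Y₀ ω) (X₀ ω ⬝ᵥ βbar) * (X₀ ω j * X₀ ω k) * u k := by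
    intro ω
    rw [dotProduct, Finset.sum_mul]
    exact Finset.sum_congr rfl fun k _ => by ring
  simp only [e]
  rw [integral_finsetSum _ fun k _ => (hX j k).mul_const _, ← h1]
  simp only [Matrix.mulVec, dotProduct, hessian, Matrix.of_apply]
  exact Finset.sum_congr rfl fun k _ => integral_mul_const _ _

/-- The asymptotic variance is at least a multiple of `‖ξ‖₂²`: condition on `X₀`, and use the
lower bounds on the conditional variance of the score and on `M* Σ M*`. -/
theorem le_asympVar [IsProbabilityMeasure μ] (hX₀ : Measurable X₀)
    (hX : ∀ j k, Integrable (fun ω => X₀ ω j * X₀ ω k) μ) {ξ : Fin p → ℝ}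
    (hψ : Integrable (fun ω => dphi φ 1 (Y₀ ω) (X₀ ω ⬝ᵥ βbar) ^ 2) μ)
    (hZψ : Integrable (fun ω => ((Mstar μ φ X₀ Y₀ βbar *ᵥ ξ) ⬝ᵥ X₀ ω) ^ 2 *
      dphi φ 1 (Y₀ ω) (X₀ ω ⬝ᵥ βbar) ^ 2) μ) {C₃ C₅ : ℝ} (hC₅ : 0 ≤ C₅)
    (hE : EigenvaluesGE (Mstar μ φ X₀ Y₀ βbar * secondMoment μ X₀ * Mstar μ φ X₀ Y₀ βbar) C₃)
    (hcond : ∀ᵐ ω ∂μ, C₅ ≤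
      (μ[fun ω' => dphi φ 1 (Y₀ ω') (X₀ ω' ⬝ᵥ βbar) ^ 2 |
        MeasurableSpace.comap X₀ inferInstance]) ω) :
    C₅ * (C₃ * l2Norm ξ ^ 2) ≤ asympVar μ φ X₀ Y₀ βbar ξ := by
  set M := Mstar μ φ X₀ Y₀ βbar with hMdef
  have hM : M.IsSymm := Mstar_isSymm μ φ X₀ Y₀ βbar
  set S := secondMoment μ X₀ with hSdef
  have hS : S.IsSymm := secondMoment_isSymm μ X₀
  set u := M *ᵥ ξ with hu
  set g : Ω → ℝ := fun ω => dphi φ 1 (Y₀ ω) (X₀ ω ⬝ᵥ βbar) ^ 2 with hg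
  set f : Ω → ℝ := fun ω => (u ⬝ᵥ X₀ ω) ^ 2 with hf
  have hm : MeasurableSpace.comap X₀ inferInstance ≤ ‹MeasurableSpace Ω› := hX₀.comap_le
  have hV : asympVar μ φ X₀ Y₀ βbar ξ = ∫ ω, f ω * g ω ∂μ := by
    simp only [asympVar, hf, hg]
    congr 1
    ext ω
    rw [← hMdef, dotProduct_mulVec_comm hM]
  have hfm : StronglyMeasurable[MeasurableSpace.comap X₀ inferInstance] f := by
    refine Measurable.stronglyMeasurable ?_
    have h1 : Measurable fun x : Fin p → ℝ => (u ⬝ᵥ x) ^ 2 :=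
      (measurable_dotProduct measurable_const measurable_id).pow_const 2
    exact h1.comp (comap_measurable X₀)
  have hfi : Integrable f μ := by
    have e : f = fun ω => ∑ j, ∑ k, u j * u k * (X₀ ω j * X₀ ω k) := by
      funext ω
      simp only [hf]
      rw [sq, dotProduct, Finset.sum_mul_sum]
      refine Finset.sum_congr rfl fun j _ => Finset.sum_congr rfl fun k _ => by ring
    rw [e]
    exact integrable_finsetSum _ fun j _ => integrable_finsetSum _ fun k _ =>
      (hX j k).const_mul _
  have hpull : μ[fun ω => f ω * g ω | MeasurableSpace.comap X₀ inferInstance] =ᵐ[μ]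
      fun ω => f ω * (μ[g | MeasurableSpace.comap X₀ inferInstance]) ω :=
    condExp_mul_of_stronglyMeasurable_left hfm hZψ hψ
  have hint : ∫ ω, f ω * g ω ∂μ =
      ∫ ω, f ω * (μ[g | MeasurableSpace.comap X₀ inferInstance]) ω ∂μ := by
    rw [← integral_congr_ae hpull, integral_condExp hm]
  have hlow : ∫ ω, C₅ * f ω ∂μ ≤
      ∫ ω, f ω * (μ[g | MeasurableSpace.comap X₀ inferInstance]) ω ∂μ := by
    refine integral_mono_ae (hfi.const_mul C₅) (integrable_condExp.congr hpull) ?_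
    filter_upwards [hcond] with ω hω
    rw [mul_comm]
    exact mul_le_mul_of_nonneg_left hω (sq_nonneg _)
  have hquad : C₃ * l2Norm ξ ^ 2 ≤ ∫ ω, f ω ∂μ := by
    rw [← dotProduct_secondMoment hX u, l2Norm_sq]
    have h1 : (M * S * M).IsSymm := by
      rw [Matrix.IsSymm, Matrix.transpose_mul, Matrix.transpose_mul, hM.eq, hS.eq,
        Matrix.mul_assoc]
    refine (hE.le_dotProduct h1 ξ).trans (le_of_eq ?_)
    rw [← Matrix.mulVec_mulVec, ← Matrix.mulVec_mulVec, dotProduct_mulVec_comm hM]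
  rw [hV, hint]
  refine le_trans ?_ hlow
  rw [integral_const_mul]
  gcongr

end Population

/-! ### Sub-gaussian designs -/

section Design

variable {Ω : Type*} [MeasurableSpace Ω] {μ : Measure Ω} {p : ℕ} {X₀ : Ω → Fin p → ℝ}

theorem SubGaussianVector.subGauss (hX₀ : Measurable X₀) {σ : ℝ} (hσ : 0 < σ)
    (h : SubGaussianVector μ X₀ σ) {s : Fin p → ℝ} (hs : s ≠ 0) :
    SubGauss μ (fun ω => s ⬝ᵥ X₀ ω) (2 * σ * l2Norm s) := by
  have h1 : psi2Norm μ (fun ω => (s ⬝ᵥ X₀ ω) / l2Norm s) ≤ ENNReal.ofReal σ :=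
    le_trans (le_iSup₂_of_le s hs le_rfl) h
  have hl := l2Norm_pos hs
  have h2 := (subGauss_of_psi2Norm_le
    ((measurable_dotProduct measurable_const hX₀).div_const _) hσ h1).const_mul hl.ne'
  have e : ∀ ω, l2Norm s * ((s ⬝ᵥ X₀ ω) / l2Norm s) = s ⬝ᵥ X₀ ω := fun ω => by
    field_simp
  simpa only [e, mul_comm (l2Norm s)] using h2

theorem SubGaussianVector.subGauss_apply (hX₀ : Measurable X₀) {σ : ℝ} (hσ : 0 < σ)
    (h : SubGaussianVector μ X₀ σ) (j : Fin p) : SubGauss μ (fun ω => X₀ ω j) (2 * σ) := by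
  have hs : (Pi.single j 1 : Fin p → ℝ) ≠ 0 := by simp
  have h1 := h.subGauss hX₀ hσ hs
  have hl : l2Norm (Pi.single j 1 : Fin p → ℝ) = 1 := by
    have := l2Norm_sq (Pi.single j 1 : Fin p → ℝ)
    simp only [single_dotProduct, Pi.single_eq_same, mul_one] at this
    nlinarith [l2Norm_nonneg (Pi.single j 1 : Fin p → ℝ)]
  simpa only [hl, single_dotProduct, one_mul, mul_one] using h1

end Design

/-! ### Deterministic expansions -/

section Deterministic

variable {n : ℕ}

/-- Cauchy–Schwarz for empirical averages. -/
theorem abs_avg_mul_le {u w : Fin n → ℝ} {a b : ℝ} (ha : 0 ≤ a) (hb : 0 ≤ b)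
    (hu : (1 / (n : ℝ)) * ∑ i, u i ^ 2 ≤ a ^ 2) (hw : (1 / (n : ℝ)) * ∑ i, w i ^ 2 ≤ b ^ 2) :
    |(1 / (n : ℝ)) * ∑ i, u i * w i| ≤ a * b := by
  refine abs_le_of_sq_le_sq ?_ (mul_nonneg ha hb)
  have h1 := Finset.sum_mul_sq_le_sq_mul_sq Finset.univ u w
  have h2 : 0 ≤ ∑ i, w i ^ 2 := Finset.sum_nonneg fun _ _ => sq_nonneg _
  have h3 : (0 : ℝ) ≤ 1 / n := by positivity
  calc ((1 / (n : ℝ)) * ∑ i, u i * w i) ^ 2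
      = (1 / (n : ℝ)) ^ 2 * (∑ i, u i * w i) ^ 2 := mul_pow _ _ _
    _ ≤ (1 / (n : ℝ)) ^ 2 * ((∑ i, u i ^ 2) * ∑ i, w i ^ 2) := by gcongr
    _ = ((1 / (n : ℝ)) * ∑ i, u i ^ 2) * ((1 / (n : ℝ)) * ∑ i, w i ^ 2) := by ring
    _ ≤ a ^ 2 * b ^ 2 := by gcongr
    _ = (a * b) ^ 2 := by ring

theorem avg_le_of_le {u v : Fin n → ℝ} {a c : ℝ} (hc : 0 ≤ c) (h : ∀ i, u i ≤ c * v i)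
    (hv : (1 / (n : ℝ)) * ∑ i, v i ≤ a) : (1 / (n : ℝ)) * ∑ i, u i ≤ c * a :=
  calc (1 / (n : ℝ)) * ∑ i, u i ≤ (1 / (n : ℝ)) * ∑ i, c * v i := by
        gcongr with i
        exact h i
    _ = c * ((1 / (n : ℝ)) * ∑ i, v i) := by rw [← Finset.mul_sum]; ring
    _ ≤ c * a := by gcongr

/-- The error of the debiased estimator. Here `Z`, `ψ`, `f` are the projected covariates, scores
and curvatures at the target, `ψ'` the scores at the estimator, `x` the errors of the linear
predictor, `d` the error of the plug-in estimator, and `Z + e` the projections computed with the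
estimated inverse Hessians. -/
theorem abs_debiased_error_le {Z e ψ ψ' f x : Fin n → ℝ} {d b₁ b₂ b₃ b₄ b₅ b₆ C₆ C₇ : ℝ}
    (hb₃ : 0 ≤ b₃) (hb₄ : 0 ≤ b₄) (hC₆ : 0 ≤ C₆) (hC₇ : 0 ≤ C₇)
    (hb₅ : 0 ≤ b₅) (hb₆ : 0 ≤ b₆)
    (h1 : |(1 / (n : ℝ)) * ∑ i, e i * ψ i| ≤ b₁)
    (h2 : |d - (1 / (n : ℝ)) * ∑ i, Z i * f i * x i| ≤ b₂)
    (h3 : (1 / (n : ℝ)) * ∑ i, e i ^ 2 ≤ b₃ ^ 2)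
    (h4 : (1 / (n : ℝ)) * ∑ i, x i ^ 2 ≤ b₄ ^ 2)
    (h5 : ∀ i, |Z i| ≤ b₅) (h6 : ∀ i, |e i| ≤ b₆)
    (hf : ∀ i, |f i| ≤ C₆)
    (hR : ∀ i, |ψ' i - ψ i - f i * x i| ≤ C₇ * x i ^ 2) :
    |d - (1 / (n : ℝ)) * ∑ i, (Z i + e i) * ψ' i + (1 / (n : ℝ)) * ∑ i, Z i * ψ i| ≤
      b₁ + b₂ + C₆ * (b₃ * b₄) + C₇ * (b₅ + b₆) * b₄ ^ 2 := by
  have key : d - (1 / (n : ℝ)) * ∑ i, (Z i + e i) * ψ' i + (1 / (n : ℝ)) * ∑ i, Z i * ψ i =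
      -((1 / (n : ℝ)) * ∑ i, e i * ψ i) + (d - (1 / (n : ℝ)) * ∑ i, Z i * f i * x i)
      - (1 / (n : ℝ)) * ∑ i, e i * (f i * x i)
      - (1 / (n : ℝ)) * ∑ i, (Z i + e i) * (ψ' i - ψ i - f i * x i) := by
    have : ∑ i, (Z i + e i) * ψ' i = ∑ i, Z i * ψ i + ∑ i, e i * ψ i + ∑ i, Z i * f i * x i +
        ∑ i, e i * (f i * x i) + ∑ i, (Z i + e i) * (ψ' i - ψ i - f i * x i) := by
      simp only [← Finset.sum_add_distrib]
      exact Finset.sum_congr rfl fun i _ => by ring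
    rw [this]
    ring
  have hA : |(1 / (n : ℝ)) * ∑ i, e i * (f i * x i)| ≤ b₃ * (C₆ * b₄) := by
    refine abs_avg_mul_le hb₃ (mul_nonneg hC₆ hb₄) h3 ?_
    rw [mul_pow]
    refine avg_le_of_le (sq_nonneg _) (fun i => ?_) h4
    rw [mul_pow]
    have := hf i
    rw [← sq_abs (f i)]
    gcongr
  have hB : |(1 / (n : ℝ)) * ∑ i, (Z i + e i) * (ψ' i - ψ i - f i * x i)| ≤
      C₇ * (b₅ + b₆) * b₄ ^ 2 := by
    rw [abs_mul, abs_of_nonneg (by positivity : (0 : ℝ) ≤ 1 / n)]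
    have hs : (1 / (n : ℝ)) * |∑ i, (Z i + e i) * (ψ' i - ψ i - f i * x i)| ≤
        (1 / (n : ℝ)) * ∑ i, |(Z i + e i) * (ψ' i - ψ i - f i * x i)| := by
      gcongr
      exact Finset.abs_sum_le_sum_abs _ _
    refine hs.trans (avg_le_of_le (by positivity) (fun i => ?_) h4)
    rw [abs_mul]
    have h7 : |Z i + e i| ≤ b₅ + b₆ := (abs_add_le _ _).trans (add_le_add (h5 i) (h6 i))
    calc _ ≤ (b₅ + b₆) * (C₇ * x i ^ 2) := by gcongr; exact hR i
      _ = _ := by ring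
  rw [key]
  have t1 := abs_sub (-((1 / (n : ℝ)) * ∑ i, e i * ψ i) +
    (d - (1 / (n : ℝ)) * ∑ i, Z i * f i * x i) - (1 / (n : ℝ)) * ∑ i, e i * (f i * x i))
    ((1 / (n : ℝ)) * ∑ i, (Z i + e i) * (ψ' i - ψ i - f i * x i))
  have t2 := abs_sub (-((1 / (n : ℝ)) * ∑ i, e i * ψ i) +
    (d - (1 / (n : ℝ)) * ∑ i, Z i * f i * x i)) ((1 / (n : ℝ)) * ∑ i, e i * (f i * x i))
  have t3 := abs_add_le (-((1 / (n : ℝ)) * ∑ i, e i * ψ i))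
    (d - (1 / (n : ℝ)) * ∑ i, Z i * f i * x i)
  rw [abs_neg] at t3
  linarith

/-- The error of the variance estimator, in the notation of `abs_debiased_error_le`. -/
theorem abs_varEst_error_le {Z e ψ ψ' x : Fin n → ℝ} {V b₀ b₄ b₅ b₆ b₇ c w u : ℝ}
    (hw : 0 ≤ w) (hu : 0 ≤ u)
    (h0 : |(1 / (n : ℝ)) * ∑ i, (Z i * ψ i) ^ 2 - V| ≤ b₀)
    (h4 : (1 / (n : ℝ)) * ∑ i, x i ^ 2 ≤ b₄ ^ 2)
    (h5 : ∀ i, |Z i| ≤ b₅) (h6 : ∀ i, |e i| ≤ b₆)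
    (h7 : (1 / (n : ℝ)) * ∑ i, ψ i ^ 2 ≤ b₇ ^ 2)
    (hR : ∀ i, |ψ' i - ψ i| ≤ c * |x i|)
    (hwle : 3 * (b₅ ^ 2 * c ^ 2 * b₄ ^ 2 + b₆ ^ 2 * b₇ ^ 2 + b₆ ^ 2 * c ^ 2 * b₄ ^ 2) ≤ w ^ 2)
    (hule : V + b₀ ≤ u ^ 2) :
    |(1 / (n : ℝ)) * ∑ i, ((Z i + e i) * ψ' i) ^ 2 - V| ≤ b₀ + w ^ 2 + 2 * (u * w) := by
  set r : Fin n → ℝ := fun i => (Z i + e i) * ψ' i - Z i * ψ i with hr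
  have hsplit : ∀ i, r i ^ 2 ≤ 3 * b₅ ^ 2 * c ^ 2 * x i ^ 2 + 3 * b₆ ^ 2 * ψ i ^ 2 +
      3 * b₆ ^ 2 * c ^ 2 * x i ^ 2 := by
    intro i
    have e1 : r i = Z i * (ψ' i - ψ i) + e i * ψ i + e i * (ψ' i - ψ i) := by
      simp only [hr]; ring
    have e2 : r i ^ 2 ≤ 3 * ((Z i) ^ 2 * (ψ' i - ψ i) ^ 2 + (e i) ^ 2 * (ψ i) ^ 2 +
        (e i) ^ 2 * (ψ' i - ψ i) ^ 2) := by
      rw [e1]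
      nlinarith [sq_nonneg (Z i * (ψ' i - ψ i) - e i * ψ i),
        sq_nonneg (Z i * (ψ' i - ψ i) - e i * (ψ' i - ψ i)),
        sq_nonneg (e i * ψ i - e i * (ψ' i - ψ i))]
    have hZ : Z i ^ 2 ≤ b₅ ^ 2 := by rw [← sq_abs]; exact pow_le_pow_left₀ (abs_nonneg _) (h5 i) 2
    have he : e i ^ 2 ≤ b₆ ^ 2 := by rw [← sq_abs]; exact pow_le_pow_left₀ (abs_nonneg _) (h6 i) 2
    have hd : (ψ' i - ψ i) ^ 2 ≤ c ^ 2 * x i ^ 2 := by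
      rw [← sq_abs, ← sq_abs (x i), ← mul_pow]
      exact pow_le_pow_left₀ (abs_nonneg _) (hR i) 2
    have m1 : Z i ^ 2 * (ψ' i - ψ i) ^ 2 ≤ b₅ ^ 2 * (c ^ 2 * x i ^ 2) := by gcongr
    have m2 : e i ^ 2 * ψ i ^ 2 ≤ b₆ ^ 2 * ψ i ^ 2 := by gcongr
    have m3 : e i ^ 2 * (ψ' i - ψ i) ^ 2 ≤ b₆ ^ 2 * (c ^ 2 * x i ^ 2) := by gcongr
    linarith
  have hrw : (1 / (n : ℝ)) * ∑ i, r i ^ 2 ≤ w ^ 2 := by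
    have hn0 : (0 : ℝ) ≤ 1 / n := by positivity
    have h1 : (1 / (n : ℝ)) * ∑ i, r i ^ 2 ≤
        (1 / (n : ℝ)) * ∑ i, (3 * b₅ ^ 2 * c ^ 2 * x i ^ 2 + 3 * b₆ ^ 2 * ψ i ^ 2 +
          3 * b₆ ^ 2 * c ^ 2 * x i ^ 2) := by
      gcongr with i
      exact hsplit i
    rw [Finset.sum_add_distrib, Finset.sum_add_distrib, ← Finset.mul_sum, ← Finset.mul_sum,
      ← Finset.mul_sum] at h1
    have g1 := mul_le_mul_of_nonneg_left h4
      (show (0 : ℝ) ≤ 3 * b₅ ^ 2 * c ^ 2 + 3 * b₆ ^ 2 * c ^ 2 by positivity)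
    have g2 := mul_le_mul_of_nonneg_left h7 (show (0 : ℝ) ≤ 3 * b₆ ^ 2 by positivity)
    nlinarith
  have hzu : (1 / (n : ℝ)) * ∑ i, (Z i * ψ i) ^ 2 ≤ u ^ 2 := by
    linarith [(abs_le.1 h0).2]
  have hcross := abs_avg_mul_le hu hw hzu hrw
  have key : (1 / (n : ℝ)) * ∑ i, ((Z i + e i) * ψ' i) ^ 2 - V =
      ((1 / (n : ℝ)) * ∑ i, (Z i * ψ i) ^ 2 - V) + (1 / (n : ℝ)) * ∑ i, r i ^ 2 +
      2 * ((1 / (n : ℝ)) * ∑ i, Z i * ψ i * r i) := by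
    have : ∑ i, ((Z i + e i) * ψ' i) ^ 2 =
        ∑ i, (Z i * ψ i) ^ 2 + ∑ i, r i ^ 2 + 2 * ∑ i, Z i * ψ i * r i := by
      rw [Finset.mul_sum]
      simp only [← Finset.sum_add_distrib]
      exact Finset.sum_congr rfl fun i _ => by simp only [hr]; ring
    rw [this]
    ring
  have hr0 : 0 ≤ (1 / (n : ℝ)) * ∑ i, r i ^ 2 :=
    mul_nonneg (by positivity) (Finset.sum_nonneg fun _ _ => sq_nonneg _)
  rw [key, abs_le]
  obtain ⟨a1, a2⟩ := abs_le.1 h0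
  obtain ⟨c1, c2⟩ := abs_le.1 hcross
  constructor <;> nlinarith

end Deterministic

/-! ### Events of high probability -/

section Events

variable {Ω : Type*} [MeasurableSpace Ω] {μ : Measure Ω} {n : ℕ}

/-- With `L = log N`, a union bound over `N³` sums, each of which fails Bernstein's bound with
probability `2 exp (-5 L)`, costs `1 / N`. -/
theorem mul_exp_neg_five_log_le {N m : ℝ} (hN : 2 ≤ N) (hm : m ≤ N ^ 3) :
    m * (2 * Real.exp (-(5 * Real.log N))) ≤ 1 / N := by
  have hN0 : 0 < N := by linarith
  have e : Real.exp (-(5 * Real.log N)) = (N ^ 5)⁻¹ := by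
    rw [Real.exp_neg, show 5 * Real.log N = ((5 : ℕ) : ℝ) * Real.log N by norm_num,
      Real.exp_nat_mul, Real.exp_log hN0]
  rw [e, ← div_eq_mul_inv, ← mul_div_assoc, div_le_div_iff₀ (by positivity) hN0, one_mul]
  calc m * 2 * N ≤ N ^ 3 * N * N := by gcongr
    _ = N ^ 5 := by ring

/-- With `L = log N`, a union bound over `N²` sub-gaussian variables, each of which exceeds `2 √L`
times its norm with probability `2 exp (-4 L)`, costs `1 / N`. -/
theorem mul_exp_neg_four_log_le {N m : ℝ} (hN : 2 ≤ N) (hm : m ≤ N ^ 2) :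
    m * (2 * Real.exp (-(4 * Real.log N))) ≤ 1 / N := by
  have hN0 : 0 < N := by linarith
  have e : Real.exp (-(4 * Real.log N)) = (N ^ 4)⁻¹ := by
    rw [Real.exp_neg, show 4 * Real.log N = ((4 : ℕ) : ℝ) * Real.log N by norm_num,
      Real.exp_nat_mul, Real.exp_log hN0]
  rw [e, ← div_eq_mul_inv, ← mul_div_assoc, div_le_div_iff₀ (by positivity) hN0, one_mul]
  calc m * 2 * N ≤ N ^ 2 * N * N := by gcongr
    _ = N ^ 4 := by ring

theorem IsIIDCopies.bernstein_scaled [IsProbabilityMeasure μ] {U : Fin n → Ω → ℝ} {U₀ : Ω → ℝ}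
    (h : IsIIDCopies μ U U₀) {κ : ℝ} (hκ : 0 < κ) (hE : SubExpOne μ (fun ω => U₀ ω / κ)) {L : ℝ}
    (hL : 0 ≤ L) (hLn : L ≤ n) (hn : 0 < n) (s : Finset (Fin n)) :
    μ.real {ω | 34 * κ * Real.sqrt (n * L) < |∑ i ∈ s, (U i ω - ∫ ω', U₀ ω' ∂μ)|} ≤
      2 * Real.exp (-(5 * L)) := by
  have h1 := (h.comp (g := fun x => x / κ) (measurable_id.div_const κ)).bernstein hE hL hLn hn s
  refine le_trans (measureReal_mono fun ω hω => ?_) h1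
  simp only [Set.mem_ofPred_eq] at hω ⊢
  have e : ∑ i ∈ s, (U i ω / κ - ∫ ω', U₀ ω' / κ ∂μ) =
      (∑ i ∈ s, (U i ω - ∫ ω', U₀ ω' ∂μ)) / κ := by
    rw [integral_div, Finset.sum_div]
    exact Finset.sum_congr rfl fun i _ => (sub_div _ _ _).symm
  rw [e, abs_div, abs_of_pos hκ, lt_div_iff₀ hκ]
  linarith

theorem IsIIDCopies.measure_avg_sq_gt_le_scaled [IsProbabilityMeasure μ] {U : Fin n → Ω → ℝ}
    {U₀ : Ω → ℝ} (h : IsIIDCopies μ U U₀) {κ : ℝ} (hκ : 0 < κ)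
    (hE : SubExpOne μ (fun ω => U₀ ω / κ)) (hn : 0 < n) :
    μ.real {ω | sqConst * κ ^ 2 * (n : ℝ) ^ (-(1 / 3) : ℝ) <
      |(1 / (n : ℝ)) * ∑ i, U i ω ^ 2 - ∫ ω', U₀ ω' ^ 2 ∂μ|} ≤ 1 / n := by
  have h1 := (h.comp (g := fun x => x / κ) (measurable_id.div_const κ)).measure_avg_sq_gt_le hE hn
  refine le_trans (measureReal_mono fun ω hω => ?_) h1
  simp only [Set.mem_ofPred_eq] at hω ⊢
  have e : (1 / (n : ℝ)) * ∑ i, (U i ω / κ) ^ 2 - ∫ ω', (U₀ ω' / κ) ^ 2 ∂μ =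
      ((1 / (n : ℝ)) * ∑ i, U i ω ^ 2 - ∫ ω', U₀ ω' ^ 2 ∂μ) / κ ^ 2 := by
    simp only [div_pow]
    rw [integral_div, ← Finset.sum_div]
    ring
  rw [e, abs_div, abs_of_pos (by positivity : 0 < κ ^ 2), lt_div_iff₀ (by positivity)]
  linarith

/-- A sub-gaussian variable exceeds `t` times its norm in one of `n` independent copies with
probability at most `2 n exp (-t²)`. -/
theorem IsIIDCopies.measure_exists_gt_le [IsProbabilityMeasure μ] {U : Fin n → Ω → ℝ} {U₀ : Ω → ℝ}
    (h : IsIIDCopies μ U U₀) {k t : ℝ} (hk : 0 < k) (hE : SubGauss μ U₀ k) (ht : 0 ≤ t) :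
    μ.real {ω | ∃ i, t * k < |U i ω|} ≤ n * (2 * Real.exp (-t ^ 2)) := by
  have hone : ∀ i, μ.real {ω | t * k < |U i ω|} ≤ 2 * Real.exp (-t ^ 2) := by
    intro i
    have h1 : μ {ω | t * k < |U i ω|} = μ {ω | t * k < |U₀ ω|} :=
      (h.ident i).measure_mem_eq (s := {x : ℝ | t * k < |x|})
        (measurableSet_lt measurable_const measurable_id.abs)
    rw [measureReal_def, h1]
    exact hE.tail hk ht
  have hU : {ω | ∃ i, t * k < |U i ω|} = ⋃ i, {ω | t * k < |U i ω|} := by ext; simp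
  rw [hU]
  refine (measureReal_iUnion_fintype_le _).trans ((Finset.sum_le_sum fun i _ => hone i).trans
    (le_of_eq ?_))
  simp

theorem measureReal_exists_le {ι : Type*} [Fintype ι] [IsFiniteMeasure μ] {S : ι → Set Ω} {ε : ℝ}
    (h : ∀ i, μ.real (S i) ≤ ε) : μ.real {ω | ∃ i, ω ∈ S i} ≤ Fintype.card ι * ε := by
  have hU : {ω | ∃ i, ω ∈ S i} = ⋃ i, S i := by ext; simp
  rw [hU]
  refine (measureReal_iUnion_fintype_le _).trans ((Finset.sum_le_sum fun i _ => h i).trans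
    (le_of_eq ?_))
  simp

variable {p : ℕ}

/-- What is needed of a subsample `s` and of a direction `a` (the error of the estimate of `M* ξ`
from the other subsample). The size `v` of `a` is measured in the `ℓ¹` norm when only the entries
of `X` are sub-gaussian, and in the Euclidean norm when `X` is a sub-gaussian vector. -/
structure CrossfitGood (φ : ℝ → ℝ → ℝ) (βbar : Fin p → ℝ) (Sig : Matrix (Fin p) (Fin p) ℝ)
    (kx kψ L : ℝ) (z : Fin n → (Fin p → ℝ) × ℝ) (s : Finset (Fin n)) (a : Fin p → ℝ) (v : ℝ) :
    Prop where
  score_le : |∑ i ∈ s, (a ⬝ᵥ (z i).1) * score φ βbar (z i)| ≤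
    34 * (kx * kψ) * v * Real.sqrt (n * L)
  quad_le : |∑ i ∈ s, ((a ⬝ᵥ (z i).1) ^ 2 - a ⬝ᵥ (Sig *ᵥ a))| ≤
    34 * kx ^ 2 * v ^ 2 * Real.sqrt (n * L)
  max_le : ∀ i ∈ s, |a ⬝ᵥ (z i).1| ≤ 2 * Real.sqrt L * kx * v

variable {φ : ℝ → ℝ → ℝ} {X₀ : Ω → Fin p → ℝ} {Y₀ : Ω → ℝ} {βbar : Fin p → ℝ}
  {ζ : Fin n → Ω → (Fin p → ℝ) × ℝ} {kx kψ N : ℝ}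

theorem subExpOne_of_subGauss_mul {Z W : Ω → ℝ} {k l : ℝ} (hZ : SubGauss μ Z k)
    (hW : SubGauss μ W l) (hZm : Measurable Z) (hWm : Measurable W) :
    SubExpOne μ (fun ω => Z ω * W ω / (k * l)) := by
  have := hZ.mul hW hZm hWm
  simpa only [div_mul_div_comm] using this

theorem integrable_mul_of_subGauss {Z W : Ω → ℝ} {k l : ℝ} (hk : 0 < k) (hl : 0 < l)
    (hZ : SubGauss μ Z k)
    (hW : SubGauss μ W l) (hZm : Measurable Z) (hWm : Measurable W) :
    Integrable (fun ω => Z ω * W ω) μ := by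
  have h1 := (subExpOne_of_subGauss_mul hZ hW hZm hWm).integrable
    ((hZm.mul hWm).div_const _)
  have e : (fun ω => Z ω * W ω) = fun ω => (k * l) * (Z ω * W ω / (k * l)) := by
    funext ω; field_simp
  rw [e]
  exact h1.const_mul _

/-- Sub-gaussian entries: the sums are controlled coordinatewise, and Hölder's inequality between
`ℓ¹` and `ℓ^∞` gives the bounds for all directions at once. -/
theorem measure_not_crossfitGood_l1 [IsProbabilityMeasure μ] (hφ : IsLoss φ)
    (h : IsIIDCopies μ ζ (fun ω => (X₀ ω, Y₀ ω))) (hT : IsTarget μ φ X₀ Y₀ βbar)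
    (hkx : 0 < kx) (hkψ : 0 < kψ) (hX : ∀ j, SubGauss μ (fun ω => X₀ ω j) kx)
    (hψ : SubGauss μ (fun ω => score φ βbar (X₀ ω, Y₀ ω)) kψ)
    (hN : 2 ≤ N) (hnN : (n : ℝ) ≤ N) (hpN : (p : ℝ) ≤ N) (hLn : Real.log N ≤ n) (hn : 0 < n)
    (s : Finset (Fin n)) :
    μ.real {ω | ¬ ∀ a, CrossfitGood φ βbar (secondMoment μ X₀) kx kψ (Real.log N)
      (fun i => ζ i ω) s a (l1Norm a)} ≤ 3 / N := by
  have hX₀ : Measurable X₀ := measurable_fst.comp h.measurable₀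
  have hXm : ∀ j, Measurable fun ω => X₀ ω j := fun j => (measurable_pi_apply j).comp hX₀
  have hψm : Measurable fun ω => score φ βbar (X₀ ω, Y₀ ω) :=
    (hφ.measurable_score βbar).comp h.measurable₀
  have hN0 : 0 < N := by linarith
  set L := Real.log N with hLdef
  have hL0 : 0 ≤ L := Real.log_nonneg (by linarith)
  set B₁ : Set Ω := {ω | ∃ j, ω ∈ {ω | 34 * (kx * kψ) * Real.sqrt (n * L) <
    |∑ i ∈ s, (ζ i ω).1 j * score φ βbar (ζ i ω)|}} with hB₁
  set B₂ : Set Ω := {ω | ∃ jk : Fin p × Fin p, ω ∈ {ω | 34 * (kx * kx) * Real.sqrt (n * L) <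
    |∑ i ∈ s, ((ζ i ω).1 jk.1 * (ζ i ω).1 jk.2 - secondMoment μ X₀ jk.1 jk.2)|}} with hB₂
  set B₃ : Set Ω := {ω | ∃ j, ω ∈ {ω | ∃ i, 2 * Real.sqrt L * kx < |(ζ i ω).1 j|}} with hB₃
  have hb₁ : μ.real B₁ ≤ 1 / N := by
    refine (measureReal_exists_le fun j => ?_).trans (mul_exp_neg_five_log_le (N := N) hN
      (m := (Fintype.card (Fin p) : ℝ)) ?_)
    · have h1 := (h.comp (g := fun z => z.1 j * score φ βbar z)
        (((measurable_pi_apply j).comp measurable_fst).mul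
          (hφ.measurable_score βbar))).bernstein_scaled (κ := kx * kψ) (by positivity)
        (subExpOne_of_subGauss_mul (hX j) hψ (hXm j) hψm) hL0 hLn hn s
      have h0 : ∫ ω, X₀ ω j * score φ βbar (X₀ ω, Y₀ ω) ∂μ = 0 := by
        have h2 := hT.integral_score_eq_zero hφ (Pi.single j 1) (by
          simpa [score, mul_comm] using integrable_mul_of_subGauss hkx hkψ (hX j) hψ (hXm j) hψm)
        simpa [score, mul_comm] using h2
      simpa only [h0, sub_zero] using h1
    · rw [Fintype.card_fin]
      exact hpN.trans (le_self_pow₀ (by linarith) (by norm_num))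
  have hb₂ : μ.real B₂ ≤ 1 / N := by
    refine (measureReal_exists_le fun jk => ?_).trans (mul_exp_neg_five_log_le (N := N) hN
      (m := (Fintype.card (Fin p × Fin p) : ℝ)) ?_)
    · exact (h.comp (g := fun z => z.1 jk.1 * z.1 jk.2)
        (((measurable_pi_apply jk.1).comp measurable_fst).mul
          ((measurable_pi_apply jk.2).comp measurable_fst))).bernstein_scaled (κ := kx * kx)
        (by positivity)
        (subExpOne_of_subGauss_mul (hX jk.1) (hX jk.2) (hXm jk.1) (hXm jk.2)) hL0 hLn hn s
    · rw [Fintype.card_prod, Fintype.card_fin, Nat.cast_mul, ← sq]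
      exact (pow_le_pow_left₀ (by positivity) hpN 2).trans
        (pow_le_pow_right₀ (by linarith) (by norm_num))
  have hb₃ : μ.real B₃ ≤ 1 / N := by
    refine (measureReal_exists_le (ε := n * (2 * Real.exp (-(4 * L)))) fun j => ?_).trans ?_
    · have h1 := (h.comp (g := fun z => z.1 j)
        ((measurable_pi_apply j).comp measurable_fst)).measure_exists_gt_le hkx (hX j)
        (t := 2 * Real.sqrt L) (by positivity)
      rwa [mul_pow, Real.sq_sqrt hL0, show (2 : ℝ) ^ 2 * L = 4 * L by ring] at h1
    · rw [Fintype.card_fin, ← mul_assoc]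
      refine mul_exp_neg_four_log_le hN ?_
      rw [sq]
      gcongr
  have hsub : {ω | ¬ ∀ a, CrossfitGood φ βbar (secondMoment μ X₀) kx kψ L
      (fun i => ζ i ω) s a (l1Norm a)} ⊆ B₁ ∪ B₂ ∪ B₃ := by
    intro ω hω
    by_contra hcon
    simp only [hB₁, hB₂, hB₃, Set.mem_union, Set.mem_ofPred_eq, not_or, not_exists, not_lt]
      at hω hcon
    obtain ⟨⟨hc1, hc2⟩, hc3⟩ := hcon
    refine hω fun a => ⟨?_, ?_, ?_⟩
    · have e : ∑ i ∈ s, (a ⬝ᵥ (ζ i ω).1) * score φ βbar (ζ i ω) =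
          a ⬝ᵥ fun j => ∑ i ∈ s, (ζ i ω).1 j * score φ βbar (ζ i ω) := by
        simp only [dotProduct, Finset.sum_mul, Finset.mul_sum]
        rw [Finset.sum_comm]
        exact Finset.sum_congr rfl fun _ _ => Finset.sum_congr rfl fun _ _ => by ring
      rw [e]
      refine (abs_dotProduct_le _ _ hc1).trans (le_of_eq ?_)
      ring
    · have e : ∑ i ∈ s, ((a ⬝ᵥ (ζ i ω).1) ^ 2 - a ⬝ᵥ (secondMoment μ X₀ *ᵥ a)) =
          a ⬝ᵥ fun j => a ⬝ᵥ fun k =>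
            ∑ i ∈ s, ((ζ i ω).1 j * (ζ i ω).1 k - secondMoment μ X₀ j k) := by
        have e1 : ∀ i, (a ⬝ᵥ (ζ i ω).1) ^ 2 - a ⬝ᵥ (secondMoment μ X₀ *ᵥ a) =
            ∑ j, ∑ k, a j * (a k * ((ζ i ω).1 j * (ζ i ω).1 k - secondMoment μ X₀ j k)) := by
          intro i
          rw [sq, dotProduct, Finset.sum_mul_sum]
          simp only [dotProduct, Matrix.mulVec, Finset.mul_sum, ← Finset.sum_sub_distrib]
          exact Finset.sum_congr rfl fun _ _ => Finset.sum_congr rfl fun _ _ => by ring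
        simp only [e1]
        rw [Finset.sum_comm]
        simp only [dotProduct, Finset.mul_sum]
        refine Finset.sum_congr rfl fun j _ => ?_
        rw [Finset.sum_comm]
      rw [e]
      refine (abs_dotProduct_le _ _ fun j => abs_dotProduct_le _ _ fun k => hc2 (j, k)).trans
        (le_of_eq ?_)
      ring
    · intro i _
      refine (abs_dotProduct_le _ _ fun j => hc3 j i).trans (le_of_eq ?_)
      ring
  refine (measureReal_mono hsub).trans ((measureReal_union_le _ _).trans
    ((add_le_add (measureReal_union_le _ _) le_rfl).trans ?_))
  calc _ ≤ 1 / N + 1 / N + 1 / N := by gcongr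
    _ = 3 / N := by ring

/-- Sub-gaussian vectors: for a fixed direction the bounds hold with the Euclidean norm, and the
direction may be replaced by a random one that is computed from the other subsample. -/
theorem measure_not_crossfitGood_l2 [IsProbabilityMeasure μ] (hφ : IsLoss φ)
    (h : IsIIDCopies μ ζ (fun ω => (X₀ ω, Y₀ ω))) (hT : IsTarget μ φ X₀ Y₀ βbar)
    (hkx : 0 < kx) (hkψ : 0 < kψ) (hX : ∀ j, SubGauss μ (fun ω => X₀ ω j) kx)
    (hXa : ∀ a : Fin p → ℝ, a ≠ 0 → SubGauss μ (fun ω => a ⬝ᵥ X₀ ω) (kx * l2Norm a))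
    (hψ : SubGauss μ (fun ω => score φ βbar (X₀ ω, Y₀ ω)) kψ)
    (hN : 2 ≤ N) (hnN : (n : ℝ) ≤ N) (hLn : Real.log N ≤ n) (hn : 0 < n)
    {s t : Finset (Fin n)} (hst : Disjoint t s) {A : Ω → Fin p → ℝ}
    (hA : Measurable[⨆ i ∈ t, MeasurableSpace.comap (ζ i) inferInstance] A) :
    μ.real {ω | ¬ CrossfitGood φ βbar (secondMoment μ X₀) kx kψ (Real.log N)
      (fun i => ζ i ω) s (A ω) (l2Norm (A ω))} ≤ 3 / N := by
  have hX₀ : Measurable X₀ := measurable_fst.comp h.measurable₀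
  have hXm : ∀ j, Measurable fun ω => X₀ ω j := fun j => (measurable_pi_apply j).comp hX₀
  have hXam : ∀ a : Fin p → ℝ, Measurable fun ω => a ⬝ᵥ X₀ ω := fun a =>
    measurable_dotProduct measurable_const hX₀
  have hψm : Measurable fun ω => score φ βbar (X₀ ω, Y₀ ω) :=
    (hφ.measurable_score βbar).comp h.measurable₀
  have hXX : ∀ j k, Integrable (fun ω => X₀ ω j * X₀ ω k) μ := fun j k =>
    integrable_mul_of_subGauss hkx hkx (hX j) (hX k) (hXm j) (hXm k)
  have hN0 : 0 < N := by linarith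
  set L := Real.log N with hLdef
  have hL0 : 0 ≤ L := Real.log_nonneg (by linarith)
  have hl2 : Measurable (l2Norm : (Fin p → ℝ) → ℝ) := measurable_l2Norm
  have hdot : Measurable fun az : (Fin p → ℝ) × ((Fin p → ℝ) × ℝ) => az.1 ⬝ᵥ az.2.1 :=
    measurable_dotProduct measurable_fst (measurable_fst.comp measurable_snd)
  have hquad : Measurable fun a : Fin p → ℝ => a ⬝ᵥ (secondMoment μ X₀ *ᵥ a) := by
    refine measurable_dotProduct measurable_id (measurable_pi_iff.2 fun j => ?_)
    simp only [Matrix.mulVec]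
    exact measurable_dotProduct measurable_const measurable_id
  have h50 := mul_exp_neg_five_log_le (m := 1) hN (one_le_pow₀ (by linarith))
  have h40 := mul_exp_neg_four_log_le (m := n) hN
    (hnN.trans (le_self_pow₀ (by linarith) (by norm_num)))
  rw [one_mul] at h50
  have hzero : ∀ {c : ℝ}, 0 ≤ c → μ.real {ω : Ω | c < (0 : ℝ)} ≤ 2 * Real.exp (-(5 * L)) := by
    intro c hc
    simp only [not_lt.2 hc]
    rw [Set.ofPred_false, measureReal_empty]
    positivity
  have hb₁ : μ.real {ω | 34 * (kx * kψ) * l2Norm (A ω) * Real.sqrt (n * L) <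
      |∑ i ∈ s, (A ω ⬝ᵥ (ζ i ω).1) * score φ βbar (ζ i ω)|} ≤ 1 / N := by
    refine (measureReal_sum_le_of_disjoint h.measurable h.indep hst hA
      (F := fun a z => (a ⬝ᵥ z.1) * score φ βbar z)
      (c := fun a => 34 * (kx * kψ) * l2Norm a * Real.sqrt (n * L)) ?_ ?_ (by positivity)
      fun a => ?_).trans h50
    · exact hdot.mul ((hφ.measurable_score βbar).comp measurable_snd)
    · exact (hl2.const_mul _).mul_const _
    · by_cases ha : a = 0
      · simp only [ha, zero_dotProduct, zero_mul, Finset.sum_const_zero, abs_zero]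
        exact hzero (by have := l2Norm_nonneg (0 : Fin p → ℝ); positivity)
      · have hl := l2Norm_pos ha
        have h1 := (h.comp (g := fun z => (a ⬝ᵥ z.1) * score φ βbar z)
          ((measurable_dotProduct measurable_const measurable_fst).mul
            (hφ.measurable_score βbar))).bernstein_scaled (κ := kx * l2Norm a * kψ)
          (by positivity)
          (subExpOne_of_subGauss_mul (hXa a ha) hψ (hXam a) hψm) hL0 hLn hn s
        have h0 : ∫ ω, (a ⬝ᵥ X₀ ω) * score φ βbar (X₀ ω, Y₀ ω) ∂μ = 0 := by
          have hi := integrable_mul_of_subGauss (by positivity) hkψ (hXa a ha) hψ (hXam a) hψm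
          have h2 := hT.integral_score_eq_zero hφ a (by
            refine hi.congr (Filter.Eventually.of_forall fun ω => ?_)
            simp only [score]
            rw [mul_comm, dotProduct_comm a (X₀ ω)])
          rw [← h2]
          congr 1
          ext ω
          simp only [score]
          rw [mul_comm, dotProduct_comm a (X₀ ω)]
        simp only [h0, sub_zero] at h1
        rwa [show 34 * (kx * kψ) * l2Norm a * Real.sqrt (n * L) =
          34 * (kx * l2Norm a * kψ) * Real.sqrt (n * L) by ring]
  have hb₂ : μ.real {ω | 34 * kx ^ 2 * l2Norm (A ω) ^ 2 * Real.sqrt (n * L) <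
      |∑ i ∈ s, ((A ω ⬝ᵥ (ζ i ω).1) ^ 2 - A ω ⬝ᵥ (secondMoment μ X₀ *ᵥ A ω))|} ≤ 1 / N := by
    refine (measureReal_sum_le_of_disjoint h.measurable h.indep hst hA
      (F := fun a z => (a ⬝ᵥ z.1) ^ 2 - a ⬝ᵥ (secondMoment μ X₀ *ᵥ a))
      (c := fun a => 34 * kx ^ 2 * l2Norm a ^ 2 * Real.sqrt (n * L)) ?_ ?_ (by positivity)
      fun a => ?_).trans h50
    · exact (hdot.pow_const 2).sub (hquad.comp measurable_fst)
    · exact ((hl2.pow_const 2).const_mul _).mul_const _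
    · by_cases ha : a = 0
      · simp only [ha, zero_dotProduct, ne_eq, OfNat.ofNat_ne_zero, not_false_eq_true, zero_pow,
          sub_zero, Finset.sum_const_zero, abs_zero]
        exact hzero (by positivity)
      · have hl := l2Norm_pos ha
        have h1 := (h.comp (g := fun z => (a ⬝ᵥ z.1) * (a ⬝ᵥ z.1))
          ((measurable_dotProduct measurable_const measurable_fst).mul
            (measurable_dotProduct measurable_const measurable_fst))).bernstein_scaled
          (κ := kx * l2Norm a * (kx * l2Norm a)) (by positivity)
          (subExpOne_of_subGauss_mul (hXa a ha) (hXa a ha) (hXam a) (hXam a)) hL0 hLn hn s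
        simp only [← sq] at h1
        rw [← dotProduct_secondMoment hXX a] at h1
        rwa [show 34 * kx ^ 2 * l2Norm a ^ 2 * Real.sqrt (n * L) =
          34 * (kx * l2Norm a) ^ 2 * Real.sqrt (n * L) by ring]
  have hb₃ : μ.real {ω | ∃ i : s, ω ∈ {ω | 2 * Real.sqrt L * kx * l2Norm (A ω) <
      |A ω ⬝ᵥ (ζ i ω).1|}} ≤ 1 / N := by
    refine (measureReal_exists_le (ε := 2 * Real.exp (-(4 * L))) fun i => ?_).trans
      (le_trans ?_ h40)
    · have h1 := measureReal_sum_le_of_disjoint (ε := 2 * Real.exp (-(4 * L))) h.measurable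
        h.indep (s := {(i : Fin n)})
        (Finset.disjoint_singleton_right.2 (Finset.disjoint_right.1 hst i.2)) hA
        (F := fun a z => a ⬝ᵥ z.1)
        (c := fun a => 2 * Real.sqrt L * kx * l2Norm a) hdot (hl2.const_mul _) (by positivity)
        fun a => ?_
      · simpa only [Finset.sum_singleton] using h1
      · simp only [Finset.sum_singleton]
        by_cases ha : a = 0
        · simp only [ha, zero_dotProduct, abs_zero]
          have hc : 0 ≤ 2 * Real.sqrt L * kx * l2Norm (0 : Fin p → ℝ) := by
            have := l2Norm_nonneg (0 : Fin p → ℝ); positivity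
          simp only [not_lt.2 hc]
          rw [Set.ofPred_false, measureReal_empty]
          positivity
        · have hl := l2Norm_pos ha
          have h2 := (hXa a ha).tail (by positivity) (t := 2 * Real.sqrt L) (by positivity)
          rw [mul_pow, Real.sq_sqrt hL0, show (2 : ℝ) ^ 2 * L = 4 * L by ring] at h2
          have h3 : μ {ω | 2 * Real.sqrt L * kx * l2Norm a < |a ⬝ᵥ (ζ i ω).1|} =
              μ {ω | 2 * Real.sqrt L * kx * l2Norm a < |a ⬝ᵥ X₀ ω|} :=
            (h.ident i).measure_mem_eq
              (s := {z : (Fin p → ℝ) × ℝ | 2 * Real.sqrt L * kx * l2Norm a < |a ⬝ᵥ z.1|})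
              (measurableSet_lt measurable_const
                (measurable_dotProduct measurable_const measurable_fst).abs)
          rw [measureReal_def, h3, ← measureReal_def]
          simpa only [mul_assoc] using h2
    · have : ((Fintype.card s : ℕ) : ℝ) ≤ n := by
        rw [Fintype.card_coe]
        exact_mod_cast (Finset.card_le_univ s).trans (by simp)
      gcongr
  refine (measureReal_mono (fun ω hω => ?_ : _ ⊆ ({ω | 34 * (kx * kψ) * l2Norm (A ω) *
      Real.sqrt (n * L) < |∑ i ∈ s, (A ω ⬝ᵥ (ζ i ω).1) * score φ βbar (ζ i ω)|} ∪
      {ω | 34 * kx ^ 2 * l2Norm (A ω) ^ 2 * Real.sqrt (n * L) <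
      |∑ i ∈ s, ((A ω ⬝ᵥ (ζ i ω).1) ^ 2 - A ω ⬝ᵥ (secondMoment μ X₀ *ᵥ A ω))|}) ∪
      {ω | ∃ i : s, ω ∈ {ω | 2 * Real.sqrt L * kx * l2Norm (A ω) <
      |A ω ⬝ᵥ (ζ i ω).1|}})).trans ((measureReal_union_le _ _).trans
    ((add_le_add (measureReal_union_le _ _) le_rfl).trans ?_))
  · by_contra hcon
    simp only [Set.mem_union, Set.mem_ofPred_eq, not_or, not_exists, not_lt] at hω hcon
    exact hω ⟨hcon.1.1, hcon.1.2, fun i hi => hcon.2 ⟨i, hi⟩⟩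
  · calc _ ≤ 1 / N + 1 / N + 1 / N := by gcongr
      _ = 3 / N := by ring

end Events

/-! ### The asymptotic variance and the sample -/

section CommonEvents

variable {Ω : Type*} [MeasurableSpace Ω] {μ : Measure Ω} {n p : ℕ}
  {φ : ℝ → ℝ → ℝ} {X₀ : Ω → Fin p → ℝ} {Y₀ : Ω → ℝ} {βbar ξ : Fin p → ℝ}
  {ζ : Fin n → Ω → (Fin p → ℝ) × ℝ} {kx kz kψ N C₃ C₅ C₆ C₇ : ℝ}

/-- Properties of the sample that do not involve the estimators; `u` stands for `M* ξ` and `V` for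
the asymptotic variance. -/
structure SampleGood (φ : ℝ → ℝ → ℝ) (βbar ξ u : Fin p → ℝ) (V kx kz kψ L C₆ C₇ : ℝ)
    (z : Fin n → (Fin p → ℝ) × ℝ) : Prop where
  proj_le : ∀ i, |u ⬝ᵥ (z i).1| ≤ 2 * Real.sqrt (Real.log n) * kz
  entry_le : ∀ i j, |(z i).1 j| ≤ 2 * Real.sqrt L * kx
  curv_le : ∀ j, |∑ i, ((u ⬝ᵥ (z i).1) * (curv φ βbar (z i) * (z i).1 j) - ξ j)| ≤
    34 * (kz * kx * C₆) * Real.sqrt (n * L)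
  score_sq_le : (1 / (n : ℝ)) * ∑ i, score φ βbar (z i) ^ 2 ≤ 35 * kψ ^ 2
  var_le : |(1 / (n : ℝ)) * ∑ i, ((u ⬝ᵥ (z i).1) * score φ βbar (z i)) ^ 2 - V| ≤
    sqConst * (kz * kψ) ^ 2 * (n : ℝ) ^ (-(1 / 3) : ℝ)
  mem_lipSet : ∀ i, (z i).2 ∈ lipSet φ C₇
  abs_curv_le : ∀ i, |curv φ βbar (z i)| ≤ C₆

theorem asympVar_eq (μ : Measure Ω) (φ : ℝ → ℝ → ℝ) (X₀ : Ω → Fin p → ℝ) (Y₀ : Ω → ℝ)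
    (βbar ξ : Fin p → ℝ) : asympVar μ φ X₀ Y₀ βbar ξ =
      ∫ ω, ((Mstar μ φ X₀ Y₀ βbar *ᵥ ξ) ⬝ᵥ X₀ ω * score φ βbar (X₀ ω, Y₀ ω)) ^ 2 ∂μ := by
  simp only [asympVar, score, mul_pow]
  congr 1
  ext ω
  rw [dotProduct_mulVec_comm (Mstar_isSymm μ φ X₀ Y₀ βbar)]

/-- `V` is a second moment of the product of two sub-gaussian variables. -/
theorem asympVar_le (hX₀ : Measurable X₀)
    (hψm : Measurable fun ω => score φ βbar (X₀ ω, Y₀ ω)) (hkz : 0 < kz) (hkψ : 0 < kψ)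
    (hZ : SubGauss μ (fun ω => (Mstar μ φ X₀ Y₀ βbar *ᵥ ξ) ⬝ᵥ X₀ ω) kz)
    (hψ : SubGauss μ (fun ω => score φ βbar (X₀ ω, Y₀ ω)) kψ) :
    asympVar μ φ X₀ Y₀ βbar ξ ≤ 4 * (kz * kψ) ^ 2 := by
  have hZm := measurable_dotProduct (f := fun _ => Mstar μ φ X₀ Y₀ βbar *ᵥ ξ)
    measurable_const hX₀
  have h1 := (subExpOne_of_subGauss_mul hZ hψ hZm hψm).integral_pow_le
    ((hZm.mul hψm).div_const _) 2
  simp only [sq_abs, div_pow] at h1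
  rw [integral_div, ← asympVar_eq, div_le_iff₀ (by positivity)] at h1
  norm_num [Nat.factorial] at h1
  linarith

theorem le_asympVar_of_subGauss [IsProbabilityMeasure μ] (hX₀ : Measurable X₀)
    (hψm : Measurable fun ω => score φ βbar (X₀ ω, Y₀ ω))
    (hkx : 0 < kx) (hkz : 0 < kz) (hkψ : 0 < kψ)
    (hX : ∀ j, SubGauss μ (fun ω => X₀ ω j) kx)
    (hZ : SubGauss μ (fun ω => (Mstar μ φ X₀ Y₀ βbar *ᵥ ξ) ⬝ᵥ X₀ ω) kz)
    (hψ : SubGauss μ (fun ω => score φ βbar (X₀ ω, Y₀ ω)) kψ) (hC₅ : 0 ≤ C₅)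
    (hE : EigenvaluesGE (Mstar μ φ X₀ Y₀ βbar * secondMoment μ X₀ * Mstar μ φ X₀ Y₀ βbar) C₃)
    (hcond : ∀ᵐ ω ∂μ, C₅ ≤
      (μ[fun ω' => dphi φ 1 (Y₀ ω') (X₀ ω' ⬝ᵥ βbar) ^ 2 |
        MeasurableSpace.comap X₀ inferInstance]) ω) :
    C₅ * (C₃ * l2Norm ξ ^ 2) ≤ asympVar μ φ X₀ Y₀ βbar ξ := by
  have hZm := measurable_dotProduct (f := fun _ => Mstar μ φ X₀ Y₀ βbar *ᵥ ξ)
    measurable_const hX₀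
  have hXm : ∀ j, Measurable fun ω => X₀ ω j := fun j => (measurable_pi_apply j).comp hX₀
  have hsq := (subExpOne_of_subGauss_mul hZ hψ hZm hψm).integrable_sq
    ((hZm.mul hψm).div_const _)
  refine le_asympVar hX₀ (fun j k => integrable_mul_of_subGauss hkx hkx (hX j) (hX k) (hXm j)
    (hXm k)) ?_ ?_ hC₅ hE hcond
  · refine (integrable_mul_of_subGauss hkψ hkψ hψ hψ hψm hψm).congr
      (Filter.Eventually.of_forall fun ω => ?_)
    simp only [score, sq]
  · refine (hsq.mul_const ((kz * kψ) ^ 2)).congr (Filter.Eventually.of_forall fun ω => ?_)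
    simp only [score]
    field_simp

/-- Two of the events fail with probability `1 / n` (the bound for all projections and the average
of squares), three with probability `1 / N`, and the ones on the loss have probability one. -/
theorem measure_not_sampleGood [IsProbabilityMeasure μ] (hφ : IsLoss φ)
    (h : IsIIDCopies μ ζ (fun ω => (X₀ ω, Y₀ ω)))
    (hkx : 0 < kx) (hkz : 0 < kz) (hkψ : 0 < kψ) (hX : ∀ j, SubGauss μ (fun ω => X₀ ω j) kx)
    (hZ : SubGauss μ (fun ω => (Mstar μ φ X₀ Y₀ βbar *ᵥ ξ) ⬝ᵥ X₀ ω) kz)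
    (hψ : SubGauss μ (fun ω => score φ βbar (X₀ ω, Y₀ ω)) kψ)
    (hC₃ : 0 < C₃) (hM : EigenvaluesGE (Mstar μ φ X₀ Y₀ βbar) C₃) (hC₆ : 0 < C₆)
    (hD : DerivativeBounds μ φ X₀ Y₀ βbar C₆ C₇)
    (hN : 2 ≤ N) (hnN : (n : ℝ) ≤ N) (hpN : (p : ℝ) ≤ N) (hLn : Real.log N ≤ n) (hn : 2 ≤ n) :
    μ.real {ω | ¬ SampleGood φ βbar ξ (Mstar μ φ X₀ Y₀ βbar *ᵥ ξ) (asympVar μ φ X₀ Y₀ βbar ξ)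
      kx kz kψ (Real.log N) C₆ C₇ (fun i => ζ i ω)} ≤ 2 / n + 3 / N := by
  have hn0 : 0 < n := by omega
  have hn0' : (0 : ℝ) < n := by exact_mod_cast hn0
  have hn2 : (2 : ℝ) ≤ n := by exact_mod_cast hn
  have hX₀ : Measurable X₀ := measurable_fst.comp h.measurable₀
  have hXm : ∀ j, Measurable fun ω => X₀ ω j := fun j => (measurable_pi_apply j).comp hX₀
  have hψm : Measurable fun ω => score φ βbar (X₀ ω, Y₀ ω) :=
    (hφ.measurable_score βbar).comp h.measurable₀
  have hcm : Measurable fun ω => curv φ βbar (X₀ ω, Y₀ ω) :=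
    (hφ.measurable_curv βbar).comp h.measurable₀
  have hN0 : 0 < N := by linarith
  set u := Mstar μ φ X₀ Y₀ βbar *ᵥ ξ with hu
  have hZm : Measurable fun ω => u ⬝ᵥ X₀ ω := measurable_dotProduct measurable_const hX₀
  have hum : Measurable fun z : (Fin p → ℝ) × ℝ => u ⬝ᵥ z.1 :=
    measurable_dotProduct measurable_const measurable_fst
  set L := Real.log N with hLdef
  have hL0 : 0 ≤ L := Real.log_nonneg (by linarith)
  have hreg₀ : ∀ᵐ ω ∂μ, |curv φ βbar (X₀ ω, Y₀ ω)| ≤ C₆ ∧ Y₀ ω ∈ lipSet φ C₇ := by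
    filter_upwards [hD] with ω hω
    refine ⟨?_, hφ.mem_lipSet hω.2⟩
    rw [curv, abs_of_nonneg (hφ.dphi_two_nonneg _ _)]
    exact hω.1
  set B₁ : Set Ω := {ω | ∃ i, 2 * Real.sqrt (Real.log n) * kz < |u ⬝ᵥ (ζ i ω).1|} with hB₁
  set B₂ : Set Ω := {ω | ∃ j, ω ∈ {ω | ∃ i, 2 * Real.sqrt L * kx < |(ζ i ω).1 j|}} with hB₂
  set B₃ : Set Ω := {ω | ∃ j, ω ∈ {ω | 34 * (kz * kx * C₆) * Real.sqrt (n * L) <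
    |∑ i, ((u ⬝ᵥ (ζ i ω).1) * (curv φ βbar (ζ i ω) * (ζ i ω).1 j) - ξ j)|}} with hB₃
  set B₄ : Set Ω := {ω | 34 * (kψ * kψ) * Real.sqrt (n * L) <
    |∑ i, (score φ βbar (ζ i ω) * score φ βbar (ζ i ω) -
      ∫ ω', score φ βbar (X₀ ω', Y₀ ω') * score φ βbar (X₀ ω', Y₀ ω') ∂μ)|} with hB₄
  set B₅ : Set Ω := {ω | sqConst * (kz * kψ) ^ 2 * (n : ℝ) ^ (-(1 / 3) : ℝ) <
    |(1 / (n : ℝ)) * ∑ i, ((u ⬝ᵥ (ζ i ω).1) * score φ βbar (ζ i ω)) ^ 2 -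
      asympVar μ φ X₀ Y₀ βbar ξ|} with hB₅
  set B₆ : Set Ω := {ω | ¬ ∀ i, |curv φ βbar (ζ i ω)| ≤ C₆ ∧ (ζ i ω).2 ∈ lipSet φ C₇} with hB₆
  have hb₁ : μ.real B₁ ≤ 1 / n := by
    have h1 := (h.comp (g := fun z => u ⬝ᵥ z.1) hum).measure_exists_gt_le hkz hZ
      (t := 2 * Real.sqrt (Real.log n)) (by positivity)
    rw [mul_pow, Real.sq_sqrt (Real.log_nonneg (by linarith)),
      show (2 : ℝ) ^ 2 * Real.log n = 4 * Real.log n by ring] at h1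
    exact h1.trans (mul_exp_neg_four_log_le hn2 (le_self_pow₀ (by linarith) (by norm_num)))
  have hb₂ : μ.real B₂ ≤ 1 / N := by
    refine (measureReal_exists_le (ε := n * (2 * Real.exp (-(4 * L)))) fun j => ?_).trans ?_
    · have h1 := (h.comp (g := fun z => z.1 j)
        ((measurable_pi_apply j).comp measurable_fst)).measure_exists_gt_le hkx (hX j)
        (t := 2 * Real.sqrt L) (by positivity)
      rwa [mul_pow, Real.sq_sqrt hL0, show (2 : ℝ) ^ 2 * L = 4 * L by ring] at h1
    · rw [Fintype.card_fin, ← mul_assoc]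
      refine mul_exp_neg_four_log_le hN ?_
      rw [sq]
      gcongr
  have hb₃ : μ.real B₃ ≤ 1 / N := by
    refine (measureReal_exists_le fun j => ?_).trans (mul_exp_neg_five_log_le (N := N) hN
      (m := (Fintype.card (Fin p) : ℝ)) ?_)
    · have hXX : ∀ j k, Integrable
          (fun ω => dphi φ 2 (Y₀ ω) (X₀ ω ⬝ᵥ βbar) * (X₀ ω j * X₀ ω k)) μ := by
        intro j k
        refine ((integrable_mul_of_subGauss hkx hkx (hX j) (hX k) (hXm j) (hXm k)).norm.const_mul
          C₆).mono' (hcm.mul ((hXm j).mul (hXm k))).aestronglyMeasurable ?_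
        filter_upwards [hreg₀] with ω hω
        rw [norm_mul]
        exact mul_le_mul_of_nonneg_right hω.1 (norm_nonneg _)
      have h0 : ∫ ω, u ⬝ᵥ X₀ ω * (curv φ βbar (X₀ ω, Y₀ ω) * X₀ ω j) ∂μ = ξ j :=
        integral_curv_mul hXX hC₃ hM ξ j
      have hE : SubExpOne μ (fun ω => u ⬝ᵥ X₀ ω * (curv φ βbar (X₀ ω, Y₀ ω) * X₀ ω j) /
          (kz * kx * C₆)) := by
        refine (subExpOne_of_subGauss_mul hZ (hX j) hZm (hXm j)).mono
          ((hZm.mul (hcm.mul (hXm j))).div_const _) ?_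
        filter_upwards [hreg₀] with ω hω
        rw [abs_div, abs_div, abs_of_pos (by positivity : 0 < kz * kx * C₆),
          abs_of_pos (by positivity : 0 < kz * kx), abs_mul, abs_mul, abs_mul,
          div_le_div_iff₀ (by positivity) (by positivity)]
        calc |u ⬝ᵥ X₀ ω| * (|curv φ βbar (X₀ ω, Y₀ ω)| * |X₀ ω j|) * (kz * kx)
            ≤ |u ⬝ᵥ X₀ ω| * (C₆ * |X₀ ω j|) * (kz * kx) := by gcongr; exact hω.1
          _ = _ := by ring
      have h1 := (h.comp (g := fun z => u ⬝ᵥ z.1 * (curv φ βbar z * z.1 j))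
        (hum.mul ((hφ.measurable_curv βbar).mul
          ((measurable_pi_apply j).comp measurable_fst)))).bernstein_scaled (by positivity)
        hE hL0 hLn hn0 Finset.univ
      rwa [h0] at h1
    · rw [Fintype.card_fin]
      exact hpN.trans (le_self_pow₀ (by linarith) (by norm_num))
  have hb₄ : μ.real B₄ ≤ 1 / N := by
    refine le_trans ?_ (mul_exp_neg_five_log_le (m := 1) hN (one_le_pow₀ (by linarith)))
    rw [one_mul]
    exact (h.comp (g := fun z => score φ βbar z * score φ βbar z)
      ((hφ.measurable_score βbar).mul (hφ.measurable_score βbar))).bernstein_scaled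
      (by positivity) (subExpOne_of_subGauss_mul hψ hψ hψm hψm) hL0 hLn hn0 Finset.univ
  have hb₅ : μ.real B₅ ≤ 1 / n := by
    have h1 := (h.comp (g := fun z => u ⬝ᵥ z.1 * score φ βbar z)
      (hum.mul (hφ.measurable_score βbar))).measure_avg_sq_gt_le_scaled (κ := kz * kψ)
      (by positivity) (subExpOne_of_subGauss_mul hZ hψ hZm hψm) hn0
    rwa [← asympVar_eq] at h1
  have hb₆ : μ.real B₆ = 0 := by
    rw [measureReal_eq_zero_iff]
    have h1 : ∀ i, ∀ᵐ ω ∂μ, |curv φ βbar (ζ i ω)| ≤ C₆ ∧ (ζ i ω).2 ∈ lipSet φ C₇ := fun i =>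
      (h.ident i).symm.ae_snd
        (p := fun z : (Fin p → ℝ) × ℝ => |curv φ βbar z| ≤ C₆ ∧ z.2 ∈ lipSet φ C₇)
        ((measurableSet_le (hφ.measurable_curv βbar).abs measurable_const).inter
          (measurable_snd (hφ.measurableSet_lipSet C₇))) hreg₀
    exact ae_iff.1 (ae_all_iff.2 h1)
  have hsub : {ω | ¬ SampleGood φ βbar ξ u (asympVar μ φ X₀ Y₀ βbar ξ)
      kx kz kψ L C₆ C₇ (fun i => ζ i ω)} ⊆ B₁ ∪ B₂ ∪ B₃ ∪ B₄ ∪ B₅ ∪ B₆ := by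
    intro ω hω
    by_contra hcon
    simp only [hB₁, hB₂, hB₃, hB₄, hB₅, hB₆, Set.mem_union, Set.mem_ofPred_eq, not_or, not_exists,
      not_lt, not_not] at hω hcon
    obtain ⟨⟨⟨⟨⟨hc1, hc2⟩, hc3⟩, hc4⟩, hc5⟩, hc6⟩ := hcon
    -- only the bound on the average of the squared scores is not among the events: it follows from
    -- Bernstein's bound for their sum because `√(n L) ≤ n`
    refine hω ⟨hc1, fun i j => hc2 j i, hc3, ?_, hc5, fun i => (hc6 i).2, fun i => (hc6 i).1⟩
    have hm := (subExpOne_of_subGauss_mul hψ hψ hψm hψm).abs_integral_le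
      ((hψm.mul hψm).div_const _)
    rw [integral_div, abs_div, abs_of_pos (by positivity : 0 < kψ * kψ),
      div_le_one (by positivity)] at hm
    set m := ∫ ω', score φ βbar (X₀ ω', Y₀ ω') * score φ βbar (X₀ ω', Y₀ ω') ∂μ
    have hsq : Real.sqrt (n * L) ≤ n := by
      rw [Real.sqrt_le_left (by positivity), sq]
      gcongr
    rw [Finset.sum_sub_distrib, Finset.sum_const, Finset.card_univ, Fintype.card_fin,
      nsmul_eq_mul] at hc4
    have hle := (le_abs_self _).trans hc4
    have hm' := (le_abs_self m).trans hm
    rw [one_div, inv_mul_le_iff₀ hn0']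
    simp only [sq]
    have g1 : 34 * (kψ * kψ) * Real.sqrt (n * L) ≤ 34 * (kψ * kψ) * n := by gcongr
    have g2 : n * m ≤ n * (kψ * kψ) := by gcongr
    linarith
  have hU : μ.real (B₁ ∪ B₂ ∪ B₃ ∪ B₄ ∪ B₅ ∪ B₆) ≤
      μ.real B₁ + μ.real B₂ + μ.real B₃ + μ.real B₄ + μ.real B₅ + μ.real B₆ := by
    refine (measureReal_union_le _ _).trans (add_le_add ?_ le_rfl)
    refine (measureReal_union_le _ _).trans (add_le_add ?_ le_rfl)
    refine (measureReal_union_le _ _).trans (add_le_add ?_ le_rfl)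
    refine (measureReal_union_le _ _).trans (add_le_add ?_ le_rfl)
    exact measureReal_union_le _ _
  refine (measureReal_mono hsub).trans (hU.trans ?_)
  have e2 : 2 / (n : ℝ) = 1 / n + 1 / n := by ring
  have e3 : 3 / N = 1 / N + 1 / N + 1 / N := by ring
  rw [hb₆, e2, e3]
  linarith

end CommonEvents

/-! ### Rates -/

section Rates

/-- The constant in the bound for `Δ₁`; `kx`, `kz ‖ξ‖₂`, `kψ` are sub-gaussian norms of the
entries of `X₀`, of `ξᵀM*X₀` and of the score. -/
noncomputable def delta1Const (C₁ C₂ C₃ C₅ C₆ C₇ kx kz kψ : ℝ) : ℝ :=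
  (68 * (kx * kψ) * C₂ + 68 * (kz * kx * C₆) * C₁
    + C₆ * (C₂ * Real.sqrt C₁) * (Real.sqrt (2 / C₃) + 18 * kx)
    + C₇ * C₁ * (2 * kz + 2 * kx * C₂)) / Real.sqrt (C₅ * C₃)

/-- The Lipschitz constant of the score on the range of the linear predictors. -/
noncomputable def scoreLip (C₁ C₆ C₇ kx : ℝ) : ℝ := C₆ + C₇ * (2 * kx * C₁)

/-- The square of the constant in the bound for the root mean square of the changes of
`(ξᵀM X_i) φ₁` when the population quantities are replaced by their estimates. -/
noncomputable def changeConst (C₁ C₂ C₆ C₇ kx kz kψ : ℝ) : ℝ :=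
  12 * kz ^ 2 * C₁ * scoreLip C₁ C₆ C₇ kx ^ 2 + 432 * kx ^ 2 * C₂ ^ 2 * kψ ^ 2
    + 12 * kx ^ 2 * C₂ ^ 2 * scoreLip C₁ C₆ C₇ kx ^ 2 * C₁

/-- The constant in the bound for `Δ₂`. -/
noncomputable def delta2Const (C₁ C₂ C₃ C₅ C₆ C₇ kx kz kψ : ℝ) : ℝ :=
  (sqConst * (kz * kψ) ^ 2 + 2 * changeConst C₁ C₂ C₆ C₇ kx kz kψ
    + 2 * (Real.sqrt (4 + sqConst) * (kz * kψ) * Real.sqrt (changeConst C₁ C₂ C₆ C₇ kx kz kψ)))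
      / (C₅ * C₃)

variable {C₁ C₂ C₃ C₅ C₆ C₇ kx kz kψ : ℝ}

theorem delta1Const_nonneg (hC₁ : 0 < C₁) (hC₂ : 0 < C₂) (hC₆ : 0 < C₆)
    (hC₇ : 0 < C₇) (hkx : 0 < kx) (hkz : 0 < kz) (hkψ : 0 < kψ) :
    0 ≤ delta1Const C₁ C₂ C₃ C₅ C₆ C₇ kx kz kψ := by
  unfold delta1Const
  positivity

theorem changeConst_nonneg (hC₁ : 0 < C₁) : 0 ≤ changeConst C₁ C₂ C₆ C₇ kx kz kψ := by
  unfold changeConst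
  positivity

theorem delta2Const_nonneg (hC₁ : 0 < C₁) (hC₃ : 0 < C₃) (hC₅ : 0 < C₅)
    (hkz : 0 < kz) (hkψ : 0 < kψ) :
    0 ≤ delta2Const C₁ C₂ C₃ C₅ C₆ C₇ kx kz kψ := by
  have h1 := sqConst_pos
  have h2 := changeConst_nonneg (C₂ := C₂) (C₆ := C₆) (C₇ := C₇) (kx := kx) (kz := kz)
    (kψ := kψ) hC₁
  unfold delta2Const
  positivity

variable {n : ℕ} {L : ℝ}

theorem sqrt_div_sq_mul_sqrt (hn : 0 < n) (hL : 0 ≤ L) :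
    Real.sqrt n * Real.sqrt (L / n) ^ 2 = L / Real.sqrt n := by
  have hn' : (0 : ℝ) < n := by exact_mod_cast hn
  have hs : 0 < Real.sqrt n := Real.sqrt_pos.2 hn'
  rw [Real.sq_sqrt (by positivity), eq_div_iff hs.ne', mul_comm (Real.sqrt n), mul_assoc,
    Real.mul_self_sqrt hn'.le]
  field_simp

theorem sqrt_mul_sqrt_div (hL : 0 ≤ L) :
    Real.sqrt L * Real.sqrt (L / n) = L / Real.sqrt n := by
  rw [Real.sqrt_div hL, ← mul_div_assoc, Real.mul_self_sqrt hL]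

/-- The bound of `abs_debiased_error_le`, at the rates that hold on the good event, in terms of
`τ = L / √n`. The sum `S` is the numerator of `Δ₁`, and `q` stands for `‖ξ‖₂`. -/
theorem delta1_rate (hn : 0 < n) {V q s₀ G A₁ S : ℝ} (hq : 0 < q) (hs₀ : 1 ≤ s₀)
    (hG : 0 ≤ G) (hA₁ : 0 ≤ A₁) (hlog : 1 / 4 ≤ Real.log n) (hL : Real.log n ≤ L)
    (hs₀L : s₀ * (L / Real.sqrt n) ≤ 1)
    (hC₁ : 0 < C₁) (hC₂ : 0 < C₂) (hC₃ : 0 < C₃) (hC₅ : 0 < C₅) (hC₆ : 0 < C₆)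
    (hC₇ : 0 < C₇) (hkx : 0 < kx) (hkz : 0 < kz) (hkψ : 0 < kψ)
    (hV : C₅ * (C₃ * q ^ 2) ≤ V)
    (hS : |S| ≤ 68 * (kx * kψ) * (C₂ * G * Real.sqrt (L / n) * q) * Real.sqrt (L / n)
      + 34 * (kz * q * kx * C₆) * (C₁ * s₀ * Real.sqrt (L / n)) * Real.sqrt (L / n)
      + C₆ * ((q * Real.sqrt (L / n) * C₂ * (Real.sqrt (2 / C₃) * A₁
        + 9 * kx * G * Real.sqrt (Real.sqrt (L / n)))) *
          (Real.sqrt C₁ * Real.sqrt s₀ * Real.sqrt (L / n)))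
      + C₇ * (2 * Real.sqrt (Real.log n) * (kz * q) + 2 * kx * C₂ * G * (L / Real.sqrt n) * q) *
          (Real.sqrt C₁ * Real.sqrt s₀ * Real.sqrt (L / n)) ^ 2) :
    |Real.sqrt n * (S / Real.sqrt V)| ≤ delta1Const C₁ C₂ C₃ C₅ C₆ C₇ kx kz kψ *
      (G + A₁ * Real.sqrt s₀ + Real.sqrt (Real.log n) * s₀) * (L / Real.sqrt n) := by
  have hn' : (0 : ℝ) < n := by exact_mod_cast hn
  have hL4 : 1 / 4 ≤ L := hlog.trans hL
  have hL0 : 0 ≤ L := by linarith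
  set R := Real.sqrt n with hR
  have hR0 : 0 < R := Real.sqrt_pos.2 hn'
  set r := Real.sqrt (L / n) with hr
  have hr0 : 0 ≤ r := Real.sqrt_nonneg _
  set τ := L / R with hτ
  have hτ0 : 0 ≤ τ := by positivity
  have hRr : R * r ^ 2 = τ := sqrt_div_sq_mul_sqrt hn hL0
  have hl : 1 / 2 ≤ Real.sqrt (Real.log n) := by
    rw [show (1 : ℝ) / 2 = Real.sqrt (1 / 4) by
      rw [show (1 : ℝ) / 4 = (1 / 2) ^ 2 by norm_num, Real.sqrt_sq (by norm_num)]]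
    exact Real.sqrt_le_sqrt hlog
  set l := Real.sqrt (Real.log n) with hldef
  -- `s₀ √(L / n) ≤ 2` because `√L ≥ 1 / 2`.
  have hrr : Real.sqrt s₀ * Real.sqrt r ≤ 2 := by
    have h1 : Real.sqrt L * r = τ := sqrt_mul_sqrt_div hL0
    have h2 : 1 / 2 ≤ Real.sqrt L := hl.trans (Real.sqrt_le_sqrt hL)
    have h3 : s₀ * r ≤ 2 := by
      have h4 : s₀ * (Real.sqrt L * r) ≤ 1 := by rw [h1]; exact hs₀L
      have h5 : 0 ≤ s₀ * r := by positivity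
      nlinarith
    rw [← Real.sqrt_mul (by linarith)]
    rw [Real.sqrt_le_left (by norm_num)]
    linarith
  have hsV : Real.sqrt (C₅ * C₃) * q ≤ Real.sqrt V := by
    rw [show Real.sqrt (C₅ * C₃) * q = Real.sqrt (C₅ * (C₃ * q ^ 2)) by
      rw [← mul_assoc, Real.sqrt_mul (by positivity) (q ^ 2), Real.sqrt_sq hq.le]]
    exact Real.sqrt_le_sqrt hV
  have hsc : 0 < Real.sqrt (C₅ * C₃) := Real.sqrt_pos.2 (by positivity)
  have hsV0 : 0 < Real.sqrt V := lt_of_lt_of_le (by positivity) hsV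
  set T := G + A₁ * Real.sqrt s₀ + l * s₀ with hT
  set y := Real.sqrt s₀ with hy
  have hy2 : y ^ 2 = s₀ := Real.sq_sqrt (by linarith)
  have hy0 : 0 ≤ y := Real.sqrt_nonneg _
  set c := Real.sqrt C₁ with hc
  have hc2 : c ^ 2 = C₁ := Real.sq_sqrt hC₁.le
  have hc0 : 0 ≤ c := Real.sqrt_nonneg _
  set d := Real.sqrt (2 / C₃) with hd
  have hd0 : 0 ≤ d := Real.sqrt_nonneg _
  set w := Real.sqrt r with hw
  have hw0 : 0 ≤ w := Real.sqrt_nonneg _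
  have hT1 : G ≤ T := by rw [hT]; have : 0 ≤ A₁ * y := by positivity
                         have : 0 ≤ l * s₀ := by positivity
                         linarith
  have hT2 : A₁ * y ≤ T := by rw [hT]; have : 0 ≤ l * s₀ := by positivity
                              linarith
  have hT3 : l * s₀ ≤ T := by rw [hT]; have : 0 ≤ A₁ * y := by positivity
                              linarith
  have hT4 : s₀ ≤ 2 * T := by nlinarith
  have hT0 : 0 ≤ T := hG.trans hT1
  have hmain : R * |S| ≤ (68 * (kx * kψ) * C₂ + 68 * (kz * kx * C₆) * C₁
      + C₆ * (C₂ * c) * (d + 18 * kx) + C₇ * C₁ * (2 * kz + 2 * kx * C₂)) * (T * τ) * q := by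
    have e1 : R * |S| ≤ (68 * (kx * kψ) * C₂ * G + 34 * (kz * kx * C₆) * C₁ * s₀
        + C₆ * (C₂ * c) * (d * (A₁ * y) + 9 * kx * G * (y * w))
        + C₇ * C₁ * (2 * kz * (l * s₀) + 2 * kx * C₂ * (G * (s₀ * τ)))) * (R * r ^ 2) * q := by
      calc R * |S| ≤ _ := mul_le_mul_of_nonneg_left hS hR0.le
        _ = _ := by rw [← hc2, ← hy2]; ring
    refine e1.trans ?_
    rw [hRr, ← mul_assoc _ T τ]
    refine mul_le_mul_of_nonneg_right (mul_le_mul_of_nonneg_right ?_ hτ0) hq.le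
    have f1 : 68 * (kx * kψ) * C₂ * G ≤ 68 * (kx * kψ) * C₂ * T := by gcongr
    have f2 : 34 * (kz * kx * C₆) * C₁ * s₀ ≤ 34 * (kz * kx * C₆) * C₁ * (2 * T) := by gcongr
    have f3 : C₆ * (C₂ * c) * (d * (A₁ * y) + 9 * kx * G * (y * w)) ≤
        C₆ * (C₂ * c) * (d * T + 9 * kx * T * 2) := by gcongr
    have f4 : C₇ * C₁ * (2 * kz * (l * s₀) + 2 * kx * C₂ * (G * (s₀ * τ))) ≤
        C₇ * C₁ * (2 * kz * T + 2 * kx * C₂ * (T * 1)) := by gcongr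
    linarith
  rw [abs_mul, abs_div, abs_of_pos hR0, abs_of_pos hsV0, ← mul_div_assoc]
  calc R * |S| / Real.sqrt V ≤ R * |S| / (Real.sqrt (C₅ * C₃) * q) := by gcongr
    _ ≤ (68 * (kx * kψ) * C₂ + 68 * (kz * kx * C₆) * C₁
      + C₆ * (C₂ * c) * (d + 18 * kx) + C₇ * C₁ * (2 * kz + 2 * kx * C₂)) * (T * τ) * q /
        (Real.sqrt (C₅ * C₃) * q) := by gcongr
    _ = _ := by rw [mul_div_mul_right _ _ hq.ne', delta1Const, ← hc, ← hd]; ring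

/-- The bound of `abs_varEst_error_le`, at the rates that hold on the good event. Here `q` stands
for `‖ξ‖₂`, `η` for `n^(-1/3)` and `y` for `√s₀ τ + G τ`. -/
theorem delta2_rate {V Vhat q y η : ℝ} (hq : 0 < q) (hy : 0 ≤ y) (hy2 : y ≤ 2) (hη : 0 ≤ η)
    (hC₁ : 0 < C₁) (hC₃ : 0 < C₃) (hC₅ : 0 < C₅) (hkz : 0 < kz) (hkψ : 0 < kψ)
    (hV : C₅ * (C₃ * q ^ 2) ≤ V)
    (hS : |Vhat - V| ≤ sqConst * (kz * q * kψ) ^ 2 * η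
      + (q * Real.sqrt (changeConst C₁ C₂ C₆ C₇ kx kz kψ) * y) ^ 2
      + 2 * (Real.sqrt (4 + sqConst) * (kz * q * kψ) *
          (q * Real.sqrt (changeConst C₁ C₂ C₆ C₇ kx kz kψ) * y))) :
    |Vhat / V - 1| ≤ delta2Const C₁ C₂ C₃ C₅ C₆ C₇ kx kz kψ * (η + y) := by
  have hV0 : 0 < V := lt_of_lt_of_le (by positivity) hV
  have hW := changeConst_nonneg (C₂ := C₂) (C₆ := C₆) (C₇ := C₇) (kx := kx) (kz := kz)
    (kψ := kψ) hC₁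
  have hsq := sqConst_pos
  rw [delta2Const]
  set W := changeConst C₁ C₂ C₆ C₇ kx kz kψ with hWdef
  have hW2 : Real.sqrt W ^ 2 = W := Real.sq_sqrt hW
  set w := Real.sqrt W with hw
  have hw0 : 0 ≤ w := Real.sqrt_nonneg _
  set u := Real.sqrt (4 + sqConst) with hu
  have hu0 : 0 ≤ u := Real.sqrt_nonneg _
  have e : Vhat / V - 1 = (Vhat - V) / V := by field_simp
  rw [e, abs_div, abs_of_pos hV0]
  have hmain : |Vhat - V| ≤ (sqConst * (kz * kψ) ^ 2 + 2 * W + 2 * (u * (kz * kψ) * w)) *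
      (η + y) * q ^ 2 := by
    refine hS.trans ?_
    have e1 : sqConst * (kz * q * kψ) ^ 2 * η + (q * w * y) ^ 2 +
        2 * (u * (kz * q * kψ) * (q * w * y)) =
        (sqConst * (kz * kψ) ^ 2 * η + W * (y * y) + 2 * (u * (kz * kψ) * w) * y) * q ^ 2 := by
      rw [← hW2]; ring
    rw [e1]
    refine mul_le_mul_of_nonneg_right ?_ (sq_nonneg _)
    have f1 : W * (y * y) ≤ W * (2 * y) := by gcongr
    have f2 : 0 ≤ sqConst * (kz * kψ) ^ 2 * y := by positivity
    have f3 : 0 ≤ (2 * W + 2 * (u * (kz * kψ) * w)) * η := by positivity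
    linarith
  calc |Vhat - V| / V ≤ |Vhat - V| / (C₅ * (C₃ * q ^ 2)) := by gcongr
    _ ≤ (sqConst * (kz * kψ) ^ 2 + 2 * W + 2 * (u * (kz * kψ) * w)) *
      (η + y) * q ^ 2 / (C₅ * (C₃ * q ^ 2)) := by gcongr
    _ = _ := by field_simp

end Rates

/-! ### The estimators as sums over the sample -/

section Assembly

variable {Ω : Type*} {n p : ℕ} {φ : ℝ → ℝ → ℝ} {ξ : Fin p → ℝ} {X : Fin n → Ω → Fin p → ℝ}
  {Y : Fin n → Ω → ℝ} {J : Finset (Fin n)} {βhat : Ω → Fin p → ℝ}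
  {MJ MJc : Ω → Matrix (Fin p) (Fin p) ℝ}

theorem dotProduct_mulVec_avg {M : Matrix (Fin p) (Fin p) ℝ} (hM : M.IsSymm) (ξ : Fin p → ℝ)
    (s : Finset (Fin n)) (w : Fin n → ℝ) (x : Fin n → Fin p → ℝ) (c : ℝ) :
    ξ ⬝ᵥ (M *ᵥ (c • ∑ i ∈ s, w i • x i)) = c * ∑ i ∈ s, (M *ᵥ ξ) ⬝ᵥ x i * w i := by
  rw [dotProduct_mulVec_comm hM, dotProduct_smul, dotProduct_sum, smul_eq_mul]
  congr 1
  refine Finset.sum_congr rfl fun i _ => ?_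
  rw [dotProduct_smul, smul_eq_mul, mul_comm]

theorem debiased_eq (hMJ : ∀ ω, (MJ ω).IsSymm) (hMJc : ∀ ω, (MJc ω).IsSymm) (ω : Ω) :
    debiased φ ξ X Y J βhat MJ MJc ω = ξ ⬝ᵥ βhat ω - (1 / (n : ℝ)) *
      ∑ i, ((if i ∈ J then MJc ω else MJ ω) *ᵥ ξ) ⬝ᵥ X i ω *
        score φ (βhat ω) (X i ω, Y i ω) := by
  rw [debiased, dotProduct_mulVec_avg (hMJc ω), dotProduct_mulVec_avg (hMJ ω),
    ← Finset.sum_add_sum_compl J, mul_add, ← sub_sub]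
  refine congrArg₂ _ (congrArg₂ _ rfl (congrArg₂ _ rfl ?_)) (congrArg₂ _ rfl ?_)
  · exact Finset.sum_congr rfl fun i hi => by rw [if_pos hi, score]
  · exact Finset.sum_congr rfl fun i hi => by rw [if_neg (Finset.mem_compl.1 hi), score]

theorem varEst_eq (hMJ : ∀ ω, (MJ ω).IsSymm) (hMJc : ∀ ω, (MJc ω).IsSymm) (ω : Ω) :
    varEst φ ξ X Y J βhat MJ MJc ω = (1 / (n : ℝ)) *
      ∑ i, (((if i ∈ J then MJc ω else MJ ω) *ᵥ ξ) ⬝ᵥ X i ω *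
        score φ (βhat ω) (X i ω, Y i ω)) ^ 2 := by
  rw [varEst, ← Finset.sum_add_sum_compl J, mul_add]
  refine congrArg₂ _ (congrArg₂ _ rfl ?_) (congrArg₂ _ rfl ?_)
  · exact Finset.sum_congr rfl fun i hi => by
      rw [if_pos hi, score, mul_pow, dotProduct_mulVec_comm (hMJc ω)]
  · exact Finset.sum_congr rfl fun i hi => by
      rw [if_neg (Finset.mem_compl.1 hi), score, mul_pow, dotProduct_mulVec_comm (hMJ ω)]

end Assembly

/-! ### The error bounds on the good event -/

section GoodEvent

variable {Ω : Type*} [MeasurableSpace Ω] {μ : Measure Ω} {n p : ℕ}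
  {φ : ℝ → ℝ → ℝ} {X₀ : Ω → Fin p → ℝ} {Y₀ : Ω → ℝ} {βbar ξ : Fin p → ℝ}
  {X : Fin n → Ω → Fin p → ℝ} {Y : Fin n → Ω → ℝ} {J : Finset (Fin n)} {βhat : Ω → Fin p → ℝ}
  {MJ MJc : Ω → Matrix (Fin p) (Fin p) ℝ}
  {C₁ C₂ C₃ C₅ C₆ C₇ kx kz kψ L : ℝ}

theorem one_div_mul_sqrt_mul (hn : 0 < n) (L : ℝ) :
    1 / (n : ℝ) * Real.sqrt (n * L) = Real.sqrt (L / n) := by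
  have hn' : (0 : ℝ) < n := by exact_mod_cast hn
  rw [show L / (n : ℝ) = (1 / n) ^ 2 * (n * L) by field_simp,
    Real.sqrt_mul (by positivity : (0 : ℝ) ≤ (1 / n) ^ 2), Real.sqrt_sq (by positivity)]

theorem Delta1_eq (hMJ : ∀ ω, (MJ ω).IsSymm) (hMJc : ∀ ω, (MJc ω).IsSymm) (ω : Ω) :
    Delta1 μ φ X₀ Y₀ βbar ξ X Y J βhat MJ MJc ω = Real.sqrt n *
      ((ξ ⬝ᵥ (βhat ω - βbar)
        - (1 / (n : ℝ)) * ∑ i, ((if i ∈ J then MJc ω else MJ ω) *ᵥ ξ) ⬝ᵥ X i ω *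
            score φ (βhat ω) (X i ω, Y i ω)
        + (1 / (n : ℝ)) * ∑ i, (Mstar μ φ X₀ Y₀ βbar *ᵥ ξ) ⬝ᵥ X i ω *
            score φ βbar (X i ω, Y i ω)) / Real.sqrt (asympVar μ φ X₀ Y₀ βbar ξ)) := by
  have e0 : ∀ i, (ξ ⬝ᵥ (Mstar μ φ X₀ Y₀ βbar *ᵥ X i ω)) *
      dphi φ 1 (Y i ω) (X i ω ⬝ᵥ βbar) =
      (Mstar μ φ X₀ Y₀ βbar *ᵥ ξ) ⬝ᵥ X i ω * score φ βbar (X i ω, Y i ω) := fun i => by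
    rw [dotProduct_mulVec_comm (Mstar_isSymm μ φ X₀ Y₀ βbar), score]
  rw [Delta1, debiased_eq hMJ hMJc]
  simp only [e0]
  rw [← Finset.sum_div, dotProduct_sub]
  ring

/-- The mean square change of `(ξᵀM X_i) φ₁`, in units of `‖ξ‖₂²`, is of the order of
`s₀ τ² + G² τ²`. -/
theorem change_le (hn : 0 < n) (hlog : 1 / 4 ≤ Real.log n) (hL : Real.log n ≤ L)
    {s₀ G q : ℝ} (hs₀ : 1 ≤ s₀) (hs₀L : s₀ * (L / Real.sqrt n) ≤ 1) (hG : 0 ≤ G)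
    (hC₁ : 0 < C₁) :
    3 * ((2 * Real.sqrt (Real.log n) * (kz * q)) ^ 2 * scoreLip C₁ C₆ C₇ kx ^ 2 *
        (C₁ * s₀ * (L / n))
      + (2 * kx * C₂ * G * (L / Real.sqrt n) * q) ^ 2 * (6 * kψ) ^ 2
      + (2 * kx * C₂ * G * (L / Real.sqrt n) * q) ^ 2 * scoreLip C₁ C₆ C₇ kx ^ 2 *
        (C₁ * s₀ * (L / n))) ≤
    changeConst C₁ C₂ C₆ C₇ kx kz kψ *
      (Real.sqrt s₀ * (L / Real.sqrt n) + G * (L / Real.sqrt n)) ^ 2 * q ^ 2 := by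
  have hn' : (0 : ℝ) < n := by exact_mod_cast hn
  have hL0 : 0 < L := by linarith
  set τ := L / Real.sqrt n with hτ
  have hτ0 : 0 ≤ τ := by positivity
  set y := Real.sqrt s₀ * τ + G * τ with hy
  set c := scoreLip C₁ C₆ C₇ kx with hc
  have hlogn : Real.sqrt (Real.log n) ^ 2 = Real.log n := Real.sq_sqrt (by linarith)
  have hτ2 : L * (L / n) = τ ^ 2 := by
    rw [hτ, div_pow, Real.sq_sqrt hn'.le]; ring
  have hysq : s₀ * τ ^ 2 + (G * τ) ^ 2 ≤ y ^ 2 := by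
    have e2 : y ^ 2 = Real.sqrt s₀ ^ 2 * τ ^ 2 + (G * τ) ^ 2 +
      2 * (Real.sqrt s₀ * τ * (G * τ)) := by rw [hy]; ring
    rw [e2, Real.sq_sqrt (by linarith)]
    have : 0 ≤ Real.sqrt s₀ * τ * (G * τ) := by positivity
    linarith
  have hs1 : s₀ * τ ^ 2 ≤ y ^ 2 := by linarith [sq_nonneg (G * τ)]
  have hg1 : (G * τ) ^ 2 ≤ y ^ 2 := by
    have : 0 ≤ s₀ * τ ^ 2 := by positivity
    linarith
  have hLn1 : s₀ * (L / n) ≤ 1 := by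
    refine le_trans ?_ hs₀L
    rw [hτ]
    have hn1 : (1 : ℝ) ≤ n := by exact_mod_cast hn
    have hsn : Real.sqrt n ≤ n := by
      rw [Real.sqrt_le_left (by positivity)]; nlinarith
    gcongr
  have t1 : (2 * Real.sqrt (Real.log n) * (kz * q)) ^ 2 * c ^ 2 * (C₁ * s₀ * (L / n)) ≤
      4 * kz ^ 2 * C₁ * c ^ 2 * y ^ 2 * q ^ 2 := by
    rw [mul_pow, mul_pow, hlogn]
    calc 2 ^ 2 * Real.log n * (kz * q) ^ 2 * c ^ 2 * (C₁ * s₀ * (L / n))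
        ≤ 2 ^ 2 * L * (kz * q) ^ 2 * c ^ 2 * (C₁ * s₀ * (L / n)) := by gcongr
      _ = 4 * kz ^ 2 * C₁ * c ^ 2 * (s₀ * (L * (L / n))) * q ^ 2 := by ring
      _ ≤ _ := by rw [hτ2]; gcongr
  have t2 : (2 * kx * C₂ * G * τ * q) ^ 2 * (6 * kψ) ^ 2 ≤
      144 * kx ^ 2 * C₂ ^ 2 * kψ ^ 2 * y ^ 2 * q ^ 2 := by
    calc _ = 144 * kx ^ 2 * C₂ ^ 2 * kψ ^ 2 * (G * τ) ^ 2 * q ^ 2 := by ring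
      _ ≤ _ := by gcongr
  have t3 : (2 * kx * C₂ * G * τ * q) ^ 2 * c ^ 2 * (C₁ * s₀ * (L / n)) ≤
      4 * kx ^ 2 * C₂ ^ 2 * c ^ 2 * C₁ * y ^ 2 * q ^ 2 := by
    calc _ = 4 * kx ^ 2 * C₂ ^ 2 * c ^ 2 * C₁ * (G * τ) ^ 2 * (s₀ * (L / n)) * q ^ 2 := by ring
      _ ≤ 4 * kx ^ 2 * C₂ ^ 2 * c ^ 2 * C₁ * y ^ 2 * 1 * q ^ 2 := by gcongr
      _ = _ := by ring
  rw [changeConst, ← hc]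
  linarith

/-- Contribution of one half of the sample to the empirical second moment of the projections. -/
theorem CrossfitGood.sum_sq_le {Sig : Matrix (Fin p) (Fin p) ℝ}
    {z : Fin n → (Fin p → ℝ) × ℝ} {s : Finset (Fin n)} {a : Fin p → ℝ} {v A B : ℝ}
    (h : CrossfitGood φ βbar Sig kx kψ L z s a v) (hn : 0 < n)
    (hv : 0 ≤ v) (hvB : v ≤ B) (hA : a ⬝ᵥ (Sig *ᵥ a) ≤ A) (hA0 : 0 ≤ A) :
    (1 / (n : ℝ)) * ∑ i ∈ s, (a ⬝ᵥ (z i).1) ^ 2 ≤ A + 34 * kx ^ 2 * B ^ 2 * Real.sqrt (L / n) := by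
  have hn' : (0 : ℝ) < n := by exact_mod_cast hn
  have h1 := (le_abs_self _).trans h.quad_le
  rw [Finset.sum_sub_distrib, Finset.sum_const, nsmul_eq_mul] at h1
  have hcard : (s.card : ℝ) ≤ n := by exact_mod_cast (Finset.card_le_univ s).trans (by simp)
  have h2 : s.card * (a ⬝ᵥ (Sig *ᵥ a)) ≤ n * A :=
    calc _ ≤ s.card * A := by gcongr
      _ ≤ n * A := by gcongr
  have h3 : 34 * kx ^ 2 * v ^ 2 * Real.sqrt (n * L) ≤ 34 * kx ^ 2 * B ^ 2 * Real.sqrt (n * L) := by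
    gcongr
  rw [← one_div_mul_sqrt_mul hn]
  calc (1 / (n : ℝ)) * ∑ i ∈ s, (a ⬝ᵥ (z i).1) ^ 2
      ≤ (1 / (n : ℝ)) * (n * A + 34 * kx ^ 2 * B ^ 2 * Real.sqrt (n * L)) := by
        gcongr; linarith
    _ = _ := by field_simp

set_option maxHeartbeats 1000000 in
/-- The deterministic part of the theorem: both error bounds hold at every sample point where the
sample is well behaved and the estimators satisfy their rates. The number `G` stands for
`A₂ ‖ξ‖₁ / ‖ξ‖₂` or for `A₁`. -/
theorem abs_Delta_le_of_good (hφ : IsLoss φ) (hn : 0 < n) (hlog : 1 / 4 ≤ Real.log n)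
    (hL : Real.log n ≤ L) {s₀ G A₁ vJ vJc : ℝ} (hs₀ : 1 ≤ s₀)
    (hs₀L : s₀ * (L / Real.sqrt n) ≤ 1) (hGL : G * (L / Real.sqrt n) ≤ 1)
    (hC₁ : 0 < C₁) (hC₂ : 0 < C₂) (hC₃ : 0 < C₃) (hC₅ : 0 < C₅) (hC₆ : 0 < C₆)
    (hC₇ : 0 < C₇) (hkx : 0 < kx) (hkz : 0 < kz) (hkψ : 0 < kψ) (hξ : ξ ≠ 0)
    (hMJ : ∀ ω, (MJ ω).IsSymm) (hMJc : ∀ ω, (MJc ω).IsSymm)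
    (hV : C₅ * (C₃ * l2Norm ξ ^ 2) ≤ asympVar μ φ X₀ Y₀ βbar ξ)
    (hV' : asympVar μ φ X₀ Y₀ βbar ξ ≤ 4 * (kz * l2Norm ξ * kψ) ^ 2)
    (hSig : ∀ a, a ⬝ᵥ (secondMoment μ X₀ *ᵥ a) ≤ (a ⬝ᵥ a) / C₃) {ω : Ω}
    (hS : SampleGood φ βbar ξ (Mstar μ φ X₀ Y₀ βbar *ᵥ ξ) (asympVar μ φ X₀ Y₀ βbar ξ)
      kx (kz * l2Norm ξ) kψ L C₆ C₇ (fun i => (X i ω, Y i ω)))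
    (hJ : CrossfitGood φ βbar (secondMoment μ X₀) kx kψ L (fun i => (X i ω, Y i ω)) J
      ((MJc ω - Mstar μ φ X₀ Y₀ βbar) *ᵥ ξ) vJc)
    (hJc : CrossfitGood φ βbar (secondMoment μ X₀) kx kψ L (fun i => (X i ω, Y i ω)) Jᶜ
      ((MJ ω - Mstar μ φ X₀ Y₀ βbar) *ᵥ ξ) vJ)
    (hvJ0 : 0 ≤ vJ) (hvJc0 : 0 ≤ vJc)
    (hvJ : vJ ≤ C₂ * G * Real.sqrt (L / n) * l2Norm ξ)
    (hvJc : vJc ≤ C₂ * G * Real.sqrt (L / n) * l2Norm ξ)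
    (hAJ : l2Norm ((MJ ω - Mstar μ φ X₀ Y₀ βbar) *ᵥ ξ) ≤
      C₂ * A₁ * Real.sqrt (L / n) * l2Norm ξ)
    (hAJc : l2Norm ((MJc ω - Mstar μ φ X₀ Y₀ βbar) *ᵥ ξ) ≤
      C₂ * A₁ * Real.sqrt (L / n) * l2Norm ξ)
    (hβ1 : l1Norm (βhat ω - βbar) ≤ C₁ * s₀ * Real.sqrt (L / n))
    (hβ2 : (1 / (n : ℝ)) * ∑ i, (X i ω ⬝ᵥ βhat ω - X i ω ⬝ᵥ βbar) ^ 2 ≤ C₁ * s₀ * (L / n)) :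
    |Delta1 μ φ X₀ Y₀ βbar ξ X Y J βhat MJ MJc ω| ≤ delta1Const C₁ C₂ C₃ C₅ C₆ C₇ kx kz kψ *
      (G + A₁ * Real.sqrt s₀ + Real.sqrt (Real.log n) * s₀) * (L / Real.sqrt n) ∧
    |Delta2 μ φ X₀ Y₀ βbar ξ X Y J βhat MJ MJc ω| ≤ delta2Const C₁ C₂ C₃ C₅ C₆ C₇ kx kz kψ *
      ((n : ℝ) ^ (-(1 / 3) : ℝ) + (Real.sqrt s₀ * (L / Real.sqrt n) + G * (L / Real.sqrt n))) := by
  have hn' : (0 : ℝ) < n := by exact_mod_cast hn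
  have hL4 : 1 / 4 ≤ L := hlog.trans hL
  have hL0 : 0 < L := by linarith
  have hq := l2Norm_pos hξ
  set q := l2Norm ξ with hqdef
  set r := Real.sqrt (L / n) with hr
  have hr0 : 0 < r := Real.sqrt_pos.2 (by positivity)
  have hG0 : 0 ≤ G := by
    by_contra hneg
    have : C₂ * G * r * q < 0 :=
      mul_neg_of_neg_of_pos (mul_neg_of_neg_of_pos (mul_neg_of_pos_of_neg hC₂ (not_le.1 hneg))
        hr0) hq
    linarith
  have hA0 : 0 ≤ A₁ := by
    by_contra hneg
    have : C₂ * A₁ * r * q < 0 :=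
      mul_neg_of_neg_of_pos (mul_neg_of_neg_of_pos (mul_neg_of_pos_of_neg hC₂ (not_le.1 hneg))
        hr0) hq
    linarith [l2Norm_nonneg ((MJ ω - Mstar μ φ X₀ Y₀ βbar) *ᵥ ξ)]
  set M := Mstar μ φ X₀ Y₀ βbar with hM
  set u := M *ᵥ ξ with hu
  set V := asympVar μ φ X₀ Y₀ βbar ξ with hVdef
  set τ := L / Real.sqrt n with hτ
  have hτ0 : 0 ≤ τ := by positivity
  have hLr : Real.sqrt L * r = τ := sqrt_mul_sqrt_div hL0.le
  have hr2 : r ^ 2 = L / n := Real.sq_sqrt (by positivity)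
  set e : Fin n → ℝ := fun i =>
    (((if i ∈ J then MJc ω else MJ ω) - M) *ᵥ ξ) ⬝ᵥ X i ω with he
  set Z : Fin n → ℝ := fun i => u ⬝ᵥ X i ω with hZ
  set ψ : Fin n → ℝ := fun i => score φ βbar (X i ω, Y i ω) with hψ
  set ψ' : Fin n → ℝ := fun i => score φ (βhat ω) (X i ω, Y i ω) with hψ'
  set f : Fin n → ℝ := fun i => curv φ βbar (X i ω, Y i ω) with hf
  set x : Fin n → ℝ := fun i => X i ω ⬝ᵥ βhat ω - X i ω ⬝ᵥ βbar with hx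
  have heJ : ∀ i ∈ J, e i = ((MJc ω - M) *ᵥ ξ) ⬝ᵥ X i ω := fun i hi => by
    simp only [he, if_pos hi]
  have heJc : ∀ i ∈ Jᶜ, e i = ((MJ ω - M) *ᵥ ξ) ⬝ᵥ X i ω := fun i hi => by
    simp only [he, if_neg (Finset.mem_compl.1 hi)]
  have hZe : ∀ i, ((if i ∈ J then MJc ω else MJ ω) *ᵥ ξ) ⬝ᵥ X i ω = Z i + e i := fun i => by
    simp only [hZ, he, hu]
    rw [← add_dotProduct, ← Matrix.add_mulVec, add_sub_cancel]
  set b₄ := Real.sqrt C₁ * Real.sqrt s₀ * r with hb₄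
  have hb₄0 : 0 ≤ b₄ := by positivity
  have hb₄2 : b₄ ^ 2 = C₁ * s₀ * (L / n) := by
    rw [hb₄, mul_pow, mul_pow, Real.sq_sqrt hC₁.le, Real.sq_sqrt (by linarith), hr2]
  have h4 : (1 / (n : ℝ)) * ∑ i, x i ^ 2 ≤ b₄ ^ 2 := by rw [hb₄2]; exact hβ2
  set E := C₂ * G * r * q with hE
  have hE0 : 0 ≤ E := by positivity
  -- averages of `e ψ`, one half of the sample at a time
  have h1 : |(1 / (n : ℝ)) * ∑ i, e i * ψ i| ≤ 68 * (kx * kψ) * E * r := by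
    rw [← Finset.sum_add_sum_compl J, abs_mul, abs_of_pos (by positivity : 0 < 1 / (n : ℝ))]
    have g1 : |∑ i ∈ J, e i * ψ i| ≤ 34 * (kx * kψ) * E * Real.sqrt (n * L) := by
      rw [Finset.sum_congr rfl fun i hi => by rw [heJ i hi]]
      exact hJ.score_le.trans (by gcongr)
    have g2 : |∑ i ∈ Jᶜ, e i * ψ i| ≤ 34 * (kx * kψ) * E * Real.sqrt (n * L) := by
      rw [Finset.sum_congr rfl fun i hi => by rw [heJc i hi]]
      exact hJc.score_le.trans (by gcongr)
    rw [hr, ← one_div_mul_sqrt_mul hn]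
    calc _ ≤ 1 / (n : ℝ) * (34 * (kx * kψ) * E * Real.sqrt (n * L) +
          34 * (kx * kψ) * E * Real.sqrt (n * L)) := by
          gcongr
          exact (abs_add_le _ _).trans (add_le_add g1 g2)
      _ = _ := by ring
  -- the linear term, by Hölder's inequality
  have h2 : |ξ ⬝ᵥ (βhat ω - βbar) - (1 / (n : ℝ)) * ∑ i, Z i * f i * x i| ≤
      34 * (kz * q * kx * C₆) * (C₁ * s₀ * r) * r := by
    have e1 : ξ ⬝ᵥ (βhat ω - βbar) - (1 / (n : ℝ)) * ∑ i, Z i * f i * x i =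
        (βhat ω - βbar) ⬝ᵥ fun j => -(1 / (n : ℝ) * ∑ i, (Z i * (f i * X i ω j) - ξ j)) := by
      have e2 : ∀ i, Z i * f i * x i = ∑ j, (βhat ω - βbar) j * (Z i * (f i * X i ω j)) := by
        intro i
        simp only [hx]
        rw [← dotProduct_sub, dotProduct, Finset.mul_sum]
        exact Finset.sum_congr rfl fun j _ => by ring
      simp only [e2]
      rw [Finset.sum_comm, dotProduct, dotProduct, Finset.mul_sum, ← Finset.sum_sub_distrib]
      refine Finset.sum_congr rfl fun j _ => ?_
      rw [Finset.sum_sub_distrib, ← Finset.mul_sum, Finset.sum_const, Finset.card_univ,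
        Fintype.card_fin, nsmul_eq_mul]
      field_simp
      ring
    rw [e1]
    refine (abs_dotProduct_le _ _ (B := 34 * (kz * q * kx * C₆) * r) fun j => ?_).trans ?_
    · rw [abs_neg, abs_mul, abs_of_pos (by positivity : 0 < 1 / (n : ℝ)), hr,
        ← one_div_mul_sqrt_mul hn]
      calc _ ≤ 1 / (n : ℝ) * (34 * (kz * q * kx * C₆) * Real.sqrt (n * L)) := by
            gcongr
            exact hS.curv_le j
        _ = _ := by ring
    · calc _ ≤ C₁ * s₀ * r * (34 * (kz * q * kx * C₆) * r) := by gcongr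
        _ = _ := by ring
  -- the empirical second moment of `e`: the population value at the Euclidean rate `A₁`, plus the
  -- deviation from it at the rate `G`
  set b₃ := q * r * C₂ * (Real.sqrt (2 / C₃) * A₁ + 9 * kx * G * Real.sqrt r) with hb₃
  have hb₃0 : 0 ≤ b₃ := by positivity
  have h3 : (1 / (n : ℝ)) * ∑ i, e i ^ 2 ≤ b₃ ^ 2 := by
    have hA : ∀ a : Fin p → ℝ, l2Norm a ≤ C₂ * A₁ * r * q →
        a ⬝ᵥ (secondMoment μ X₀ *ᵥ a) ≤ (C₂ * A₁ * r * q) ^ 2 / C₃ := by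
      intro a ha
      refine (hSig a).trans ?_
      rw [← l2Norm_sq]
      have := l2Norm_nonneg a
      gcongr
    have g1 := hJ.sum_sq_le hn hvJc0 hvJc (hA _ hAJc) (by positivity)
    have g2 := hJc.sum_sq_le hn hvJ0 hvJ (hA _ hAJ) (by positivity)
    have e1 : (1 / (n : ℝ)) * ∑ i, e i ^ 2 =
        (1 / (n : ℝ)) * ∑ i ∈ J, (((MJc ω - M) *ᵥ ξ) ⬝ᵥ X i ω) ^ 2 +
        (1 / (n : ℝ)) * ∑ i ∈ Jᶜ, (((MJ ω - M) *ᵥ ξ) ⬝ᵥ X i ω) ^ 2 := by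
      rw [← Finset.sum_add_sum_compl J, mul_add,
        Finset.sum_congr rfl fun i hi => by rw [heJ i hi],
        Finset.sum_congr (s₁ := Jᶜ) rfl fun i hi => by rw [heJc i hi]]
    rw [e1]
    refine (add_le_add g1 g2).trans ?_
    have hw2 : Real.sqrt r ^ 2 = r := Real.sq_sqrt hr0.le
    have hd2 : Real.sqrt (2 / C₃) ^ 2 = 2 / C₃ := Real.sq_sqrt (by positivity)
    have hcross : 0 ≤ Real.sqrt (2 / C₃) * A₁ * (9 * kx * G * Real.sqrt r) := by positivity
    have e3 : b₃ ^ 2 = (q * r * C₂) ^ 2 * (Real.sqrt (2 / C₃) ^ 2 * A₁ ^ 2 +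
        2 * (Real.sqrt (2 / C₃) * A₁ * (9 * kx * G * Real.sqrt r)) +
        81 * kx ^ 2 * G ^ 2 * Real.sqrt r ^ 2) := by rw [hb₃]; ring
    rw [e3, hw2, hd2, ← hr]
    have e4 : (C₂ * A₁ * r * q) ^ 2 / C₃ + 34 * kx ^ 2 * E ^ 2 * r +
        ((C₂ * A₁ * r * q) ^ 2 / C₃ + 34 * kx ^ 2 * E ^ 2 * r) =
        (q * r * C₂) ^ 2 * (2 / C₃ * A₁ ^ 2 + 68 * kx ^ 2 * G ^ 2 * r) := by rw [hE]; ring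
    rw [e4]
    refine mul_le_mul_of_nonneg_left ?_ (sq_nonneg _)
    have : 0 ≤ kx ^ 2 * G ^ 2 * r := by positivity
    linarith
  -- uniform bounds
  set b₅ := 2 * Real.sqrt (Real.log n) * (kz * q) with hb₅
  have hb₅0 : 0 ≤ b₅ := by positivity
  have h5 : ∀ i, |Z i| ≤ b₅ := hS.proj_le
  set b₆ := 2 * kx * C₂ * G * τ * q with hb₆
  have hb₆0 : 0 ≤ b₆ := by positivity
  have hb₆E : 2 * Real.sqrt L * kx * E = b₆ := by rw [hb₆, ← hLr, hE]; ring
  have h6 : ∀ i, |e i| ≤ b₆ := by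
    intro i
    rw [← hb₆E]
    by_cases hi : i ∈ J
    · rw [heJ i hi]
      exact (hJ.max_le i hi).trans (by gcongr)
    · rw [heJc i (Finset.mem_compl.2 hi)]
      exact (hJc.max_le i (Finset.mem_compl.2 hi)).trans (by gcongr)
  have hfC : ∀ i, |f i| ≤ C₆ := hS.abs_curv_le
  have hR : ∀ i, |ψ' i - ψ i - f i * x i| ≤ C₇ * x i ^ 2 := fun i =>
    hφ.abs_taylor_le hC₇.le (hS.mem_lipSet i) (X i ω ⬝ᵥ βbar) (X i ω ⬝ᵥ βhat ω)
  -- the errors of the linear predictors are bounded, so that the score is Lipschitz where needed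
  have hxle : ∀ i, |x i| ≤ 2 * kx * C₁ := by
    intro i
    have e1 : x i = (βhat ω - βbar) ⬝ᵥ X i ω := by
      simp only [hx]; rw [← dotProduct_sub, dotProduct_comm]
    rw [e1]
    calc _ ≤ l1Norm (βhat ω - βbar) * (2 * Real.sqrt L * kx) :=
          abs_dotProduct_le _ _ (hS.entry_le i)
      _ ≤ C₁ * s₀ * r * (2 * Real.sqrt L * kx) := by gcongr
      _ = 2 * kx * C₁ * (s₀ * τ) := by rw [← hLr]; ring
      _ ≤ 2 * kx * C₁ * 1 := by gcongr
      _ = _ := by ring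
  set c := scoreLip C₁ C₆ C₇ kx with hc
  have hc0 : 0 ≤ c := by rw [hc, scoreLip]; positivity
  have hlip : ∀ i, |ψ' i - ψ i| ≤ c * |x i| := by
    intro i
    have g1 : |ψ' i - ψ i| ≤ |ψ' i - ψ i - f i * x i| + |f i * x i| := by
      have := abs_add_le (ψ' i - ψ i - f i * x i) (f i * x i)
      rwa [sub_add_cancel] at this
    have g2 : |f i * x i| ≤ C₆ * |x i| := by rw [abs_mul]; gcongr; exact hfC i
    have g3 : C₇ * x i ^ 2 ≤ C₇ * (2 * kx * C₁) * |x i| := by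
      rw [← sq_abs, sq, mul_assoc]
      gcongr
      exact hxle i
    rw [hc, scoreLip]
    linarith [hR i]
  have hVle : C₅ * (C₃ * q ^ 2) ≤ V := hV
  constructor
  · have hSb := abs_debiased_error_le hb₃0 hb₄0 hC₆.le hC₇.le hb₅0 hb₆0 h1 h2 h3 h4 h5 h6 hfC hR
    have hrate := delta1_rate (C₂ := C₂) (kψ := kψ) hn hq hs₀ hG0 hA0 hlog hL hs₀L hC₁ hC₂ hC₃ hC₅
      hC₆ hC₇ hkx hkz hkψ hVle hSb
    refine le_trans (le_of_eq ?_) hrate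
    congr 1
    rw [Delta1_eq hMJ hMJc, Finset.sum_congr rfl fun i _ => by rw [hZe i]]
  · set y := Real.sqrt s₀ * τ + G * τ with hy
    have hy0 : 0 ≤ y := by positivity
    have hss : Real.sqrt s₀ ≤ s₀ := by
      rw [Real.sqrt_le_left (by linarith)]
      exact le_self_pow₀ hs₀ two_ne_zero
    have hy2 : y ≤ 2 := by
      have : Real.sqrt s₀ * τ ≤ s₀ * τ := by gcongr
      linarith
    -- `w` bounds the root mean square of the change of `Z ψ`, and `U` that of `Z ψ` itself
    set W := changeConst C₁ C₂ C₆ C₇ kx kz kψ with hW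
    have hW0 : 0 ≤ W := changeConst_nonneg hC₁
    set η := (n : ℝ) ^ (-(1 / 3) : ℝ) with hη
    have hη0 : 0 ≤ η := Real.rpow_nonneg hn'.le _
    have hη1 : η ≤ 1 := Real.rpow_le_one_of_one_le_of_nonpos (by exact_mod_cast hn) (by norm_num)
    have hsq := sqConst_pos
    set w := q * Real.sqrt W * y with hw
    have hw0 : 0 ≤ w := by positivity
    set U := Real.sqrt (4 + sqConst) * (kz * q * kψ) with hU
    have hU0 : 0 ≤ U := by positivity
    have hU2 : V + sqConst * (kz * q * kψ) ^ 2 * η ≤ U ^ 2 := by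
      have e1 : U ^ 2 = (4 + sqConst) * (kz * q * kψ) ^ 2 := by
        rw [hU, mul_pow (Real.sqrt (4 + sqConst)), Real.sq_sqrt (by positivity)]
      rw [e1]
      have : sqConst * (kz * q * kψ) ^ 2 * η ≤ sqConst * (kz * q * kψ) ^ 2 * 1 := by gcongr
      linarith
    have h7 : (1 / (n : ℝ)) * ∑ i, ψ i ^ 2 ≤ (6 * kψ) ^ 2 :=
      hS.score_sq_le.trans (by rw [mul_pow]; linarith [sq_nonneg kψ])
    have hw2 : 3 * (b₅ ^ 2 * c ^ 2 * b₄ ^ 2 + b₆ ^ 2 * (6 * kψ) ^ 2 + b₆ ^ 2 * c ^ 2 * b₄ ^ 2) ≤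
        w ^ 2 := by
      have e1 : w ^ 2 = W * y ^ 2 * q ^ 2 := by
        rw [hw, mul_pow, mul_pow, Real.sq_sqrt hW0]; ring
      rw [e1, hb₄2]
      exact change_le hn hlog hL hs₀ hs₀L hG0 hC₁
    have h0 : |(1 / (n : ℝ)) * ∑ i, (Z i * ψ i) ^ 2 - V| ≤ sqConst * (kz * q * kψ) ^ 2 * η :=
      hS.var_le
    have hSb := abs_varEst_error_le hw0 hU0 h0 h4 h5 h6 h7 hlip hw2 hU2
    have hrate := delta2_rate (C₂ := C₂) (C₆ := C₆) (C₇ := C₇) (kx := kx) hq hy0 hy2 hη0 hC₁ hC₃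
      hC₅ hkz hkψ hVle hSb
    refine le_trans (le_of_eq ?_) hrate
    rw [Delta2, varEst_eq hMJ hMJc, Finset.sum_congr rfl fun i _ => by rw [hZe i]]

end GoodEvent

/-! ### Probability of the good event -/

section Probability

variable {Ω : Type*} [MeasurableSpace Ω] {μ : Measure Ω} {n p : ℕ}
  {φ : ℝ → ℝ → ℝ} {X₀ : Ω → Fin p → ℝ} {Y₀ : Ω → ℝ} {βbar ξ : Fin p → ℝ}
  {X : Fin n → Ω → Fin p → ℝ} {Y : Fin n → Ω → ℝ} {J : Finset (Fin n)} {βhat : Ω → Fin p → ℝ}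
  {MJ MJc : Ω → Matrix (Fin p) (Fin p) ℝ}
  {A₁ A₂ C₁ C₂ C₃ C₅ C₆ C₇ kx kz kψ δ₁ δ₂ δ₃ : ℝ}

theorem sub_add_le_measureReal_inter [IsProbabilityMeasure μ] {A B : Set Ω}
    (hB : MeasurableSet B) : μ.real A + μ.real B - 1 ≤ μ.real (A ∩ B) := by
  have h1 := measureReal_union_add_inter (μ := μ) (s := A) hB
  have h2 : μ.real (A ∪ B) ≤ 1 := measureReal_le_one
  linarith

theorem one_le_l0Norm (h : βbar ≠ 0) : (1 : ℝ) ≤ l0Norm βbar := by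
  obtain ⟨j, hj⟩ := Function.ne_iff.1 h
  have : 0 < l0Norm βbar := Finset.card_pos.2 ⟨j, by simpa using hj⟩
  exact_mod_cast this

theorem mulVec_Mstar_ne_zero (hC₃ : 0 < C₃) (h : EigenvaluesGE (Mstar μ φ X₀ Y₀ βbar) C₃)
    (hξ : ξ ≠ 0) : Mstar μ φ X₀ Y₀ βbar *ᵥ ξ ≠ 0 := fun h0 => hξ (by
  rw [← hessian_mulVec_Mstar hC₃ h ξ, h0, Matrix.mulVec_zero])

theorem IsIIDSample.isIIDCopies (h : IsIIDSample μ X₀ Y₀ X Y) :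
    IsIIDCopies μ (fun i ω => (X i ω, Y i ω)) (fun ω => (X₀ ω, Y₀ ω)) :=
  ⟨fun i => (h.measurable_X i).prodMk (h.measurable_Y i),
    h.measurable_X₀.prodMk h.measurable_Y₀, h.indep, h.identDistrib⟩

theorem measurable_mulVec_sub {Ω' : Type*} {m : MeasurableSpace Ω'}
    {M : Ω' → Matrix (Fin p) (Fin p) ℝ}
    (hM : ∀ j k, Measurable fun ω => M ω j k) (Mst : Matrix (Fin p) (Fin p) ℝ) (ξ : Fin p → ℝ) :
    Measurable fun ω => (M ω - Mst) *ᵥ ξ := by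
  refine measurable_pi_lambda _ fun j => ?_
  simp only [Matrix.mulVec, dotProduct, Matrix.sub_apply]
  exact Finset.measurable_sum _ fun k _ => ((hM j k).sub_const _).mul_const _

theorem BasedOn.measurable (h : IsIIDSample μ X₀ Y₀ X Y) {s : Finset (Fin n)}
    {M : Ω → Matrix (Fin p) (Fin p) ℝ} (hM : BasedOn X Y s M) (j k : Fin p) :
    Measurable fun ω => M ω j k :=
  (hM j k).mono (iSup₂_le fun i _ => (h.isIIDCopies.measurable i).comap_le) le_rfl

/-- The rates of an estimator `M` of `M*` enter the proof only through `(M - M*) ξ`. -/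
theorem MhatRate.mulVec_le [IsProbabilityMeasure μ] {Mst : Matrix (Fin p) (Fin p) ℝ}
    {M : Ω → Matrix (Fin p) (Fin p) ℝ} {δ : ℝ} (h : MhatRate μ n Mst ξ M C₂ A₁ A₂ δ) :
    1 - δ ≤ μ.real {ω |
      l2Norm ((M ω - Mst) *ᵥ ξ) ≤ C₂ * A₁ * Real.sqrt (logDim n p / n) * l2Norm ξ ∧
      l1Norm ((M ω - Mst) *ᵥ ξ) ≤ C₂ * A₂ * Real.sqrt (logDim n p / n) * l1Norm ξ} := by
  refine le_trans h (measureReal_mono fun ω hω => ⟨?_, ?_⟩)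
  · exact (l2Norm_mulVec_le_of_matNorm2 ξ _).trans
      (mul_le_mul_of_nonneg_right hω.1 (l2Norm_nonneg ξ))
  · exact (l1Norm_mulVec_le_of_matNorm1 ξ _).trans
      (mul_le_mul_of_nonneg_right hω.2 (l1Norm_nonneg ξ))

/-- The common core of both regimes. The function `ν` measures the errors `(M̂ - M*) ξ`: it is the
`ℓ¹` norm in the first regime and the Euclidean norm in the second one. -/
theorem le_measureReal_abs_Delta_le [IsProbabilityMeasure μ] (hφ : IsLoss φ)
    (h : IsIIDSample μ X₀ Y₀ X Y) (hβbar : βbar ≠ 0) (hξ : ξ ≠ 0) (hn : 2 ≤ n)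
    (hMJm : ∀ j k, Measurable fun ω => MJ ω j k)
    (hMJcm : ∀ j k, Measurable fun ω => MJc ω j k)
    (hMJ : ∀ ω, (MJ ω).IsSymm) (hMJc : ∀ ω, (MJc ω).IsSymm)
    (hC₁ : 0 < C₁) (hC₂ : 0 < C₂) (hC₃ : 0 < C₃) (hC₅ : 0 < C₅) (hC₆ : 0 < C₆)
    (hC₇ : 0 < C₇) (hkx : 0 < kx) (hkz : 0 < kz) (hkψ : 0 < kψ)
    (hβ : BetaHatRate μ X βbar βhat C₁ δ₁)
    (hRJ : MhatRate μ n (Mstar μ φ X₀ Y₀ βbar) ξ MJ C₂ A₁ A₂ δ₂)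
    (hRJc : MhatRate μ n (Mstar μ φ X₀ Y₀ βbar) ξ MJc C₂ A₁ A₂ δ₃)
    {C₄ : ℝ} (hE : EigenvalueBounds (secondMoment μ X₀) (Mstar μ φ X₀ Y₀ βbar) C₃ C₄)
    (hcond : ∀ᵐ ω ∂μ, C₅ ≤ (μ[fun ω' => dphi φ 1 (Y₀ ω') (X₀ ω' ⬝ᵥ βbar) ^ 2 |
      MeasurableSpace.comap X₀ inferInstance]) ω)
    (hD : DerivativeBounds μ φ X₀ Y₀ βbar C₆ C₇)
    (hX : ∀ j, SubGauss μ (fun ω => X₀ ω j) kx)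
    (hZ : SubGauss μ (fun ω => (Mstar μ φ X₀ Y₀ βbar *ᵥ ξ) ⬝ᵥ X₀ ω) (kz * l2Norm ξ))
    (hψ : SubGauss μ (fun ω => score φ βbar (X₀ ω, Y₀ ω)) kψ)
    {ν : (Fin p → ℝ) → ℝ} (hν : ∀ a, 0 ≤ ν a) {G : ℝ}
    (hνG : ∀ a, l2Norm a ≤ C₂ * A₁ * Real.sqrt (logDim n p / n) * l2Norm ξ →
      l1Norm a ≤ C₂ * A₂ * Real.sqrt (logDim n p / n) * l1Norm ξ →
      ν a ≤ C₂ * G * Real.sqrt (logDim n p / n) * l2Norm ξ)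
    (hJ : μ.real {ω | ¬ CrossfitGood φ βbar (secondMoment μ X₀) kx kψ (logDim n p)
      (fun i => (X i ω, Y i ω)) J ((MJc ω - Mstar μ φ X₀ Y₀ βbar) *ᵥ ξ)
        (ν ((MJc ω - Mstar μ φ X₀ Y₀ βbar) *ᵥ ξ))} ≤ 3 / (max p n : ℕ))
    (hJc : μ.real {ω | ¬ CrossfitGood φ βbar (secondMoment μ X₀) kx kψ (logDim n p)
      (fun i => (X i ω, Y i ω)) Jᶜ ((MJ ω - Mstar μ φ X₀ Y₀ βbar) *ᵥ ξ)
        (ν ((MJ ω - Mstar μ φ X₀ Y₀ βbar) *ᵥ ξ))} ≤ 3 / (max p n : ℕ))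
    (hLn : logDim n p ≤ n) (hGL : G * tau n p ≤ 1) (hs₀L : l0Norm βbar * tau n p ≤ 1) :
    1 - δ₁ - δ₂ - δ₃ - 2 / (n : ℝ) - 9 / ((max p n : ℕ) : ℝ) ≤ μ.real {ω |
      |Delta1 μ φ X₀ Y₀ βbar ξ X Y J βhat MJ MJc ω| ≤ delta1Const C₁ C₂ C₃ C₅ C₆ C₇ kx kz kψ *
        (G + A₁ * Real.sqrt (l0Norm βbar) + Real.sqrt (Real.log n) * l0Norm βbar) * tau n p ∧
      |Delta2 μ φ X₀ Y₀ βbar ξ X Y J βhat MJ MJc ω| ≤ delta2Const C₁ C₂ C₃ C₅ C₆ C₇ kx kz kψ *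
        ((n : ℝ) ^ (-(1 / 3) : ℝ) + (Real.sqrt (l0Norm βbar) * tau n p + G * tau n p)) ∧
      0 ≤ A₁ ∧ 0 ≤ G} := by
  have hn2 : (2 : ℝ) ≤ n := by exact_mod_cast hn
  have hn0 : 0 < n := by omega
  have hnN : (n : ℝ) ≤ (max p n : ℕ) := by exact_mod_cast le_max_right p n
  have hpN : (p : ℝ) ≤ (max p n : ℕ) := by exact_mod_cast le_max_left p n
  have hN : (2 : ℝ) ≤ (max p n : ℕ) := hn2.trans hnN
  have hlog : 1 / 4 ≤ Real.log n := by
    have h1 := Real.log_le_log (by norm_num) hn2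
    have h2 := Real.log_two_gt_d9
    linarith
  have hL : Real.log n ≤ logDim n p := Real.log_le_log (by positivity) hnN
  have hL0 : 0 < logDim n p := by linarith
  have hq := l2Norm_pos hξ
  have hs₀ := one_le_l0Norm hβbar
  have hiid := h.isIIDCopies
  have hψm : Measurable fun ω => score φ βbar (X₀ ω, Y₀ ω) :=
    (hφ.measurable_score βbar).comp hiid.measurable₀
  have hkzq : 0 < kz * l2Norm ξ := by positivity
  have hV := le_asympVar_of_subGauss h.measurable_X₀ hψm hkx hkzq hkψ hX hZ hψ hC₅.le hE.2.2.1
    hcond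
  have hV' := asympVar_le h.measurable_X₀ hψm hkzq hkψ hZ hψ
  have hSig : ∀ a, a ⬝ᵥ (secondMoment μ X₀ *ᵥ a) ≤ (a ⬝ᵥ a) / C₃ := fun a =>
    dotProduct_le_of_inv (secondMoment_isSymm μ X₀) hC₃ hE.1 a
  have hB := measure_not_sampleGood hφ hiid hkx hkzq hkψ hX hZ hψ hC₃ hE.2.1 hC₆ hD hN hnN hpN
    hLn hn
  set M := Mstar μ φ X₀ Y₀ βbar with hM
  have hR2 := hRJ.mulVec_le
  have hR3 := hRJc.mulVec_le
  rw [BetaHatRate] at hβ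
  set E₁ := {ω | l1Norm (βhat ω - βbar) ≤ C₁ * l0Norm βbar * Real.sqrt (logDim n p / n) ∧
    (1 / (n : ℝ)) * ∑ i, (X i ω ⬝ᵥ βhat ω - X i ω ⬝ᵥ βbar) ^ 2
      ≤ C₁ * l0Norm βbar * (logDim n p / n)} with hE₁
  set E₂ := {ω | l2Norm ((MJ ω - M) *ᵥ ξ) ≤ C₂ * A₁ * Real.sqrt (logDim n p / n) * l2Norm ξ ∧
    l1Norm ((MJ ω - M) *ᵥ ξ) ≤ C₂ * A₂ * Real.sqrt (logDim n p / n) * l1Norm ξ} with hE₂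
  set E₃ := {ω | l2Norm ((MJc ω - M) *ᵥ ξ) ≤ C₂ * A₁ * Real.sqrt (logDim n p / n) * l2Norm ξ ∧
    l1Norm ((MJc ω - M) *ᵥ ξ) ≤ C₂ * A₂ * Real.sqrt (logDim n p / n) * l1Norm ξ} with hE₃
  have mE : ∀ K : Ω → Matrix (Fin p) (Fin p) ℝ, (∀ j k, Measurable fun ω => K ω j k) →
      MeasurableSet {ω |
        l2Norm ((K ω - M) *ᵥ ξ) ≤ C₂ * A₁ * Real.sqrt (logDim n p / n) * l2Norm ξ ∧
        l1Norm ((K ω - M) *ᵥ ξ) ≤ C₂ * A₂ * Real.sqrt (logDim n p / n) * l1Norm ξ} := by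
    intro K hK
    have hK' := measurable_mulVec_sub hK M ξ
    exact (measurableSet_le (measurable_l2Norm.comp hK') measurable_const).inter
      (measurableSet_le (measurable_l1Norm.comp hK') measurable_const)
  have h12 := sub_add_le_measureReal_inter (μ := μ) (A := E₁) (mE MJ hMJm)
  have h123 := sub_add_le_measureReal_inter (μ := μ) (A := E₁ ∩ E₂) (mE MJc hMJcm)
  set B₁ := {ω | ¬ SampleGood φ βbar ξ (M *ᵥ ξ) (asympVar μ φ X₀ Y₀ βbar ξ)
    kx (kz * l2Norm ξ) kψ (Real.log (max p n : ℕ)) C₆ C₇ (fun i => (X i ω, Y i ω))} with hB₁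
  set B₂ := {ω | ¬ CrossfitGood φ βbar (secondMoment μ X₀) kx kψ (logDim n p)
      (fun i => (X i ω, Y i ω)) J ((MJc ω - M) *ᵥ ξ) (ν ((MJc ω - M) *ᵥ ξ))} with hB₂
  set B₃ := {ω | ¬ CrossfitGood φ βbar (secondMoment μ X₀) kx kψ (logDim n p)
      (fun i => (X i ω, Y i ω)) Jᶜ ((MJ ω - M) *ᵥ ξ) (ν ((MJ ω - M) *ᵥ ξ))} with hB₃
  set T := {ω |
      |Delta1 μ φ X₀ Y₀ βbar ξ X Y J βhat MJ MJc ω| ≤ delta1Const C₁ C₂ C₃ C₅ C₆ C₇ kx kz kψ *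
        (G + A₁ * Real.sqrt (l0Norm βbar) + Real.sqrt (Real.log n) * l0Norm βbar) * tau n p ∧
      |Delta2 μ φ X₀ Y₀ βbar ξ X Y J βhat MJ MJc ω| ≤ delta2Const C₁ C₂ C₃ C₅ C₆ C₇ kx kz kψ *
        ((n : ℝ) ^ (-(1 / 3) : ℝ) + (Real.sqrt (l0Norm βbar) * tau n p + G * tau n p)) ∧
      0 ≤ A₁ ∧ 0 ≤ G} with hT
  have hsub : E₁ ∩ E₂ ∩ E₃ ⊆ T ∪ (B₁ ∪ (B₂ ∪ B₃)) := by
    rintro ω ⟨⟨h1, h2⟩, h3⟩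
    by_cases hb : ω ∈ B₁ ∪ (B₂ ∪ B₃)
    · exact Or.inr hb
    left
    simp only [Set.mem_union, not_or] at hb
    obtain ⟨hb1, hb2, hb3⟩ := hb
    have hr0 : 0 < Real.sqrt (logDim n p / n) := Real.sqrt_pos.2 (by positivity)
    -- the rates hold at `ω`, so the constants in them are nonnegative
    have hpos : ∀ a : ℝ, 0 ≤ C₂ * a * Real.sqrt (logDim n p / n) * l2Norm ξ → 0 ≤ a := by
      intro a ha
      exact nonneg_of_mul_nonneg_right (nonneg_of_mul_nonneg_left
        (nonneg_of_mul_nonneg_left ha hq) hr0) hC₂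
    have key := abs_Delta_le_of_good (J := J) (X := X) (Y := Y) (ω := ω) hφ hn0 hlog hL hs₀ hs₀L
      hGL hC₁ hC₂ hC₃ hC₅ hC₆ hC₇ hkx hkz hkψ hξ hMJ hMJc hV hV' hSig
      (not_not.1 hb1) (not_not.1 hb2) (not_not.1 hb3) (hν _) (hν _) (hνG _ h2.1 h2.2)
      (hνG _ h3.1 h3.2) h2.1 h3.1 h1.1 h1.2
    exact ⟨key.1, key.2, hpos _ ((l2Norm_nonneg _).trans h2.1),
      hpos _ ((hν _).trans (hνG _ h2.1 h2.2))⟩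
  have hfin : μ.real (E₁ ∩ E₂ ∩ E₃) ≤ μ.real T + (μ.real B₁ + (μ.real B₂ + μ.real B₃)) :=
    (measureReal_mono hsub).trans ((measureReal_union_le _ _).trans (add_le_add le_rfl
      ((measureReal_union_le _ _).trans (add_le_add le_rfl (measureReal_union_le _ _)))))
  have e9 : 9 / ((max p n : ℕ) : ℝ) = 3 / ((max p n : ℕ) : ℝ) + (3 / ((max p n : ℕ) : ℝ)
    + 3 / ((max p n : ℕ) : ℝ)) := by ring
  linarith

/-- The sub-gaussian bounds for `ξᵀ M* X₀` in terms of `‖ξ‖₂`, from bounds in terms of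
`‖M* ξ‖₂`. -/
theorem subGauss_proj (hX₀ : Measurable X₀) {σ₁ C₄ : ℝ} (hσ₁ : 0 < σ₁) (hC₃ : 0 < C₃)
    (hC₄ : 0 < C₄) (hξ : ξ ≠ 0)
    (hE : EigenvalueBounds (secondMoment μ X₀) (Mstar μ φ X₀ Y₀ βbar) C₃ C₄)
    (h : SubGauss μ (fun ω => (Mstar μ φ X₀ Y₀ βbar *ᵥ ξ) ⬝ᵥ X₀ ω)
      (2 * σ₁ * l2Norm (Mstar μ φ X₀ Y₀ βbar *ᵥ ξ))) :
    SubGauss μ (fun ω => (Mstar μ φ X₀ Y₀ βbar *ᵥ ξ) ⬝ᵥ X₀ ω) (2 * σ₁ * C₄ * l2Norm ξ) := by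
  have h1 := l2Norm_mulVec_le (Mstar_isSymm μ φ X₀ Y₀ βbar) hC₄
    (fun l hl => hC₃.le.trans (hE.2.1 l hl)) hE.2.2.2 ξ
  have h2 := l2Norm_pos (mulVec_Mstar_ne_zero hC₃ hE.2.1 hξ)
  refine h.mono (measurable_dotProduct measurable_const hX₀) (by positivity) ?_
  calc 2 * σ₁ * l2Norm (Mstar μ φ X₀ Y₀ βbar *ᵥ ξ) ≤ 2 * σ₁ * (C₄ * l2Norm ξ) := by gcongr
    _ = _ := by ring

theorem two_le_of_card_pos (hJ : 0 < J.card) (hJc : 0 < Jᶜ.card) : 2 ≤ n := by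
  have := Finset.card_add_card_compl J
  rw [Fintype.card_fin] at this
  omega

theorem logDim_le (hn : 2 ≤ n) (hβbar : βbar ≠ 0) (h : l0Norm βbar * tau n p ≤ 1) :
    logDim n p ≤ n := by
  have hn1 : (1 : ℝ) ≤ n := by exact_mod_cast (by omega : 1 ≤ n)
  have hs : 0 < Real.sqrt n := Real.sqrt_pos.2 (by linarith)
  have hτ : 0 ≤ tau n p :=
    div_nonneg (Real.log_natCast_nonneg _) (Real.sqrt_nonneg _)
  have h1 : tau n p ≤ 1 := by
    have := mul_le_mul_of_nonneg_right (one_le_l0Norm hβbar) hτ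
    linarith
  rw [tau, div_le_one hs] at h1
  refine h1.trans ?_
  rw [Real.sqrt_le_left (by linarith)]
  exact le_self_pow₀ hn1 two_ne_zero

end Probability

end DebiasedGLM

theorem theorem4
    (cHalf cTwoThirds cOne : ℝ) (hcHalf : 0 < cHalf) (hcTwoThirds : 0 < cTwoThirds)
    (hcOne : 0 < cOne)
    (C₁ C₂ C₃ C₄ C₅ C₆ C₇ σ₁ σ₂ ρ : ℝ)
    (hC₁ : 0 < C₁) (hC₂ : 0 < C₂) (hC₃ : 0 < C₃) (hC₄ : 0 < C₄) (hC₅ : 0 < C₅)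
    (hC₆ : 0 < C₆) (hC₇ : 0 < C₇) (hσ₁ : 0 < σ₁) (hσ₂ : 0 < σ₂) (hρ : 0 < ρ) (hρ' : ρ < 1) :
    ∃ C : ℝ, 0 < C ∧
      ∀ (Ω : Type*) [MeasurableSpace Ω] (μ : Measure Ω) [IsProbabilityMeasure μ]
        (n p : ℕ) (φ : ℝ → ℝ → ℝ) (X₀ : Ω → Fin p → ℝ) (Y₀ : Ω → ℝ)
        (X : Fin n → Ω → Fin p → ℝ) (Y : Fin n → Ω → ℝ) (βbar ξ : Fin p → ℝ)
        (J : Finset (Fin n)) (βhat : Ω → Fin p → ℝ) (MJ MJc : Ω → Matrix (Fin p) (Fin p) ℝ)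
        (δ₁ δ₂ δ₃ A₁ A₂ : ℝ),
        DebiasedGLM.IsLoss φ →
        DebiasedGLM.IsIIDSample μ X₀ Y₀ X Y →
        DebiasedGLM.IsTarget μ φ X₀ Y₀ βbar →
        βbar ≠ 0 →
        ξ ≠ 0 →
        ρ * n < (J.card : ℝ) →
        ρ * n < (Jᶜ.card : ℝ) →
        Measurable βhat →
        DebiasedGLM.BasedOn X Y J MJ →
        DebiasedGLM.BasedOn X Y Jᶜ MJc →
        (∀ ω, (MJ ω).IsSymm) →
        (∀ ω, (MJc ω).IsSymm) →
        DebiasedGLM.BetaHatRate μ X βbar βhat C₁ δ₁ →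
        DebiasedGLM.MhatRate μ n (DebiasedGLM.Mstar μ φ X₀ Y₀ βbar) ξ MJ C₂ A₁ A₂ δ₂ →
        DebiasedGLM.MhatRate μ n (DebiasedGLM.Mstar μ φ X₀ Y₀ βbar) ξ MJc C₂ A₁ A₂ δ₃ →
        DebiasedGLM.EigenvalueBounds (DebiasedGLM.secondMoment μ X₀)
          (DebiasedGLM.Mstar μ φ X₀ Y₀ βbar) C₃ C₄ →
        DebiasedGLM.ScoreCondition μ φ X₀ Y₀ βbar σ₂ C₅ →
        DebiasedGLM.DerivativeBounds μ φ X₀ Y₀ βbar C₆ C₇ →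
        (DebiasedGLM.SubGaussianEntries μ X₀ (DebiasedGLM.Mstar μ φ X₀ Y₀ βbar) ξ σ₁ →
          A₂ * (DebiasedGLM.l1Norm ξ / DebiasedGLM.l2Norm ξ) * DebiasedGLM.tau n p ≤ 1 →
          DebiasedGLM.l0Norm βbar * DebiasedGLM.tau n p ≤ cOne * ρ * Real.sqrt n / 3 →
          DebiasedGLM.l0Norm βbar * DebiasedGLM.tau n p
            ≤ cTwoThirds * (n : ℝ) ^ (1 / 6 : ℝ) / 4 →
          DebiasedGLM.l0Norm βbar * DebiasedGLM.tau n p ≤ 1 →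
          1 - δ₁ - δ₂ - δ₃ - 2 / (n : ℝ) - 12 / ((max p n : ℕ) : ℝ)
              - 2 * Real.exp (-cHalf * (n : ℝ) ^ (1 / 3 : ℝ))
              - 4 * Real.exp (-(1 / 2) * Real.sqrt n)
            ≤ μ.real {ω |
                |DebiasedGLM.Delta1 μ φ X₀ Y₀ βbar ξ X Y J βhat MJ MJc ω|
                  ≤ C * (A₂ * (DebiasedGLM.l1Norm ξ / DebiasedGLM.l2Norm ξ)
                      + A₁ * Real.sqrt (DebiasedGLM.l0Norm βbar)
                      + Real.sqrt (Real.log n) * DebiasedGLM.l0Norm βbar)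
                      * DebiasedGLM.tau n p ∧
                |DebiasedGLM.Delta2 μ φ X₀ Y₀ βbar ξ X Y J βhat MJ MJc ω|
                  ≤ C * ((n : ℝ) ^ (-(1 / 3) : ℝ)
                      + Real.sqrt (DebiasedGLM.l0Norm βbar) * DebiasedGLM.tau n p
                      + A₂ * (DebiasedGLM.l1Norm ξ / DebiasedGLM.l2Norm ξ)
                        * DebiasedGLM.tau n p)}) ∧
        (DebiasedGLM.SubGaussianVector μ X₀ σ₁ →
          A₁ * DebiasedGLM.tau n p ≤ 1 →
          DebiasedGLM.l0Norm βbar * DebiasedGLM.tau n p ≤ cOne * ρ * Real.sqrt n →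
          DebiasedGLM.l0Norm βbar * DebiasedGLM.tau n p ≤ cOne * Real.sqrt n / 2 →
          DebiasedGLM.l0Norm βbar * DebiasedGLM.tau n p
            ≤ cTwoThirds * (n : ℝ) ^ (1 / 6 : ℝ) / 3 →
          DebiasedGLM.l0Norm βbar * DebiasedGLM.tau n p ≤ 1 →
          1 - δ₁ - δ₂ - δ₃ - 2 / (n : ℝ) - 20 / ((max p n : ℕ) : ℝ)
              - 2 * Real.exp (-cHalf * (n : ℝ) ^ (1 / 3 : ℝ))
              - 4 * Real.exp (-(1 / 2) * Real.sqrt n)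
            ≤ μ.real {ω |
                |DebiasedGLM.Delta1 μ φ X₀ Y₀ βbar ξ X Y J βhat MJ MJc ω|
                  ≤ C * (A₁ * Real.sqrt (DebiasedGLM.l0Norm βbar)
                      + Real.sqrt (Real.log n) * DebiasedGLM.l0Norm βbar)
                      * DebiasedGLM.tau n p ∧
                |DebiasedGLM.Delta2 μ φ X₀ Y₀ βbar ξ X Y J βhat MJ MJc ω|
                  ≤ C * ((n : ℝ) ^ (-(1 / 3) : ℝ)
                      + Real.sqrt (DebiasedGLM.l0Norm βbar) * DebiasedGLM.tau n p
                      + A₁ * DebiasedGLM.tau n p)}) := by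
  obtain ⟨kx, hkxdef⟩ : ∃ k, k = 2 * σ₁ := ⟨_, rfl⟩
  obtain ⟨kz, hkzdef⟩ : ∃ k, k = 2 * σ₁ * C₄ := ⟨_, rfl⟩
  obtain ⟨kψ, hkψdef⟩ : ∃ k, k = 2 * σ₂ := ⟨_, rfl⟩
  have hkx : 0 < kx := by rw [hkxdef]; positivity
  have hkz : 0 < kz := by rw [hkzdef]; positivity
  have hkψ : 0 < kψ := by rw [hkψdef]; positivity
  have hc₁ : 0 ≤ DebiasedGLM.delta1Const C₁ C₂ C₃ C₅ C₆ C₇ kx kz kψ :=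
    DebiasedGLM.delta1Const_nonneg hC₁ hC₂ hC₆ hC₇ hkx hkz hkψ
  have hc₂ : 0 ≤ DebiasedGLM.delta2Const C₁ C₂ C₃ C₅ C₆ C₇ kx kz kψ :=
    DebiasedGLM.delta2Const_nonneg hC₁ hC₃ hC₅ hkz hkψ
  obtain ⟨c₁, hc₁def⟩ : ∃ c, c = DebiasedGLM.delta1Const C₁ C₂ C₃ C₅ C₆ C₇ kx kz kψ := ⟨_, rfl⟩
  obtain ⟨c₂, hc₂def⟩ : ∃ c, c = DebiasedGLM.delta2Const C₁ C₂ C₃ C₅ C₆ C₇ kx kz kψ := ⟨_, rfl⟩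
  rw [← hc₁def] at hc₁
  rw [← hc₂def] at hc₂
  -- the factor `2` absorbs the term `A₁ ≤ A₁ √s₀` of the second regime
  refine ⟨2 * c₁ + c₂ + 1, by positivity, ?_⟩
  intro Ω _ μ _ n p φ X₀ Y₀ X Y βbar ξ J βhat MJ MJc δ₁ δ₂ δ₃ A₁ A₂ hφ hiid hT hβbar hξ hJ hJc
    _ hMJb hMJcb hMJ hMJc hβ hRJ hRJc hE hscore hD
  have hcardJ : 0 < J.card := by
    have h0 : 0 ≤ ρ * n := by positivity
    exact_mod_cast h0.trans_lt hJ
  have hcardJc : 0 < Jᶜ.card := by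
    have h0 : 0 ≤ ρ * n := by positivity
    exact_mod_cast h0.trans_lt hJc
  have hn := DebiasedGLM.two_le_of_card_pos hcardJ hcardJc
  have hn0 : 0 < n := by omega
  have hnN : (n : ℝ) ≤ (max p n : ℕ) := by exact_mod_cast le_max_right p n
  have hpN : (p : ℝ) ≤ (max p n : ℕ) := by exact_mod_cast le_max_left p n
  have hN : (2 : ℝ) ≤ (max p n : ℕ) := le_trans (by exact_mod_cast hn) hnN
  have hN0 : (0 : ℝ) < (max p n : ℕ) := by linarith
  have hX₀ := hiid.measurable_X₀
  have hcop := hiid.isIIDCopies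
  have hs₀ := DebiasedGLM.one_le_l0Norm hβbar
  have hτ : 0 ≤ DebiasedGLM.tau n p :=
    div_nonneg (Real.log_natCast_nonneg _) (Real.sqrt_nonneg _)
  have hη : 0 ≤ (n : ℝ) ^ (-(1 / 3) : ℝ) := Real.rpow_nonneg n.cast_nonneg _
  have hψ : DebiasedGLM.SubGauss μ
      (fun ω => DebiasedGLM.score φ βbar (X₀ ω, Y₀ ω)) kψ := by
    rw [hkψdef]
    exact DebiasedGLM.subGauss_of_psi2Norm_le
      ((hφ.measurable_score βbar).comp hcop.measurable₀) hσ₂ hscore.1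
  have hMJm := hMJb.measurable hiid
  have hMJcm := hMJcb.measurable hiid
  have hu := DebiasedGLM.l2Norm_pos (DebiasedGLM.mulVec_Mstar_ne_zero hC₃ hE.2.1 hξ)
  constructor
  · intro hsub hGL _ _ hs₀L
    have hX : ∀ j, DebiasedGLM.SubGauss μ (fun ω => X₀ ω j) kx := fun j => by
      rw [hkxdef]
      exact DebiasedGLM.subGauss_of_psi2Norm_le ((measurable_pi_apply j).comp hX₀) hσ₁ (hsub.1 j)
    have hZ : DebiasedGLM.SubGauss μ
        (fun ω => (DebiasedGLM.Mstar μ φ X₀ Y₀ βbar *ᵥ ξ) ⬝ᵥ X₀ ω)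
        (kz * DebiasedGLM.l2Norm ξ) := by
      have h1 := hsub.2
      simp only [DebiasedGLM.dotProduct_mulVec_comm (DebiasedGLM.Mstar_isSymm μ φ X₀ Y₀ βbar)]
        at h1
      have h2 := DebiasedGLM.subGauss_of_psi2Norm_le
        (DebiasedGLM.measurable_dotProduct measurable_const hX₀) (mul_pos hσ₁ hu) h1
      rw [← mul_assoc] at h2
      rw [hkzdef]
      exact DebiasedGLM.subGauss_proj hX₀ hσ₁ hC₃ hC₄ hξ hE h2
    have hLn := DebiasedGLM.logDim_le hn hβbar hs₀L
    have hgood : ∀ (s : Finset (Fin n)) (a : Ω → Fin p → ℝ),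
        μ.real {ω | ¬ DebiasedGLM.CrossfitGood φ βbar (DebiasedGLM.secondMoment μ X₀) kx kψ
          (DebiasedGLM.logDim n p) (fun i => (X i ω, Y i ω)) s (a ω)
          (DebiasedGLM.l1Norm (a ω))} ≤ 3 / (max p n : ℕ) := by
      intro s a
      refine le_trans (measureReal_mono ?_)
        (DebiasedGLM.measure_not_crossfitGood_l1 hφ hcop hT hkx hkψ hX hψ hN hnN hpN hLn hn0 s)
      exact fun ω hω hall => hω (hall (a ω))
    have hq := DebiasedGLM.l2Norm_pos hξ
    have key := DebiasedGLM.le_measureReal_abs_Delta_le (J := J) hφ hiid hβbar hξ hn hMJm hMJcm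
      hMJ hMJc hC₁ hC₂ hC₃ hC₅ hC₆ hC₇ hkx hkz hkψ hβ hRJ hRJc hE hscore.2 hD hX hZ hψ
      DebiasedGLM.l1Norm_nonneg (G := A₂ * (DebiasedGLM.l1Norm ξ / DebiasedGLM.l2Norm ξ))
      (fun a _ ha => ha.trans (le_of_eq (by field_simp)))
      (hgood J _) (hgood Jᶜ _) hLn hGL hs₀L
    rw [← hc₁def, ← hc₂def] at key
    -- the exceptional probability `2/n + 9/N` is within the allowance
    have hpr : 1 - δ₁ - δ₂ - δ₃ - 2 / (n : ℝ) - 12 / ((max p n : ℕ) : ℝ)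
        - 2 * Real.exp (-cHalf * (n : ℝ) ^ (1 / 3 : ℝ)) - 4 * Real.exp (-(1 / 2) * Real.sqrt n) ≤
        1 - δ₁ - δ₂ - δ₃ - 2 / (n : ℝ) - 9 / ((max p n : ℕ) : ℝ) := by
      have h1 := Real.exp_nonneg (-cHalf * (n : ℝ) ^ (1 / 3 : ℝ))
      have h2 := Real.exp_nonneg (-(1 / 2) * Real.sqrt n)
      have h3 : 9 / ((max p n : ℕ) : ℝ) ≤ 12 / ((max p n : ℕ) : ℝ) := by gcongr; norm_num
      linarith
    refine (hpr.trans key).trans (measureReal_mono ?_)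
    rintro ω ⟨h1, h2, hA, hG⟩
    refine ⟨h1.trans ?_, h2.trans ?_⟩
    · gcongr
      linarith
    · rw [← add_assoc]
      gcongr
      linarith
  · intro hsub hGL _ _ _ hs₀L
    have hX : ∀ j, DebiasedGLM.SubGauss μ (fun ω => X₀ ω j) kx := fun j => by
      rw [hkxdef]
      exact hsub.subGauss_apply hX₀ hσ₁ j
    have hXa : ∀ a : Fin p → ℝ, a ≠ 0 →
        DebiasedGLM.SubGauss μ (fun ω => a ⬝ᵥ X₀ ω) (kx * DebiasedGLM.l2Norm a) := fun a ha => by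
      rw [hkxdef]
      exact hsub.subGauss hX₀ hσ₁ ha
    have hZ : DebiasedGLM.SubGauss μ
        (fun ω => (DebiasedGLM.Mstar μ φ X₀ Y₀ βbar *ᵥ ξ) ⬝ᵥ X₀ ω)
        (kz * DebiasedGLM.l2Norm ξ) := by
      rw [hkzdef]
      exact DebiasedGLM.subGauss_proj hX₀ hσ₁ hC₃ hC₄ hξ hE
        (hsub.subGauss hX₀ hσ₁ (DebiasedGLM.mulVec_Mstar_ne_zero hC₃ hE.2.1 hξ))
    have hLn := DebiasedGLM.logDim_le hn hβbar hs₀L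
    have key := DebiasedGLM.le_measureReal_abs_Delta_le (J := J) hφ hiid hβbar hξ hn hMJm hMJcm
      hMJ hMJc hC₁ hC₂ hC₃ hC₅ hC₆ hC₇ hkx hkz hkψ hβ hRJ hRJc hE hscore.2 hD hX hZ hψ
      DebiasedGLM.l2Norm_nonneg (G := A₁) (fun a ha _ => ha)
      (DebiasedGLM.measure_not_crossfitGood_l2 hφ hcop hT hkx hkψ hX hXa hψ hN hnN hLn hn0
        disjoint_compl_left (DebiasedGLM.measurable_mulVec_sub hMJcb _ ξ))
      (DebiasedGLM.measure_not_crossfitGood_l2 hφ hcop hT hkx hkψ hX hXa hψ hN hnN hLn hn0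
        disjoint_compl_right (DebiasedGLM.measurable_mulVec_sub hMJb _ ξ)) hLn hGL hs₀L
    rw [← hc₁def, ← hc₂def] at key
    have hpr : 1 - δ₁ - δ₂ - δ₃ - 2 / (n : ℝ) - 20 / ((max p n : ℕ) : ℝ)
        - 2 * Real.exp (-cHalf * (n : ℝ) ^ (1 / 3 : ℝ)) - 4 * Real.exp (-(1 / 2) * Real.sqrt n) ≤
        1 - δ₁ - δ₂ - δ₃ - 2 / (n : ℝ) - 9 / ((max p n : ℕ) : ℝ) := by
      have h1 := Real.exp_nonneg (-cHalf * (n : ℝ) ^ (1 / 3 : ℝ))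
      have h2 := Real.exp_nonneg (-(1 / 2) * Real.sqrt n)
      have h3 : 9 / ((max p n : ℕ) : ℝ) ≤ 20 / ((max p n : ℕ) : ℝ) := by gcongr; norm_num
      linarith
    refine (hpr.trans key).trans (measureReal_mono ?_)
    rintro ω ⟨h1, h2, hA, -⟩
    refine ⟨h1.trans ?_, h2.trans ?_⟩
    · refine mul_le_mul_of_nonneg_right ?_ hτ
      have g1 : A₁ ≤ A₁ * Real.sqrt (DebiasedGLM.l0Norm βbar) :=
        le_mul_of_one_le_right hA (Real.one_le_sqrt.2 hs₀)
      set S := A₁ * Real.sqrt (DebiasedGLM.l0Norm βbar) +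
        Real.sqrt (Real.log n) * DebiasedGLM.l0Norm βbar with hS
      have g2 : 0 ≤ Real.sqrt (Real.log n) * DebiasedGLM.l0Norm βbar := by positivity
      have g3 : A₁ ≤ S := by linarith
      calc c₁ * (A₁ + A₁ * Real.sqrt (DebiasedGLM.l0Norm βbar) +
            Real.sqrt (Real.log n) * DebiasedGLM.l0Norm βbar) = c₁ * (A₁ + S) := by
            rw [hS]; ring
        _ ≤ c₁ * (S + S) := by gcongr
        _ = 2 * c₁ * S := by ring
        _ ≤ (2 * c₁ + c₂ + 1) * S := by gcongr; linarith
    · rw [← add_assoc]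
      gcongr
      linarith
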